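/- **Theorem 1 (a single gauge field).** Units: $8\pi G=c=1$. Consider spatially homogeneous, orthogonal spacetimes $I\times\Sigma$, $I\subseteq\mathbb R$ an open interval, with line element $ds^2=-dt^2+h_{ab}(t)\,W^aW^b$, where $\Sigma=G/H$ is a (locally) homogeneous Riemannian three-space, $G$ is a group acting transitively and effectively on the slices by isometries, and $\{W^a\}$ is an invariant coframe. Let $u=\partial_t$, $3H=\nabla_\mu u^\mu$, $\sigma_{\mu\nu}=\nabla_{(\nu}u_{\mu)}-Hh_{\mu\nu}$, and let $a(t)>0$ with $\dot a=Ha$ be a scale factor. A *shear-free solution with a single gauge field* consists of such a spacetime with - anisotropic spatial curvature: the traceless Ricci tensor ${}^3S_{ab}={}^3R_{ab}-\tfrac13{}^3R\,h_{ab}$ of the slices is not identically zero; - shear-free expansion: $\sigma_{\mu\nu}=0$, and $H$ is not identically zero; - finitely many comoving perfect fluids with total energy density $\rho(t)$ and total pressure $P(t)$, and conserved total energy-momentum tensor (no equation of state or energy condition is imposed); - one $p$-form gauge field, $p\in\{0,1,2,3\}$, with homogeneous $(p+1)$-form field strength $\mathcal F$ (locally $\mathcal F=d\mathcal A$, i.e.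 $d\mathcal F=0$), action $\mp\frac12\int\mathcal F\wedge\star\mathcal F$ (upper sign: canonical; lower sign: equivalently, purely imaginary $\mathcal F$), equation of motion $d\star\mathcal F=0$, energy-momentum tensor $$T^{\mathcal A}_{\mu\nu}=\pm\Big(\tfrac1{p!}\mathcal F_\mu{}^{\alpha_1\dots\alpha_p}\mathcal F_{\nu\alpha_1\dots\alpha_p}-\tfrac1{2(p+1)!}g_{\mu\nu}\mathcal F^{\alpha_1\dots\alpha_{p+1}}\mathcal F_{\alpha_1\dots\alpha_{p+1}}\Big),$$ energy density $\rho_{\mathcal A}=u^\mu u^\nu T^{\mathcal A}_{\mu\nu}$ and vanishing energy flux relative to $u$; such that Einstein's equation $G_{\mu\nu}=T_{\mu\nu}$ holds with the sum of the energy-momentum tensors. For a Bianchi model write the structure constants of the simply transitive group as $C_{ab}{}^d=\epsilon_{abe}N^{ed}+A_e(\delta^e_a\delta^d_b-\delta^e_b\delta^d_a)$; type III is $A=(1,0,0)$, $N=\mathrm{diag}(0,1,-1)$ and type VI$_0$ is $A=0$, $N=\mathrm{diag}(0,1,-1)$ in a suitable basis. LRS (locally rotationally symmetric) means that the spacetime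 locally admits a group of isometries, containing the given one, that is transitive on the slices and has non-trivial isotropy. Kantowski–Sachs spacetimes have slices $\mathbb R\times S^2$ (locally) with the symmetry group $\mathbb R\times SO(3)$. Then a shear-free spacetime of this class with $H\not\equiv0$ admits a shear-free solution with a single gauge field if and only if it is LRS Bianchi type III with $N^a{}_a=h_{ab}N^{ab}=0$, Bianchi type VI$_0$ with $N^a{}_a=0$, or Kantowski–Sachs; each of the three cases occurs. In every such solution the effective curvature $K_{\rm eff}=\frac{a^2}{6}\big({}^3R-2\rho_{\mathcal A}\big)$ is constant, and the expansion history is that of an FLRW model with the same perfect fluids and curvature constant $K_{\rm eff}$, $$H^2+\frac{K_{\rm eff}}{a^2}=\frac\rho3,\qquad \dot H+H^2=-\frac16(\rho+3P),\qquad \dot\rho+3H(\rho+P)=0,$$ where $K_{\rm eff}<0$ (open) for LRS Bianchi III, $K_{\rm eff}=0$ (flat) for Bianchi VI$_0$ and $K_{\rm eff}>0$ (closed) for Kantowski–Sachs. -/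

import Mathlib

noncomputable section

/-! ## Frames: connection, curvature and covariant derivative

A frame `e_μ` in which every homogeneous tensor field has components depending on `t` only.
-/

/-- Geometry written in a frame `e_μ`, `μ : ι`.
* `dir μ`: the frame vector `e_μ` acts on functions of `t` as `dir μ • d/dt`;
* `D μ ν κ`: the `e_κ`-component of the commutator `[e_μ, e_ν]`;
* `Om μ ν ρ κ`: the `e_κ`-component of `[Z, e_ρ]`, where `Z` is the isotropy part of `[e_μ, e_ν]`
  (zero if the frame consists of honest vector fields on the space, i.e. without isotropy);
* `g t μ ν`: the metric components `g(e_μ, e_ν)`. -/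
structure FrameGeometry (ι : Type) where
  dir : ι → ℝ
  D : ι → ι → ι → ℝ
  Om : ι → ι → ι → ι → ℝ
  g : ℝ → Matrix ι ι ℝ

namespace FrameGeometry

variable {ι : Type} [Fintype ι] [DecidableEq ι] (G : FrameGeometry ι)

/-- `e_μ f`. -/
def act (μ : ι) (f : ℝ → ℝ) (t : ℝ) : ℝ := G.dir μ * deriv f t

/-- `g([e_μ, e_ν], e_κ)`. -/
def commLow (μ ν κ : ι) (t : ℝ) : ℝ := ∑ σ, G.D μ ν σ * G.g t σ κ

/-- Koszul's formula: `g(∇_{e_μ} e_ν, e_κ)`. -/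
def connLow (μ ν κ : ι) (t : ℝ) : ℝ :=
  (G.act μ (fun s => G.g s ν κ) t + G.act ν (fun s => G.g s κ μ) t
    - G.act κ (fun s => G.g s μ ν) t
    + G.commLow μ ν κ t - G.commLow ν κ μ t + G.commLow κ μ ν t) / 2

/-- Levi-Civita connection: the `e_κ`-component of `∇_{e_μ} e_ν`. -/
def conn (μ ν κ : ι) (t : ℝ) : ℝ := ∑ σ, G.connLow μ ν σ t * (G.g t)⁻¹ σ κ

/-- Riemann tensor: the `e_κ`-component of
`R(e_μ, e_ν) e_ρ = ∇_μ ∇_ν e_ρ - ∇_ν ∇_μ e_ρ - ∇_{[e_μ, e_ν]} e_ρ`. The last term is the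
contribution of the isotropy part of the commutator. -/
def riemann (μ ν ρ κ : ι) (t : ℝ) : ℝ :=
  G.act μ (G.conn ν ρ κ) t - G.act ν (G.conn μ ρ κ) t
    + ∑ σ, (G.conn ν ρ σ t * G.conn μ σ κ t - G.conn μ ρ σ t * G.conn ν σ κ t
        - G.D μ ν σ * G.conn σ ρ κ t)
    - G.Om μ ν ρ κ

/-- Ricci tensor `Ric(e_ν, e_ρ)` (positive on round spheres). -/
def ricci (ν ρ : ι) (t : ℝ) : ℝ := ∑ μ, G.riemann μ ν ρ μ t

/-- Ricci scalar. -/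
def scalar (t : ℝ) : ℝ := ∑ ν, ∑ ρ, (G.g t)⁻¹ ν ρ * G.ricci ν ρ t

/-- Einstein tensor. -/
def einstein (μ ν : ι) (t : ℝ) : ℝ := G.ricci μ ν t - G.g t μ ν * G.scalar t / 2

/-- `∇_μ T_{ν₁ … ν_k}` for a covariant tensor of rank `k`. -/
def cov {k : ℕ} (T : ℝ → (Fin k → ι) → ℝ) (μ : ι) (ν : Fin k → ι) (t : ℝ) : ℝ :=
  G.act μ (fun s => T s ν) t
    - ∑ i, ∑ σ, G.conn μ (ν i) σ t * T t (Function.update ν i σ)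

/-- `∇^μ T_{μ ν₁ … ν_k}`. -/
def divergence {k : ℕ} (T : ℝ → (Fin (k + 1) → ι) → ℝ) (ν : Fin k → ι) (t : ℝ) : ℝ :=
  ∑ μ, ∑ κ, (G.g t)⁻¹ μ κ * G.cov T μ (Fin.cons κ ν) t

/-- Exterior derivative `(dF)_{ν₀ … ν_k} = ∑ᵢ (-1)ⁱ ∇_{νᵢ} F_{ν₀ … ν̂ᵢ … ν_k}` of a `k`-form. -/
def extDeriv {k : ℕ} (F : ℝ → (Fin k → ι) → ℝ) (ν : Fin (k + 1) → ι) (t : ℝ) : ℝ :=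
  ∑ i : Fin (k + 1), (-1 : ℝ) ^ (i : ℕ) * G.cov F (ν i) (fun j => ν (i.succAbove j)) t

/-- Full contraction `P_{α₁ … α_k} Q^{α₁ … α_k}`. -/
def contract {k : ℕ} (P Q : (Fin k → ι) → ℝ) (t : ℝ) : ℝ :=
  ∑ α : Fin k → ι, ∑ β : Fin k → ι, (∏ i, (G.g t)⁻¹ (α i) (β i)) * P α * Q β

end FrameGeometry

/-! ## Homogeneous three-spaces -/

/-- A (locally) homogeneous three-dimensional space `G/H`, described by the Lie algebra `𝔤` of a
transitive, effective group of isometries and its isotropy subalgebra `iso`. `E 0, E 1, E 2` is a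
frame of an `ad(iso)`-invariant complement of `iso` (such a complement exists because the isotropy
group of a Riemannian metric is compact) and `W` is the dual coframe, which vanishes on `iso`.
If `iso = ⊥`, then `G` is simply transitive (a Bianchi model) and `E` is a left-invariant frame. -/
structure HomogeneousSpace (𝔤 : Type) [LieRing 𝔤] [LieAlgebra ℝ 𝔤] where
  iso : LieSubalgebra ℝ 𝔤
  E : Fin 3 → 𝔤
  W : Fin 3 → (𝔤 →ₗ[ℝ] ℝ)
  W_E : ∀ a b, W a (E b) = if a = b then 1 else 0
  mem_iso : ∀ Z, Z ∈ iso ↔ ∀ a, W a Z = 0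
  reductive : ∀ Z ∈ iso, ∀ a, ⁅Z, E a⁆ = ∑ b, W b ⁅Z, E a⁆ • E b
  effective : ∀ Z ∈ iso, (∀ a, ⁅Z, E a⁆ = 0) → Z = 0

namespace HomogeneousSpace

variable {𝔤 : Type} [LieRing 𝔤] [LieAlgebra ℝ 𝔤] (S : HomogeneousSpace 𝔤)

/-- Commutation constants of the frame, `[E_a, E_b] = D_{ab}^c E_c` modulo isotropy. -/
def D (a b c : Fin 3) : ℝ := S.W c ⁅S.E a, S.E b⁆

/-- Isotropy part of an element of `𝔤`. -/
def isoPart (Z : 𝔤) : 𝔤 := Z - ∑ c, S.W c Z • S.E c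

/-- The `E_c`-component of `[Z, E_d]`, where `Z` is the isotropy part of `[E_a, E_b]`. -/
def Om (a b d c : Fin 3) : ℝ := S.W c ⁅S.isoPart ⁅S.E a, S.E b⁆, S.E d⁆

end HomogeneousSpace

/-! ## Spatially homogeneous, orthogonal cosmologies -/

/-- Spacetime frame indices: `none` is the time direction `e_0 = ∂_t`, `some a` is `E_a`. -/
abbrev SIdx : Type := Option (Fin 3)

/-- A spatially homogeneous spacetime `I × G/H` with line element
`ds² = -dt² + h_{ab}(t) W^a W^b`, the normal `∂_t` of the homogeneous slices being the
four-velocity of the matter. -/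
structure Cosmology {𝔤 : Type} [LieRing 𝔤] [LieAlgebra ℝ 𝔤] (S : HomogeneousSpace 𝔤) where
  I : Set ℝ
  isOpen : IsOpen I
  nonempty : I.Nonempty
  ordConnected : I.OrdConnected
  h : ℝ → Matrix (Fin 3) (Fin 3) ℝ
  smooth : ∀ a b, ContDiffOn ℝ (⊤ : ℕ∞) (fun t => h t a b) I
  posDef : ∀ t ∈ I, (h t).PosDef
  invariant : ∀ Z ∈ S.iso, ∀ t ∈ I, ∀ a b,
    ∑ c, (S.W c ⁅Z, S.E a⁆ * h t c b + S.W c ⁅Z, S.E b⁆ * h t a c) = 0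

namespace Cosmology

variable {𝔤 : Type} [LieRing 𝔤] [LieAlgebra ℝ 𝔤] {S : HomogeneousSpace 𝔤} (M : Cosmology S)

/-- Intrinsic geometry of the slices. -/
def spatial : FrameGeometry (Fin 3) where
  dir _ := 0
  D := S.D
  Om := S.Om
  g := M.h

/-- Spacetime metric `-dt² + h_{ab}(t) W^a W^b`. -/
def metric (t : ℝ) : Matrix SIdx SIdx ℝ
  | none, none => -1
  | some a, some b => M.h t a b
  | _, _ => 0

/-- Spacetime geometry; `∂_t` commutes with the spatial frame. -/
def spacetime : FrameGeometry SIdx where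
  dir
    | none => 1
    | some _ => 0
  D
    | some a, some b, some c => S.D a b c
    | _, _, _ => 0
  Om
    | some a, some b, some d, some c => S.Om a b d c
    | _, _, _, _ => 0
  g := M.metric

/-- `u_μ`, the covector of `u = ∂_t`. -/
def u : SIdx → ℝ
  | none => -1
  | some _ => 0

/-- `∇_μ u_ν`. -/
def gradU (μ ν : SIdx) (t : ℝ) : ℝ := M.spacetime.cov (fun _ (κ : Fin 1 → SIdx) => u (κ 0)) μ ![ν] t

/-- Hubble scalar, `3H = ∇_μ u^μ`. -/
def H (t : ℝ) : ℝ := (∑ μ, ∑ ν, (M.metric t)⁻¹ μ ν * M.gradU μ ν t) / 3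

/-- Shear tensor, `σ_{μν} = ∇_{(ν} u_{μ)} - H h_{μν}` with `h_{μν} = g_{μν} + u_μ u_ν`. -/
def shear (μ ν : SIdx) (t : ℝ) : ℝ :=
  (M.gradU μ ν t + M.gradU ν μ t) / 2 - M.H t * (M.metric t μ ν + u μ * u ν)

/-- Traceless three-dimensional Ricci tensor of the slices. -/
def tracelessRicci (a b : Fin 3) (t : ℝ) : ℝ :=
  M.spatial.ricci a b t - M.spatial.scalar t / 3 * M.h t a b

/-- Anisotropic spatial curvature. -/
def Anisotropic : Prop := ∃ t ∈ M.I, ∃ a b, M.tracelessRicci a b t ≠ 0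

/-- The congruence `u` is shear-free. -/
def ShearFree : Prop := ∀ t ∈ M.I, ∀ μ ν, M.shear μ ν t = 0

/-- The model is not static. -/
def Expanding : Prop := ∃ t ∈ M.I, M.H t ≠ 0

/-- A scale factor: `a > 0`, `ȧ = H a`. -/
def IsScaleFactor (a : ℝ → ℝ) : Prop :=
  ∀ t ∈ M.I, 0 < a t ∧ HasDerivAt a (M.H t * a t) t

end Cosmology

/-! ## Matter -/

/-- One free `p`-form gauge field, `0 ≤ p ≤ 3`, through its homogeneous field strength
`F = d𝒜`, a `(p+1)`-form; a (local) potential exists exactly if `dF = 0`, and need not be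
homogeneous itself. The action is `sgn • (-½ ∫ F ∧ ⋆F)` with `sgn = 1` (canonical sign) or
`sgn = -1` (purely imaginary field strength). -/
structure GaugeField {𝔤 : Type} [LieRing 𝔤] [LieAlgebra ℝ 𝔤] {S : HomogeneousSpace 𝔤}
    (M : Cosmology S) where
  p : ℕ
  p_le : p ≤ 3
  sgn : ℝ
  sgn_eq : sgn = 1 ∨ sgn = -1
  F : ℝ → (Fin (p + 1) → SIdx) → ℝ
  smooth : ∀ μ, ContDiffOn ℝ (⊤ : ℕ∞) (fun t => F t μ) M.I
  alternating : ∀ t ∈ M.I, ∀ (τ : Equiv.Perm (Fin (p + 1))) (μ : Fin (p + 1) → SIdx),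
    F t (fun i => μ (τ i)) = ((Equiv.Perm.sign τ : ℤ) : ℝ) * F t μ
  /- invariance under the isotropy group, so that `F` is a field on `I × G/H` -/
  invariant : ∀ Z ∈ S.iso, ∀ t ∈ M.I, ∀ μ : Fin (p + 1) → SIdx,
    ∑ i, (match μ i with
      | none => 0
      | some a => ∑ c, S.W c ⁅Z, S.E a⁆ * F t (Function.update μ i (some c))) = 0
  /- Bianchi identity `dF = 0` -/
  closed : ∀ t ∈ M.I, ∀ ν, M.spacetime.extDeriv F ν t = 0
  /- equation of motion `d⋆F = 0`, i.e. `∇^μ F_{μ ν₁ … ν_p} = 0` -/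
  eom : ∀ t ∈ M.I, ∀ ν, M.spacetime.divergence F ν t = 0

namespace GaugeField

variable {𝔤 : Type} [LieRing 𝔤] [LieAlgebra ℝ 𝔤] {S : HomogeneousSpace 𝔤} {M : Cosmology S}
  (A : GaugeField M)

/-- Energy-momentum tensor
`(1/p!) F_μ^{α…} F_{να…} - (1/(2(p+1)!)) g_{μν} F^{α…} F_{α…}`, times the sign of the action. -/
def T (μ ν : SIdx) (t : ℝ) : ℝ :=
  A.sgn * (M.spacetime.contract (fun α : Fin A.p → SIdx => A.F t (Fin.cons μ α))
      (fun α => A.F t (Fin.cons ν α)) t / (A.p.factorial : ℝ)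
    - M.metric t μ ν * M.spacetime.contract (A.F t) (A.F t) t / (2 * ((A.p + 1).factorial : ℝ)))

/-- Energy density `u^μ u^ν T_{μν}` seen by the observers `u = ∂_t`. -/
def energyDensity (t : ℝ) : ℝ := A.T none none t

/-- Vanishing energy flux, `h^{γμ} u^ν T_{μν} = 0`. -/
def Comoving : Prop := ∀ t ∈ M.I, ∀ a, A.T (some a) none t = 0

end GaugeField

/-- A finite collection of comoving perfect fluids whose total energy-momentum tensor is
conserved. No equation of state and no energy condition is imposed. -/
structure PerfectFluids {𝔤 : Type} [LieRing 𝔤] [LieAlgebra ℝ 𝔤] {S : HomogeneousSpace 𝔤}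
    (M : Cosmology S) where
  m : ℕ
  rho : Fin m → ℝ → ℝ
  P : Fin m → ℝ → ℝ
  smooth_rho : ∀ l, ContDiffOn ℝ (⊤ : ℕ∞) (rho l) M.I
  smooth_P : ∀ l, ContDiffOn ℝ (⊤ : ℕ∞) (P l) M.I
  conserved : ∀ t ∈ M.I, ∀ ν : Fin 1 → SIdx,
    M.spacetime.divergence (fun s (κ : Fin 2 → SIdx) => ∑ l,
      ((rho l s + P l s) * (Cosmology.u (κ 0) * Cosmology.u (κ 1))
        + P l s * M.metric s (κ 0) (κ 1))) ν t = 0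

namespace PerfectFluids

variable {𝔤 : Type} [LieRing 𝔤] [LieAlgebra ℝ 𝔤] {S : HomogeneousSpace 𝔤} {M : Cosmology S}
  (f : PerfectFluids M)

/-- Total energy-momentum tensor `∑ (ρ + P) u_μ u_ν + P g_{μν}` of the fluids. -/
def T (μ ν : SIdx) (t : ℝ) : ℝ :=
  ∑ l, ((f.rho l t + f.P l t) * (Cosmology.u μ * Cosmology.u ν) + f.P l t * M.metric t μ ν)

/-- Total energy density. -/
def totalRho (t : ℝ) : ℝ := ∑ l, f.rho l t

/-- Total pressure. -/
def totalP (t : ℝ) : ℝ := ∑ l, f.P l t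

end PerfectFluids

/-- A shear-free solution of Einstein's equation (`8πG = c = 1`) with a single gauge field on the
spatially homogeneous spacetime `M`. -/
structure ShearFreeSolution {𝔤 : Type} [LieRing 𝔤] [LieAlgebra ℝ 𝔤] {S : HomogeneousSpace 𝔤}
    (M : Cosmology S) where
  anisotropic : M.Anisotropic
  shearFree : M.ShearFree
  expanding : M.Expanding
  fluids : PerfectFluids M
  gauge : GaugeField M
  comoving : gauge.Comoving
  einstein : ∀ t ∈ M.I, ∀ μ ν, M.spacetime.einstein μ ν t = fluids.T μ ν t + gauge.T μ ν t

namespace ShearFreeSolution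

variable {𝔤 : Type} [LieRing 𝔤] [LieAlgebra ℝ 𝔤] {S : HomogeneousSpace 𝔤} {M : Cosmology S}
  (s : ShearFreeSolution M)

/-- Effective curvature `a²/6 (³R - 2 ρ_𝒜)` for the scale factor `a`. -/
def Keff (a : ℝ → ℝ) (t : ℝ) : ℝ :=
  a t ^ 2 / 6 * (M.spatial.scalar t - 2 * s.gauge.energyDensity t)

/-- The expansion history is that of an FLRW model with the same perfect fluids and curvature
constant `K` with property `Q`, where `K = K_eff`. -/
def ExpandsAsFLRW (Q : ℝ → Prop) : Prop :=
  (∃ a, M.IsScaleFactor a) ∧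
  ∀ a, M.IsScaleFactor a → ∃ K, Q K ∧ ∀ t ∈ M.I,
    s.Keff a t = K ∧
    M.H t ^ 2 + K / a t ^ 2 = s.fluids.totalRho t / 3 ∧
    HasDerivAt M.H (-(s.fluids.totalRho t + 3 * s.fluids.totalP t) / 6 - M.H t ^ 2) t ∧
    HasDerivAt s.fluids.totalRho
      (-3 * M.H t * (s.fluids.totalRho t + s.fluids.totalP t)) t

end ShearFreeSolution

/-! ## The spacetimes in the classification -/

/-- Totally antisymmetric symbol with `ε_{123} = 1`. -/
def epsilon (a b c : Fin 3) : ℝ :=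
  Matrix.det (Matrix.of ![(Pi.single a 1 : Fin 3 → ℝ), Pi.single b 1, Pi.single c 1])

/-- Behr decomposition `C_{ab}^d = ε_{abe} N^{ed} + A_e (δ^e_a δ^d_b - δ^e_b δ^d_a)`. -/
def behr (A : Fin 3 → ℝ) (N : Matrix (Fin 3) (Fin 3) ℝ) (a b d : Fin 3) : ℝ :=
  ∑ e, epsilon a b e * N e d + (A a * (if d = b then 1 else 0) - A b * (if d = a then 1 else 0))

namespace Cosmology

variable {𝔤 : Type} [LieRing 𝔤] [LieAlgebra ℝ 𝔤] {S : HomogeneousSpace 𝔤} (M : Cosmology S)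

/-- The spacetime is a Bianchi model whose Lie algebra has the Behr decomposition `(A, N)`, of the
subtype `N^a_a = h_{ab} N^{ab} = 0`: some three-dimensional subalgebra of `𝔤`, spanned by
`Y_0, Y_1, Y_2`, is transversal to the isotropy (simply transitive on the slices). The frame
commutators are `D_{ab}^c = -C_{ab}^c`. -/
def IsTracefreeBianchi (A : Fin 3 → ℝ) (N : Matrix (Fin 3) (Fin 3) ℝ) : Prop :=
  ∃ Y : Fin 3 → 𝔤,
    (∀ a b, ⁅Y a, Y b⁆ = ∑ d, (-behr A N a b d) • Y d) ∧
    (Matrix.of fun a b => S.W a (Y b)).det ≠ 0 ∧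
    ∀ t ∈ M.I, ∑ a, ∑ b, N a b * (∑ c, ∑ d, S.W c (Y a) * S.W d (Y b) * M.h t c d) = 0

/-- Local rotational symmetry: locally, the spacetime admits a transitive group of isometries of
the slices that contains the given one and has a non-trivial isotropy group. -/
def IsLRS : Prop :=
  ∃ (𝔨 : Type) (_ : LieRing 𝔨) (_ : LieAlgebra ℝ 𝔨) (S' : HomogeneousSpace 𝔨)
    (M' : Cosmology S') (f : 𝔤 →ₗ⁅ℝ⁆ 𝔨),
    S'.iso ≠ ⊥ ∧ (∀ a Z, S'.W a (f Z) = S.W a Z) ∧ M'.I = M.I ∧ ∀ t ∈ M.I, M'.h t = M.h t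

/-- LRS Bianchi type III with `N^a_a = 0`. -/
def IsLRSBianchiIII : Prop :=
  M.IsLRS ∧ M.IsTracefreeBianchi ![1, 0, 0] (Matrix.diagonal ![0, 1, -1])

/-- Bianchi type VI₀ with `N^a_a = 0`. -/
def IsBianchiVI0 : Prop := M.IsTracefreeBianchi 0 (Matrix.diagonal ![0, 1, -1])

/-- Kantowski-Sachs: the symmetry algebra is `ℝ ⊕ so(3)`, with isotropy `so(2) ⊆ so(3)`, i.e. the
slices are `ℝ × S²` with `ℝ × SO(3)` acting in the standard way. -/
def IsKantowskiSachs (_M : Cosmology S) : Prop :=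
  ∃ b : Module.Basis (Option (Fin 3)) ℝ 𝔤,
    (∀ a, ⁅b none, b (some a)⁆ = 0) ∧
    (∀ a c, ⁅b (some a), b (some c)⁆ = ∑ d, epsilon a c d • b (some d)) ∧
    S.iso.toSubmodule = Submodule.span ℝ {b (some 2)}

end Cosmology

end

/-! Vanishing shear means ḣ = 2Hh, so h(t) = φ(t) h(t₀) on the whole interval (`h_eq_smul`), and the
connection and Ricci tensor of the slices do not depend on time. Fluids have isotropic stress, so
Einstein's equation makes the trace-free Ricci tensor of the slices equal to the trace-free stress
of the gauge field, which must therefore be nonzero and the same at all times.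

This decides the degree. A four-form field strength has isotropic stress (`p_ne_three`). For a
two-form, vanishing energy flux makes the electric and magnetic parts parallel, so the anisotropic
stress is of rank one; its constancy forces the energy density to fall like 1/φ, whereas a
trace-free energy-momentum tensor requires 1/φ² (`p_ne_one`). For p = 0 vanishing flux kills the
time derivative of the potential and leaves a spatial gradient; for p = 2 it kills the purely
spatial part of the field and leaves a two-form on the slices, whose Hodge dual is a covector.
Either way there is a closed and coclosed covector v on the slice with Ric = r h + ε v⊗v. This is
the notion `IsSource`, reached in `exists_supportedBy`. Conversely a source gives a scalar field,
and the Friedmann equations then define a fluid that is automatically conserved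
(`IsSource.solution`).

What remains is three-dimensional geometry: which homogeneous metrics have a source. Take an
orthonormal frame with L₀ dual to v. Closedness removes L₀ from all commutators, and coclosedness
makes the trace of ad L₀ vanish. Without isotropy the Ricci equation and the Jacobi identity leave
type VI₀, or a central L₀ times a non-abelian plane, which is LRS type III (`IsSource.bianchi`).
With isotropy, v is fixed, so the isotropy is a single rotation about L₀; after correcting L₀ by a
rotation the space is a line times a surface of curvature r ≠ 0, which is LRS type III or
Kantowski-Sachs according to the sign of r (`IsSource.isotropic`). Conversely each class has a frame
covered by `isSource_of_adapted`.

The supporting tool is the Nomizu map on 𝔤. It gives the isotropy invariance of the Ricci tensor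
(`ricci_invariant`), hence of v, and it lets connection and curvature be computed in any frame
lifted to 𝔤 (`conn_lift`, `ricci_lift`).

For the expansion, the field of a source has ³R − 2ρ_A = 3r/φ and ρ_A + 3P_A = 0, where P_A is a
third of the trace of its stress. So it acts exactly as a curvature constant with the sign of r.
That number depends on the geometry alone (`IsSource.eq_curvature`), so computing it once in each
class settles every solution. -/

set_option linter.unusedSimpArgs false

/-! ### The metric and connection of a shear-free spacetime -/

namespace Cosmology

variable {𝔤 : Type} [LieRing 𝔤] [LieAlgebra ℝ 𝔤] {S : HomogeneousSpace 𝔤} (M : Cosmology S)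

theorem h_symm {t : ℝ} (ht : t ∈ M.I) (a b : Fin 3) : M.h t a b = M.h t b a := by
  have := (M.posDef t ht).isHermitian.apply b a
  simpa using this

theorem h_diag_pos {t : ℝ} (ht : t ∈ M.I) (a : Fin 3) : 0 < M.h t a a :=
  (M.posDef t ht).diag_pos

theorem isUnit_det_h {t : ℝ} (ht : t ∈ M.I) : IsUnit (M.h t).det :=
  isUnit_iff_ne_zero.2 (M.posDef t ht).det_pos.ne'

theorem mem_nhds {t : ℝ} (ht : t ∈ M.I) : M.I ∈ nhds t := M.isOpen.mem_nhds ht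

theorem differentiableAt_h {t : ℝ} (ht : t ∈ M.I) (a b : Fin 3) :
    DifferentiableAt ℝ (fun s => M.h s a b) t :=
  ((M.smooth a b).contDiffAt (M.mem_nhds ht)).differentiableAt (by simp)

theorem deriv_h_symm {t : ℝ} (ht : t ∈ M.I) (a b : Fin 3) :
    deriv (fun s => M.h s a b) t = deriv (fun s => M.h s b a) t := by
  apply Filter.EventuallyEq.deriv_eq
  filter_upwards [M.mem_nhds ht] with s hs using M.h_symm hs a b

/-- Block-diagonal inverse of the spacetime metric. -/
theorem metric_inv {t : ℝ} (ht : t ∈ M.I) :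
    (M.metric t)⁻¹ = Matrix.of fun μ ν => match μ, ν with
      | none, none => -1
      | some a, some b => (M.h t)⁻¹ a b
      | _, _ => 0 := by
  apply Matrix.inv_eq_right_inv
  have h1 := Matrix.mul_nonsing_inv _ (M.isUnit_det_h ht)
  ext μ ν
  rw [Matrix.mul_apply, Fintype.sum_option]
  rcases μ with _ | a <;> rcases ν with _ | b
  · simp [metric]
  · simp [metric]
  · simp [metric]
  · have := congrFun (congrFun h1 a) b
    rw [Matrix.mul_apply] at this
    simp [metric, this, Matrix.one_apply]

section inverse

variable {t : ℝ} (ht : t ∈ M.I)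
include ht

theorem metric_inv_nn : (M.metric t)⁻¹ none none = -1 := by rw [M.metric_inv ht]; rfl

theorem metric_inv_ns (a : Fin 3) : (M.metric t)⁻¹ none (some a) = 0 := by
  rw [M.metric_inv ht]; rfl

theorem metric_inv_sn (a : Fin 3) : (M.metric t)⁻¹ (some a) none = 0 := by
  rw [M.metric_inv ht]; rfl

theorem metric_inv_ss (a b : Fin 3) : (M.metric t)⁻¹ (some a) (some b) = (M.h t)⁻¹ a b := by
  rw [M.metric_inv ht]; rfl

end inverse

@[simp] theorem metric_nn (t : ℝ) : M.metric t none none = -1 := rfl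
@[simp] theorem metric_ns (t : ℝ) (a : Fin 3) : M.metric t none (some a) = 0 := rfl
@[simp] theorem metric_sn (t : ℝ) (a : Fin 3) : M.metric t (some a) none = 0 := rfl
@[simp] theorem metric_ss (t : ℝ) (a b : Fin 3) : M.metric t (some a) (some b) = M.h t a b := rfl

theorem connLow_ssn (t : ℝ) (a b : Fin 3) :
    M.spacetime.connLow (some a) (some b) none t = - deriv (fun s => M.h s a b) t / 2 := by
  simp [FrameGeometry.connLow, FrameGeometry.act, FrameGeometry.commLow, spacetime,
    Fintype.sum_option]

theorem connLow_sns (t : ℝ) (a b : Fin 3) :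
    M.spacetime.connLow (some a) none (some b) t = deriv (fun s => M.h s b a) t / 2 := by
  simp [FrameGeometry.connLow, FrameGeometry.act, FrameGeometry.commLow, spacetime,
    Fintype.sum_option]

theorem connLow_nss (t : ℝ) (a b : Fin 3) :
    M.spacetime.connLow none (some a) (some b) t = deriv (fun s => M.h s a b) t / 2 := by
  simp [FrameGeometry.connLow, FrameGeometry.act, FrameGeometry.commLow, spacetime,
    Fintype.sum_option]

theorem connLow_nnn (t : ℝ) : M.spacetime.connLow none none none t = 0 := by
  simp [FrameGeometry.connLow, FrameGeometry.act, FrameGeometry.commLow, spacetime]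

theorem connLow_nns (t : ℝ) (a : Fin 3) : M.spacetime.connLow none none (some a) t = 0 := by
  simp [FrameGeometry.connLow, FrameGeometry.act, FrameGeometry.commLow, spacetime]

theorem connLow_nsn (t : ℝ) (a : Fin 3) : M.spacetime.connLow none (some a) none t = 0 := by
  simp [FrameGeometry.connLow, FrameGeometry.act, FrameGeometry.commLow, spacetime]

theorem connLow_snn (t : ℝ) (a : Fin 3) : M.spacetime.connLow (some a) none none t = 0 := by
  simp [FrameGeometry.connLow, FrameGeometry.act, FrameGeometry.commLow, spacetime]

theorem connLow_sss (t : ℝ) (a b c : Fin 3) :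
    M.spacetime.connLow (some a) (some b) (some c) t = M.spatial.connLow a b c t := by
  simp [FrameGeometry.connLow, FrameGeometry.act, FrameGeometry.commLow, spacetime, spatial,
    Fintype.sum_option]

section conn

variable {t : ℝ} (ht : t ∈ M.I)
include ht

theorem conn_ssn_eq_deriv (a b : Fin 3) :
    M.spacetime.conn (some a) (some b) none t = deriv (fun s => M.h s a b) t / 2 := by
  have : M.spacetime.g t = M.metric t := rfl
  simp only [FrameGeometry.conn, this, Fintype.sum_option, M.metric_inv_nn ht,
    M.metric_inv_sn ht, connLow_ssn]
  simp only [mul_zero, Finset.sum_const_zero, add_zero]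
  ring

omit ht in
theorem conn_nnn : M.spacetime.conn none none none t = 0 := by
  have : M.spacetime.g t = M.metric t := rfl
  simp [FrameGeometry.conn, this, Fintype.sum_option, connLow_nnn, connLow_nns]

omit ht in
theorem conn_nns (a : Fin 3) : M.spacetime.conn none none (some a) t = 0 := by
  have : M.spacetime.g t = M.metric t := rfl
  simp [FrameGeometry.conn, this, Fintype.sum_option, connLow_nnn, connLow_nns]

theorem conn_nsn (a : Fin 3) : M.spacetime.conn none (some a) none t = 0 := by
  have : M.spacetime.g t = M.metric t := rfl
  simp [FrameGeometry.conn, this, Fintype.sum_option, connLow_nsn, M.metric_inv_sn ht]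

theorem conn_snn (a : Fin 3) : M.spacetime.conn (some a) none none t = 0 := by
  have : M.spacetime.g t = M.metric t := rfl
  simp [FrameGeometry.conn, this, Fintype.sum_option, connLow_snn, M.metric_inv_sn ht]

theorem conn_sss (a b c : Fin 3) :
    M.spacetime.conn (some a) (some b) (some c) t = M.spatial.conn a b c t := by
  have : M.spacetime.g t = M.metric t := rfl
  have h2 : M.spatial.g t = M.h t := rfl
  simp [FrameGeometry.conn, this, h2, Fintype.sum_option, connLow_sss, M.metric_inv_ns ht,
    M.metric_inv_ss ht]

/-- The spatial part of ∇u is half the time derivative of h, so vanishing shear leaves only the part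
proportional to h. -/
theorem deriv_h (hM : M.ShearFree) (a b : Fin 3) :
    deriv (fun s => M.h s a b) t = 2 * M.H t * M.h t a b := by
  have h1 := hM t ht (some a) (some b)
  have h2 : ∀ a b, M.gradU (some a) (some b) t = deriv (fun s => M.h s a b) t / 2 := by
    intro a b
    simp [gradU, FrameGeometry.cov, FrameGeometry.act, u, Fintype.sum_option,
      M.conn_ssn_eq_deriv ht a b]
  simp only [shear, h2, M.deriv_h_symm ht b a, u, metric_ss] at h1
  linarith

theorem hasDerivAt_h (hM : M.ShearFree) (a b : Fin 3) :
    HasDerivAt (fun s => M.h s a b) (2 * M.H t * M.h t a b) t := by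
  rw [← M.deriv_h ht hM]; exact (M.differentiableAt_h ht a b).hasDerivAt

theorem conn_ssn (hM : M.ShearFree) (a b : Fin 3) :
    M.spacetime.conn (some a) (some b) none t = M.H t * M.h t a b := by
  rw [M.conn_ssn_eq_deriv ht, M.deriv_h ht hM]; ring

theorem conn_nss (hM : M.ShearFree) (a b : Fin 3) :
    M.spacetime.conn none (some a) (some b) t = if a = b then M.H t else 0 := by
  have : M.spacetime.g t = M.metric t := rfl
  have h1 := congrFun (congrFun (Matrix.mul_nonsing_inv _ (M.isUnit_det_h ht)) a) b
  rw [Matrix.mul_apply, Matrix.one_apply] at h1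
  simp only [FrameGeometry.conn, this, Fintype.sum_option, connLow_nsn, connLow_nss,
    M.metric_inv_ss ht, M.deriv_h ht hM]
  calc _ = M.H t * ∑ c, M.h t a c * (M.h t)⁻¹ c b := by
        rw [Finset.mul_sum]; simp only [zero_mul, zero_add]
        exact Finset.sum_congr rfl fun _ _ => by ring
    _ = _ := by rw [h1]; simp

theorem conn_sns (hM : M.ShearFree) (a b : Fin 3) :
    M.spacetime.conn (some a) none (some b) t = if a = b then M.H t else 0 := by
  rw [← M.conn_nss ht hM]
  have : M.spacetime.g t = M.metric t := rfl
  simp only [FrameGeometry.conn, this, Fintype.sum_option, connLow_nsn, connLow_snn,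
    connLow_nss, connLow_sns, M.deriv_h_symm ht _ a]

end conn

/-! ### Conformal evolution of the spatial metric -/

/-- Squared scale factor, normalized at `t₀`. -/
noncomputable def scaleSq (t₀ t : ℝ) : ℝ := M.h t 0 0 / M.h t₀ 0 0

section scaleSq

variable {t₀ : ℝ} (ht₀ : t₀ ∈ M.I)
include ht₀

@[simp] theorem scaleSq_self : M.scaleSq t₀ t₀ = 1 := div_self (M.h_diag_pos ht₀ 0).ne'

theorem scaleSq_pos {t : ℝ} (ht : t ∈ M.I) : 0 < M.scaleSq t₀ t :=
  div_pos (M.h_diag_pos ht 0) (M.h_diag_pos ht₀ 0)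

omit ht₀ in
theorem hasDerivAt_scaleSq (hM : M.ShearFree) {t : ℝ} (ht : t ∈ M.I) :
    HasDerivAt (M.scaleSq t₀) (2 * M.H t * M.scaleSq t₀ t) t := by
  have := (M.hasDerivAt_h ht hM 0 0).div_const (M.h t₀ 0 0)
  rw [mul_div_assoc] at this
  exact this

omit ht₀ in
theorem contDiffOn_scaleSq : ContDiffOn ℝ (⊤ : ℕ∞) (M.scaleSq t₀) M.I :=
  (M.smooth 0 0).div_const _

theorem eq_of_deriv_eq_zero {f : ℝ → ℝ} (hf : ∀ t ∈ M.I, HasDerivAt f 0 t) {t : ℝ} (ht : t ∈ M.I) :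
    f t = f t₀ :=
  M.isOpen.is_const_of_deriv_eq_zero M.ordConnected.isPreconnected
    (fun s hs => (hf s hs).differentiableAt.differentiableWithinAt)
    (fun s hs => (hf s hs).deriv) ht ht₀

/-- All entries of h satisfy the same linear equation f' = 2Hf, so their quotients by `scaleSq` are
constant on the interval. -/
theorem h_eq_smul (hM : M.ShearFree) {t : ℝ} (ht : t ∈ M.I) : M.h t = M.scaleSq t₀ t • M.h t₀ := by
  ext a b
  have key : ∀ s ∈ M.I, HasDerivAt (fun s => M.h s a b / M.scaleSq t₀ s) 0 s := by
    intro s hs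
    have hp := (M.scaleSq_pos ht₀ hs).ne'
    refine ((M.hasDerivAt_h hs hM a b).div (M.hasDerivAt_scaleSq hM hs) hp).congr_deriv ?_
    rw [div_eq_zero_iff]; left; ring
  have := M.eq_of_deriv_eq_zero ht₀ key ht
  simp only [M.scaleSq_self ht₀, div_one] at this
  rw [div_eq_iff (M.scaleSq_pos ht₀ ht).ne'] at this
  simp [this, mul_comm]

theorem h_inv_eq (hM : M.ShearFree) {t : ℝ} (ht : t ∈ M.I) (a b : Fin 3) :
    (M.h t)⁻¹ a b = (M.h t₀)⁻¹ a b / M.scaleSq t₀ t := by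
  have hp := (M.scaleSq_pos ht₀ ht).ne'
  have : (M.h t)⁻¹ = (M.scaleSq t₀ t)⁻¹ • (M.h t₀)⁻¹ := by
    apply Matrix.inv_eq_right_inv
    rw [M.h_eq_smul ht₀ hM ht, Matrix.smul_mul, Matrix.mul_smul,
      Matrix.mul_nonsing_inv _ (M.isUnit_det_h ht₀), smul_smul, mul_inv_cancel₀ hp, one_smul]
  rw [this]; simp [div_eq_inv_mul]

/-- Homothetic metrics have the same Levi-Civita connection: the factor of the lowered coefficients
cancels that of the inverse metric. -/
theorem spatial_conn_eq (hM : M.ShearFree) {t : ℝ} (ht : t ∈ M.I) (a b c : Fin 3) :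
    M.spatial.conn a b c t = M.spatial.conn a b c t₀ := by
  have hp := (M.scaleSq_pos ht₀ ht).ne'
  have h1 : ∀ a b c, M.spatial.commLow a b c t
      = M.scaleSq t₀ t * M.spatial.commLow a b c t₀ := by
    intro a b c
    simp only [FrameGeometry.commLow, spatial, Finset.mul_sum]
    refine Finset.sum_congr rfl fun d _ => ?_
    rw [M.h_eq_smul ht₀ hM ht]; simp; ring
  simp only [FrameGeometry.conn, FrameGeometry.connLow, h1]
  refine Finset.sum_congr rfl fun d _ => ?_
  have h2 : (M.spatial.g t)⁻¹ d c = (M.h t₀)⁻¹ d c / M.scaleSq t₀ t := M.h_inv_eq ht₀ hM ht d c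
  have h3 : (M.spatial.g t₀)⁻¹ d c = (M.h t₀)⁻¹ d c := rfl
  rw [h2, h3]
  simp only [FrameGeometry.act, spatial]
  field_simp
  ring

theorem spatial_riemann_eq (hM : M.ShearFree) {t : ℝ} (ht : t ∈ M.I) (a b c d : Fin 3) :
    M.spatial.riemann a b c d t = M.spatial.riemann a b c d t₀ := by
  simp only [FrameGeometry.riemann, M.spatial_conn_eq ht₀ hM ht]
  simp [FrameGeometry.act, spatial]

theorem spatial_ricci_eq (hM : M.ShearFree) {t : ℝ} (ht : t ∈ M.I) (a b : Fin 3) :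
    M.spatial.ricci a b t = M.spatial.ricci a b t₀ := by
  simp only [FrameGeometry.ricci, M.spatial_riemann_eq ht₀ hM ht]

theorem spatial_scalar_eq (hM : M.ShearFree) {t : ℝ} (ht : t ∈ M.I) :
    M.spatial.scalar t = M.spatial.scalar t₀ / M.scaleSq t₀ t := by
  simp only [FrameGeometry.scalar, M.spatial_ricci_eq ht₀ hM ht, Finset.sum_div]
  refine Finset.sum_congr rfl fun a _ => Finset.sum_congr rfl fun b _ => ?_
  have h2 : (M.spatial.g t)⁻¹ a b = (M.h t₀)⁻¹ a b / M.scaleSq t₀ t := M.h_inv_eq ht₀ hM ht a b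
  have h3 : (M.spatial.g t₀)⁻¹ a b = (M.h t₀)⁻¹ a b := rfl
  rw [h2, h3]; ring

theorem tracelessRicci_eq (hM : M.ShearFree) {t : ℝ} (ht : t ∈ M.I) (a b : Fin 3) :
    M.tracelessRicci a b t = M.tracelessRicci a b t₀ := by
  have hp := (M.scaleSq_pos ht₀ ht).ne'
  simp only [tracelessRicci, M.spatial_ricci_eq ht₀ hM ht, M.spatial_scalar_eq ht₀ hM ht,
    M.h_eq_smul ht₀ hM ht]
  simp; field_simp

end scaleSq

/-- Serves to read off the smoothness of `M.H` from that of h. -/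
theorem H_eq (hM : M.ShearFree) {t : ℝ} (ht : t ∈ M.I) :
    M.H t = deriv (fun s => M.h s 0 0) t / (2 * M.h t 0 0) := by
  rw [M.deriv_h ht hM]; have := (M.h_diag_pos ht 0).ne'; field_simp

theorem contDiffOn_H (hM : M.ShearFree) : ContDiffOn ℝ (⊤ : ℕ∞) M.H M.I := by
  refine ContDiffOn.congr ?_ fun t ht => M.H_eq hM ht
  refine ContDiffOn.div ?_ (contDiffOn_const.mul (M.smooth 0 0)) fun t ht => ?_
  · exact (M.smooth 0 0).deriv_of_isOpen M.isOpen (by simp)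
  · have := (M.h_diag_pos ht 0).ne'; positivity

theorem hasDerivAt_H (hM : M.ShearFree) {t : ℝ} (ht : t ∈ M.I) :
    HasDerivAt M.H (deriv M.H t) t :=
  (((M.contDiffOn_H hM).contDiffAt (M.mem_nhds ht)).differentiableAt (by simp)).hasDerivAt

end Cosmology

/-! ### Metric compatibility and torsion of the slices -/

theorem HomogeneousSpace.D_antisymm {𝔤 : Type} [LieRing 𝔤] [LieAlgebra ℝ 𝔤]
    (S : HomogeneousSpace 𝔤) (a b c : Fin 3) : S.D a b c = - S.D b a c := by
  rw [HomogeneousSpace.D, HomogeneousSpace.D, ← map_neg, lie_skew]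

namespace Cosmology

variable {𝔤 : Type} [LieRing 𝔤] [LieAlgebra ℝ 𝔤] {S : HomogeneousSpace 𝔤} (M : Cosmology S)

theorem spatial_commLow_antisymm (a b c : Fin 3) (t : ℝ) :
    M.spatial.commLow a b c t = - M.spatial.commLow b a c t := by
  simp only [FrameGeometry.commLow, ← Finset.sum_neg_distrib, ← neg_mul]
  refine Finset.sum_congr rfl fun d _ => ?_
  rw [show M.spatial.D a b d = - M.spatial.D b a d from S.D_antisymm a b d]

/-- The spatial frame annihilates functions of t, so only the commutator terms of Koszul's formula
are left. -/
theorem spatial_connLow_antisymm (a b c : Fin 3) (t : ℝ) :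
    M.spatial.connLow a b c t = - M.spatial.connLow a c b t := by
  have h1 := M.spatial_commLow_antisymm a b c t
  have h2 := M.spatial_commLow_antisymm b c a t
  have h3 := M.spatial_commLow_antisymm c a b t
  have : ∀ a f, M.spatial.act a f t = 0 := fun a f => by simp [FrameGeometry.act, spatial]
  simp only [FrameGeometry.connLow, this]
  linarith

section

variable {t : ℝ} (ht : t ∈ M.I)
include ht

theorem sum_h_mul_inv (a b : Fin 3) : ∑ c, M.h t a c * (M.h t)⁻¹ c b = if a = b then 1 else 0 := by
  have h1 := congrFun (congrFun (Matrix.mul_nonsing_inv _ (M.isUnit_det_h ht)) a) b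
  rwa [Matrix.mul_apply, Matrix.one_apply] at h1

theorem sum_inv_mul_h (a b : Fin 3) : ∑ c, (M.h t)⁻¹ a c * M.h t c b = if a = b then 1 else 0 := by
  have h1 := congrFun (congrFun (Matrix.nonsing_inv_mul _ (M.isUnit_det_h ht)) a) b
  rwa [Matrix.mul_apply, Matrix.one_apply] at h1

theorem sum_inv_h : ∑ a, ∑ b, (M.h t)⁻¹ a b * M.h t a b = 3 := by
  have : ∀ a, ∑ b, (M.h t)⁻¹ a b * M.h t a b = 1 := fun a => by
    simpa [M.h_symm ht a] using M.sum_inv_mul_h ht a a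
  simp [this]

theorem sum_conn_h (a b c : Fin 3) :
    ∑ d, M.spatial.conn a b d t * M.h t d c = M.spatial.connLow a b c t := by
  have : ∀ d e, (M.spatial.g t)⁻¹ d e = (M.h t)⁻¹ d e := fun _ _ => rfl
  simp only [FrameGeometry.conn, this, Finset.sum_mul]
  rw [Finset.sum_comm]
  calc _ = ∑ d, M.spatial.connLow a b d t * ∑ e, (M.h t)⁻¹ d e * M.h t e c := by
        simp only [Finset.mul_sum, mul_assoc]
    _ = _ := by simp [M.sum_inv_mul_h ht]

/-- Metric compatibility of the connection of the slices. -/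
theorem spatial_conn_compat (a b c : Fin 3) :
    ∑ d, M.spatial.conn a b d t * M.h t d c + ∑ d, M.spatial.conn a c d t * M.h t b d = 0 := by
  have : ∀ d, M.h t b d = M.h t d b := fun d => M.h_symm ht b d
  simp only [this, M.sum_conn_h ht]
  rw [M.spatial_connLow_antisymm]; ring

/-- The connection of the slices is torsion-free. -/
theorem spatial_conn_torsion (a b c : Fin 3) :
    M.spatial.conn a b c t - M.spatial.conn b a c t = S.D a b c := by
  have h0 : ∀ d e, (M.spatial.g t)⁻¹ d e = (M.h t)⁻¹ d e := fun _ _ => rfl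
  have h1 : ∀ d, M.spatial.connLow a b d t - M.spatial.connLow b a d t
      = M.spatial.commLow a b d t := by
    intro d
    have h1 := M.spatial_commLow_antisymm a b d t
    have h2 := M.spatial_commLow_antisymm b d a t
    have h3 := M.spatial_commLow_antisymm d a b t
    have : ∀ a f, M.spatial.act a f t = 0 := fun a f => by simp [FrameGeometry.act, spatial]
    simp only [FrameGeometry.connLow, this]
    linarith
  simp only [FrameGeometry.conn, h0, ← Finset.sum_sub_distrib, ← sub_mul, h1]
  simp only [FrameGeometry.commLow, Finset.sum_mul]
  rw [Finset.sum_comm]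
  have h2 : M.spatial.D = S.D := rfl
  have h3 : M.spatial.g t = M.h t := rfl
  calc _ = ∑ d, S.D a b d * ∑ e, M.h t d e * (M.h t)⁻¹ e c := by
        simp only [Finset.mul_sum, mul_assoc, h2, h3]
    _ = _ := by simp [M.sum_h_mul_inv ht]

end

/-! ### Einstein tensor of a shear-free spacetime -/

section

variable (hM : M.ShearFree) {t : ℝ} (ht : t ∈ M.I)
include hM ht

theorem deriv_conn_ssn (a b : Fin 3) :
    deriv (M.spacetime.conn (some a) (some b) none) t
      = (deriv M.H t + 2 * M.H t ^ 2) * M.h t a b := by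
  -- The closed formula holds only on `M.I`, so the derivative is transferred through a
  -- neighbourhood of t.
  have : M.spacetime.conn (some a) (some b) none =ᶠ[nhds t] fun s => M.H s * M.h s a b := by
    filter_upwards [M.mem_nhds ht] with s hs using M.conn_ssn hs hM a b
  rw [this.deriv_eq]
  refine (((M.hasDerivAt_H hM ht).mul (M.hasDerivAt_h ht hM a b)).congr_deriv ?_).deriv
  ring

theorem deriv_conn_sns (a b : Fin 3) :
    deriv (M.spacetime.conn (some a) none (some b)) t = if a = b then deriv M.H t else 0 := by
  have : M.spacetime.conn (some a) none (some b) =ᶠ[nhds t] fun s => if a = b then M.H s else 0 := by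
    filter_upwards [M.mem_nhds ht] with s hs using M.conn_sns hs hM a b
  rw [this.deriv_eq]
  split_ifs <;> simp

omit hM in
theorem deriv_conn_snn (a : Fin 3) : deriv (M.spacetime.conn (some a) none none) t = 0 := by
  have : M.spacetime.conn (some a) none none =ᶠ[nhds t] fun _ => 0 := by
    filter_upwards [M.mem_nhds ht] with s hs using M.conn_snn hs a
  rw [this.deriv_eq]; simp

theorem deriv_conn_sss (a b c : Fin 3) :
    deriv (M.spacetime.conn (some a) (some b) (some c)) t = 0 := by
  have : M.spacetime.conn (some a) (some b) (some c) =ᶠ[nhds t]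
      fun _ => M.spatial.conn a b c t := by
    filter_upwards [M.mem_nhds ht] with s hs
    rw [M.conn_sss hs, M.spatial_conn_eq ht hM hs]
  rw [this.deriv_eq]; simp

theorem spacetime_ricci_nn :
    M.spacetime.ricci none none t = -3 * (deriv M.H t + M.H t ^ 2) := by
  have hr : ∀ a : Fin 3, M.spacetime.riemann (some a) none none (some a) t
      = -(deriv M.H t + M.H t ^ 2) := by
    intro a
    simp only [FrameGeometry.riemann, FrameGeometry.act, Fintype.sum_option, conn_nnn,
      M.conn_snn ht, M.conn_sns ht hM, M.conn_nns, M.conn_nss ht hM,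
      M.deriv_conn_sns hM ht]
    simp [spacetime]
    ring
  have h0 : M.spacetime.riemann none none none none t = 0 := by
    simp [FrameGeometry.riemann, spacetime]
  rw [FrameGeometry.ricci, Fintype.sum_option]
  simp only [hr, h0]
  simp
  ring

theorem spacetime_ricci_ns (a : Fin 3) : M.spacetime.ricci none (some a) t = 0 := by
  have hr : ∀ b : Fin 3, M.spacetime.riemann (some b) none (some a) (some b) t = 0 := by
    intro b
    simp only [FrameGeometry.riemann, FrameGeometry.act, Fintype.sum_option, conn_nnn,
      M.conn_snn ht, M.conn_sns ht hM, M.conn_nns, M.conn_nss ht hM, M.conn_sss ht,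
      M.conn_nsn ht, M.deriv_conn_sss hM ht]
    simp [spacetime]
    ring
  have h0 : M.spacetime.riemann none none (some a) none t = 0 := by
    simp [FrameGeometry.riemann, spacetime]
  rw [FrameGeometry.ricci, Fintype.sum_option]
  simp only [hr, h0]
  simp

/-- H times the antisymmetric part of the spatial connection cancels the commutator term because the
torsion vanishes. -/
theorem spacetime_ricci_sn (a : Fin 3) : M.spacetime.ricci (some a) none t = 0 := by
  have hr : ∀ b : Fin 3, M.spacetime.riemann (some b) (some a) none (some b) t = 0 := by
    intro b
    simp only [FrameGeometry.riemann, FrameGeometry.act, Fintype.sum_option, conn_nnn,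
      M.conn_snn ht, M.conn_sns ht hM, M.conn_nns, M.conn_nss ht hM, M.conn_sss ht,
      M.conn_nsn ht]
    have h3 := M.spatial_conn_torsion ht b a b
    have h4 : M.spacetime.D (some b) (some a) (some b) = S.D b a b := rfl
    simp only [mul_ite, ite_mul, zero_mul, mul_zero, Finset.sum_sub_distrib, Finset.sum_ite_eq,
      Finset.mem_univ, if_true, h4, Finset.sum_ite_eq']
    rw [← h3]
    simp [spacetime]
    ring
  have h0 : M.spacetime.riemann none (some a) none none t = 0 := by
    simp only [FrameGeometry.riemann, FrameGeometry.act, Fintype.sum_option, conn_nnn,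
      M.conn_snn ht, M.conn_sns ht hM, M.conn_nns, M.conn_nss ht hM, M.conn_sss ht,
      M.conn_nsn ht, M.deriv_conn_snn ht]
    simp [spacetime]
  rw [FrameGeometry.ricci, Fintype.sum_option]
  simp only [hr, h0]
  simp

/-- The Gauss equation for the second fundamental form Hh: contraction over the spatial directions
adds 2H²h, and the time direction adds (Ḣ + H²)h. -/
theorem spacetime_ricci_ss (a b : Fin 3) :
    M.spacetime.ricci (some a) (some b) t
      = M.spatial.ricci a b t + (deriv M.H t + 3 * M.H t ^ 2) * M.h t a b := by
  have hr : ∀ c : Fin 3, M.spacetime.riemann (some c) (some a) (some b) (some c) t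
      = M.spatial.riemann c a b c t + (M.H t ^ 2 * M.h t a b
        - if a = c then M.H t ^ 2 * M.h t a b else 0) := by
    intro c
    simp only [FrameGeometry.riemann, FrameGeometry.act, Fintype.sum_option,
      M.conn_sns ht hM, M.conn_nss ht hM, M.conn_sss ht, M.conn_ssn ht hM]
    by_cases hc : a = c
    · subst hc
      simp [spacetime, spatial]
    · simp [spacetime, spatial, hc]
      ring
  have h0 : M.spacetime.riemann none (some a) (some b) none t
      = (deriv M.H t + M.H t ^ 2) * M.h t a b := by
    simp only [FrameGeometry.riemann, FrameGeometry.act, Fintype.sum_option,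
      M.conn_snn ht, M.conn_sns ht hM, M.conn_nss ht hM, M.conn_sss ht, M.conn_ssn ht hM,
      M.conn_nsn ht, M.deriv_conn_ssn hM ht, conn_nnn]
    simp [spacetime]
    ring
  rw [FrameGeometry.ricci, Fintype.sum_option]
  simp only [hr, h0, Finset.sum_add_distrib, Finset.sum_sub_distrib]
  simp [FrameGeometry.ricci]
  ring

theorem spacetime_scalar :
    M.spacetime.scalar t = M.spatial.scalar t + 6 * deriv M.H t + 12 * M.H t ^ 2 := by
  have hg : M.spacetime.g t = M.metric t := rfl
  have hg' : ∀ a b, (M.spatial.g t)⁻¹ a b = (M.h t)⁻¹ a b := fun _ _ => rfl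
  have h3 := M.sum_inv_h ht
  simp only [FrameGeometry.scalar, Fintype.sum_option, hg, M.metric_inv_nn ht, M.metric_inv_ns ht,
    M.metric_inv_sn ht, M.metric_inv_ss ht, M.spacetime_ricci_nn hM ht, M.spacetime_ricci_ss hM ht,
    mul_add, Finset.sum_add_distrib, hg']
  have : ∑ a, ∑ b, (M.h t)⁻¹ a b * ((deriv M.H t + 3 * M.H t ^ 2) * M.h t a b)
      = (deriv M.H t + 3 * M.H t ^ 2) * 3 := by
    rw [← h3, Finset.mul_sum]
    refine Finset.sum_congr rfl fun a _ => ?_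
    rw [Finset.mul_sum]
    exact Finset.sum_congr rfl fun b _ => by ring
  rw [this]
  simp
  ring

theorem einstein_nn :
    M.spacetime.einstein none none t = 3 * M.H t ^ 2 + M.spatial.scalar t / 2 := by
  have hg : M.spacetime.g t = M.metric t := rfl
  rw [FrameGeometry.einstein, M.spacetime_ricci_nn hM ht, M.spacetime_scalar hM ht, hg, metric_nn]
  ring

theorem einstein_ns (a : Fin 3) : M.spacetime.einstein none (some a) t = 0 := by
  have hg : M.spacetime.g t = M.metric t := rfl
  rw [FrameGeometry.einstein, M.spacetime_ricci_ns hM ht, hg, metric_ns]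
  ring

theorem einstein_sn (a : Fin 3) : M.spacetime.einstein (some a) none t = 0 := by
  have hg : M.spacetime.g t = M.metric t := rfl
  rw [FrameGeometry.einstein, M.spacetime_ricci_sn hM ht, hg, metric_sn]
  ring

theorem einstein_ss (a b : Fin 3) :
    M.spacetime.einstein (some a) (some b) t = M.spatial.ricci a b t
      - (M.spatial.scalar t / 2 + 2 * deriv M.H t + 3 * M.H t ^ 2) * M.h t a b := by
  have hg : M.spacetime.g t = M.metric t := rfl
  rw [FrameGeometry.einstein, M.spacetime_ricci_ss hM ht, M.spacetime_scalar hM ht, hg, metric_ss]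
  ring

end

end Cosmology

/-! ### Perfect fluids and the continuity equation -/

theorem FrameGeometry.cov_one {ι : Type} [Fintype ι] [DecidableEq ι] (G : FrameGeometry ι)
    (τ : ℝ → ι → ℝ) (μ : ι) (ν : Fin 1 → ι) (t : ℝ) :
    G.cov (fun s κ => τ s (κ 0)) μ ν t
      = G.act μ (fun s => τ s (ν 0)) t - ∑ σ, G.conn μ (ν 0) σ t * τ t σ := by
  simp [FrameGeometry.cov]

theorem FrameGeometry.cov_two {ι : Type} [Fintype ι] [DecidableEq ι] (G : FrameGeometry ι)
    (τ : ℝ → ι → ι → ℝ) (μ : ι) (ν : Fin 2 → ι) (t : ℝ) :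
    G.cov (fun s κ => τ s (κ 0) (κ 1)) μ ν t
      = G.act μ (fun s => τ s (ν 0) (ν 1)) t - ∑ σ, G.conn μ (ν 0) σ t * τ t σ (ν 1)
        - ∑ σ, G.conn μ (ν 1) σ t * τ t (ν 0) σ := by
  simp [FrameGeometry.cov]
  ring

namespace Cosmology

variable {𝔤 : Type} [LieRing 𝔤] [LieAlgebra ℝ 𝔤] {S : HomogeneousSpace 𝔤} (M : Cosmology S)

/-- Energy-momentum tensor of a comoving perfect fluid. -/
def fluidTensor (ρ P : ℝ → ℝ) (s : ℝ) (μ ν : SIdx) : ℝ :=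
  (ρ s + P s) * (u μ * u ν) + P s * M.metric s μ ν

variable (hM : M.ShearFree) {t : ℝ} (ht : t ∈ M.I)

theorem fluidTensor_nn (ρ P : ℝ → ℝ) (s : ℝ) : M.fluidTensor ρ P s none none = ρ s := by
  simp [fluidTensor, u]

theorem fluidTensor_ns (ρ P : ℝ → ℝ) (s : ℝ) (a : Fin 3) :
    M.fluidTensor ρ P s none (some a) = 0 := by simp [fluidTensor, u]

theorem fluidTensor_sn (ρ P : ℝ → ℝ) (s : ℝ) (a : Fin 3) :
    M.fluidTensor ρ P s (some a) none = 0 := by simp [fluidTensor, u]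

theorem fluidTensor_ss (ρ P : ℝ → ℝ) (s : ℝ) (a b : Fin 3) :
    M.fluidTensor ρ P s (some a) (some b) = P s * M.h s a b := by simp [fluidTensor, u]

include hM ht

/-- The time component is the continuity equation. In the spatial components nothing survives, since
the pressure is homogeneous and h is parallel on the slices. -/
theorem divergence_fluid (ρ P : ℝ → ℝ) (ν : Fin 1 → SIdx) :
    M.spacetime.divergence (fun s κ => M.fluidTensor ρ P s (κ 0) (κ 1)) ν t
      = match ν 0 with
        | none => -(deriv ρ t + 3 * M.H t * (ρ t + P t))
        | some _ => 0 := by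
  have hg : M.spacetime.g t = M.metric t := rfl
  have hn : M.spacetime.dir none = 1 := rfl
  have hs : ∀ a, M.spacetime.dir (some a) = 0 := fun _ => rfl
  simp only [FrameGeometry.divergence, FrameGeometry.cov_two, hg]
  simp only [Fintype.sum_option, M.metric_inv_nn ht, M.metric_inv_ns ht,
    M.metric_inv_sn ht, M.metric_inv_ss ht, Fin.cons_zero]
  have h1 : ∀ x : SIdx, (Fin.cons x ν : Fin 2 → SIdx) 1 = ν 0 := fun x => rfl
  simp only [h1]
  rcases ν 0 with _ | a
  · simp only [FrameGeometry.act, hn, hs, fluidTensor_nn, fluidTensor_ns, fluidTensor_sn,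
      fluidTensor_ss, conn_nnn, M.conn_snn ht, M.conn_sns ht hM, M.conn_ssn ht hM, conn_nns]
    have h3 := M.sum_inv_h ht
    calc _ = -deriv ρ t + ∑ a, ∑ b, (M.h t)⁻¹ a b * M.h t a b * (-(M.H t * (ρ t + P t))) := by
          simp only [zero_mul, mul_zero, Finset.sum_const_zero, add_zero, zero_add, one_mul,
            sub_zero, neg_one_mul, zero_sub]
          congr 1
          refine Finset.sum_congr rfl fun a _ => Finset.sum_congr rfl fun b _ => ?_
          simp [M.h_symm ht b a]
          ring
      _ = _ := by
          simp only [← Finset.sum_mul, h3]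
          ring
  · simp only [FrameGeometry.act, hn, hs, fluidTensor_nn, fluidTensor_ns, fluidTensor_sn,
      fluidTensor_ss, conn_nnn, M.conn_snn ht, M.conn_nsn ht, M.conn_sns ht hM, M.conn_ssn ht hM,
      conn_nns, M.conn_sss ht]
    have : ∀ b c, (M.h t)⁻¹ b c * (0 * deriv (fun s => P s * M.h s c a) t
          - (M.H t * M.h t b c * 0 + ∑ x, M.spatial.conn b c x t * (P t * M.h t x a))
          - (M.H t * M.h t b a * 0 + ∑ x, M.spatial.conn b a x t * (P t * M.h t c x)))
        = 0 := by
      intro b c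
      have h1 := M.spatial_conn_compat ht b c a
      have h2 : ∑ x, M.spatial.conn b c x t * (P t * M.h t x a)
          = P t * ∑ x, M.spatial.conn b c x t * M.h t x a := by
        rw [Finset.mul_sum]; exact Finset.sum_congr rfl fun _ _ => by ring
      have h3 : ∑ x, M.spatial.conn b a x t * (P t * M.h t c x)
          = P t * ∑ x, M.spatial.conn b a x t * M.h t c x := by
        rw [Finset.mul_sum]; exact Finset.sum_congr rfl fun _ _ => by ring
      rw [h2, h3]
      linear_combination -(M.h t)⁻¹ b c * P t * h1
    simp only [this]
    simp

end Cosmology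

namespace PerfectFluids

variable {𝔤 : Type} [LieRing 𝔤] [LieAlgebra ℝ 𝔤] {S : HomogeneousSpace 𝔤} {M : Cosmology S}
  (f : PerfectFluids M)

theorem T_eq_fluidTensor (μ ν : SIdx) (t : ℝ) :
    f.T μ ν t = M.fluidTensor f.totalRho f.totalP t μ ν := by
  simp [T, Cosmology.fluidTensor, totalRho, totalP, Finset.sum_add_distrib, Finset.sum_mul, add_mul]

theorem hasDerivAt_totalRho (hM : M.ShearFree) {t : ℝ} (ht : t ∈ M.I) :
    HasDerivAt f.totalRho (-3 * M.H t * (f.totalRho t + f.totalP t)) t := by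
  have h1 := f.conserved t ht ![none]
  have h2 : (fun s (κ : Fin 2 → SIdx) => ∑ l,
      ((f.rho l s + f.P l s) * (Cosmology.u (κ 0) * Cosmology.u (κ 1))
        + f.P l s * M.metric s (κ 0) (κ 1)))
      = fun s κ => M.fluidTensor f.totalRho f.totalP s (κ 0) (κ 1) := by
    funext s κ
    exact f.T_eq_fluidTensor (κ 0) (κ 1) s
  rw [h2, M.divergence_fluid hM ht] at h1
  have h3 : DifferentiableAt ℝ f.totalRho t := by
    have : f.totalRho = fun t => ∑ l, f.rho l t := rfl
    rw [this]
    refine DifferentiableAt.fun_sum fun l _ => ?_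
    exact ((f.smooth_rho l).contDiffAt (M.mem_nhds ht)).differentiableAt (by simp)
  refine h3.hasDerivAt.congr_deriv ?_
  simp only [Matrix.cons_val_zero] at h1
  linarith

end PerfectFluids

/-! ### Sources and the scalar-field solutions they generate -/

namespace Cosmology

variable {𝔤 : Type} [LieRing 𝔤] [LieAlgebra ℝ 𝔤] {S : HomogeneousSpace 𝔤} (M : Cosmology S)

/-- Squared norm of a spatial covector. -/
noncomputable def normSq (v : Fin 3 → ℝ) (t : ℝ) : ℝ := ∑ a, ∑ b, (M.h t)⁻¹ a b * v a * v b

/-- A closed and coclosed invariant spatial one-form `v` whose anisotropic stress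
(with sign `ε`) balances the anisotropic part of the spatial curvature. -/
structure IsSource (t₀ : ℝ) (v : Fin 3 → ℝ) (ε r : ℝ) : Prop where
  ne_zero : v ≠ 0
  sgn : ε = 1 ∨ ε = -1
  char : ∀ X Y : 𝔤, ∑ c, v c * S.W c ⁅X, Y⁆ = 0
  coclosed : ∑ a, ∑ b, ∑ c, (M.h t₀)⁻¹ a b * (M.spatial.conn a b c t₀ * v c) = 0
  ricci : ∀ a b, M.spatial.ricci a b t₀ = r * M.h t₀ a b + ε * (v a * v b)

theorem normSq_eq (hM : M.ShearFree) {t₀ t : ℝ} (ht₀ : t₀ ∈ M.I) (ht : t ∈ M.I) (v : Fin 3 → ℝ) :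
    M.normSq v t = M.normSq v t₀ / M.scaleSq t₀ t := by
  simp only [normSq, Finset.sum_div]
  exact Finset.sum_congr rfl fun a _ => Finset.sum_congr rfl fun b _ => by
    rw [M.h_inv_eq ht₀ hM ht]; ring

theorem normSq_pos {t : ℝ} (ht : t ∈ M.I) {v : Fin 3 → ℝ} (hv : v ≠ 0) : 0 < M.normSq v t := by
  have := (M.posDef t ht).inv.dotProduct_mulVec_pos hv
  refine lt_of_lt_of_eq this ?_
  simp only [normSq, dotProduct, Matrix.mulVec, Pi.star_apply, star_trivial, Finset.mul_sum]
  exact Finset.sum_congr rfl fun a _ => Finset.sum_congr rfl fun b _ => by ring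

namespace IsSource

variable {M} {t₀ : ℝ} {v : Fin 3 → ℝ} {ε r : ℝ} (hs : M.IsSource t₀ v ε r)
include hs

theorem scalar (ht₀ : t₀ ∈ M.I) : M.spatial.scalar t₀ = 3 * r + ε * M.normSq v t₀ := by
  have hg' : ∀ a b, (M.spatial.g t₀)⁻¹ a b = (M.h t₀)⁻¹ a b := fun _ _ => rfl
  rw [FrameGeometry.scalar, ← M.sum_inv_h ht₀, normSq, Finset.sum_mul, Finset.mul_sum,
    ← Finset.sum_add_distrib]
  refine Finset.sum_congr rfl fun a _ => ?_
  rw [Finset.sum_mul, Finset.mul_sum, ← Finset.sum_add_distrib]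
  exact Finset.sum_congr rfl fun b _ => by rw [hs.ricci, hg']; ring

end IsSource

end Cosmology

namespace FrameGeometry

variable {ι : Type} [Fintype ι] [DecidableEq ι] (G : FrameGeometry ι)

theorem contract_zero (P Q : (Fin 0 → ι) → ℝ) (t : ℝ) :
    G.contract P Q t = P Fin.elim0 * Q Fin.elim0 := by
  simp [contract, Subsingleton.elim _ (Fin.elim0 : Fin 0 → ι)]

omit [DecidableEq ι] in
theorem sum_fin_one (f : (Fin 1 → ι) → ℝ) : ∑ α, f α = ∑ a, f ![a] :=
  Fintype.sum_equiv (Equiv.funUnique (Fin 1) ι) _ _ fun x => by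
    congr 1; funext i; rw [Subsingleton.elim i 0]; rfl

theorem contract_one (P Q : (Fin 1 → ι) → ℝ) (t : ℝ) :
    G.contract P Q t = ∑ a, ∑ b, (G.g t)⁻¹ a b * P ![a] * Q ![b] := by
  simp [contract, sum_fin_one]

end FrameGeometry

namespace Cosmology

variable {𝔤 : Type} [LieRing 𝔤] [LieAlgebra ℝ 𝔤] {S : HomogeneousSpace 𝔤} (M : Cosmology S)

/-- Extension of a spatial covector by zero on `∂_t`. -/
def spaceCovector (v : Fin 3 → ℝ) : SIdx → ℝ
  | none => 0
  | some a => v a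

@[simp] theorem spaceCovector_none (v : Fin 3 → ℝ) : spaceCovector v none = 0 := rfl
@[simp] theorem spaceCovector_some (v : Fin 3 → ℝ) (a : Fin 3) :
    spaceCovector v (some a) = v a := rfl

namespace IsSource

variable {M} {t₀ : ℝ} {v : Fin 3 → ℝ} {ε r : ℝ} (hs : M.IsSource t₀ v ε r)

/-- The field strength of a scalar potential with constant spatial gradient. -/
noncomputable def gauge (ht₀ : t₀ ∈ M.I) (hM : M.ShearFree) : GaugeField M where
  p := 0
  p_le := Nat.zero_le _
  sgn := ε
  sgn_eq := hs.sgn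
  F _ μ := spaceCovector v (μ 0)
  smooth _ := contDiffOn_const
  alternating t ht τ μ := by
    have : τ = 1 := Equiv.ext fun i => Subsingleton.elim (α := Fin 1) _ _
    simp [this]
  invariant Z _ t _ μ := by
    refine (Fin.sum_univ_one _).trans ?_
    simp only [Function.update_self, spaceCovector_some]
    rcases μ 0 with _ | a
    · rfl
    · simpa [mul_comm] using hs.char Z (S.E a)
  closed t ht ν := by
    simp only [FrameGeometry.extDeriv, FrameGeometry.cov_one _ fun _ => spaceCovector v]
    rw [Fin.sum_univ_two]
    simp only [Fintype.sum_option, spaceCovector_none, spaceCovector_some]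
    have h2 : (Fin.succAbove (1 : Fin 2) (0 : Fin 1)) = 0 := rfl
    simp only [FrameGeometry.act, h2, Fin.succAbove_zero, Fin.succ_zero_eq_one]
    -- Torsion-freeness turns the antisymmetrized connection into the commutator, on which v
    -- vanishes.
    have key : ∀ x y : SIdx, ∑ i, M.spacetime.conn x y (some i) t * v i
        = ∑ i, M.spacetime.conn y x (some i) t * v i := by
      rintro (_ | a) (_ | b)
      · rfl
      · simp only [M.conn_nss ht hM, M.conn_sns ht hM]
      · simp only [M.conn_nss ht hM, M.conn_sns ht hM]
      · simp only [M.conn_sss ht]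
        rw [← sub_eq_zero, ← Finset.sum_sub_distrib, ← hs.char (S.E a) (S.E b)]
        refine Finset.sum_congr rfl fun c _ => ?_
        rw [← sub_mul, M.spatial_conn_torsion ht, HomogeneousSpace.D, mul_comm]
    have := key (ν 0) (ν 1)
    simp [this]
  eom t ht ν := by
    have hg : M.spacetime.g t = M.metric t := rfl
    simp only [FrameGeometry.divergence, FrameGeometry.cov_one _ fun _ => spaceCovector v]
    simp only [Fintype.sum_option, M.metric_inv_nn ht, M.metric_inv_ns ht, hg,
      M.metric_inv_sn ht, M.metric_inv_ss ht, Fin.cons_zero, spaceCovector_none,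
      spaceCovector_some, conn_nns, M.conn_sss ht, M.spatial_conn_eq ht₀ hM ht,
      M.h_inv_eq ht₀ hM ht]
    have h1 := hs.coclosed
    have h2 : ∑ a, ∑ b, ∑ c, (M.h t₀)⁻¹ a b / M.scaleSq t₀ t * (M.spatial.conn a b c t₀ * v c)
        = 0 := by
      have h3 := congrArg (fun x => x / M.scaleSq t₀ t) h1
      simp only [zero_div, Finset.sum_div] at h3
      rw [← h3]
      exact Finset.sum_congr rfl fun a _ => Finset.sum_congr rfl fun b _ =>
        Finset.sum_congr rfl fun c _ => by ring
    simpa [FrameGeometry.act, Finset.mul_sum] using h2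

variable (ht₀ : t₀ ∈ M.I) (hM : M.ShearFree)

theorem gauge_contract_one {t : ℝ} (ht : t ∈ M.I) :
    M.spacetime.contract ((hs.gauge ht₀ hM).F t) ((hs.gauge ht₀ hM).F t) t = M.normSq v t := by
  have hg : M.spacetime.g t = M.metric t := rfl
  refine (M.spacetime.contract_one _ _ t).trans ?_
  simp [gauge, normSq, Fintype.sum_option, hg, M.metric_inv_ss ht]

theorem gauge_T {t : ℝ} (ht : t ∈ M.I) (μ ν : SIdx) :
    (hs.gauge ht₀ hM).T μ ν t = ε * (spaceCovector v μ * spaceCovector v ν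
      - M.metric t μ ν * M.normSq v t / 2) := by
  rw [GaugeField.T, gauge_contract_one hs ht₀ hM ht]
  have : M.spacetime.contract
      (fun α : Fin (hs.gauge ht₀ hM).p → SIdx => (hs.gauge ht₀ hM).F t (Fin.cons μ α))
      (fun α => (hs.gauge ht₀ hM).F t (Fin.cons ν α)) t
      = spaceCovector v μ * spaceCovector v ν := by
    exact M.spacetime.contract_zero _ _ t
  rw [this]
  simp [gauge]

/-- Energy density of the perfect fluid supporting the source. -/
noncomputable def fluidRho (_ : M.IsSource t₀ v ε r) (t : ℝ) : ℝ :=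
  3 * M.H t ^ 2 + 3 * (r / 2) / M.scaleSq t₀ t

/-- Pressure of the perfect fluid supporting the source. -/
noncomputable def fluidP (_ : M.IsSource t₀ v ε r) (t : ℝ) : ℝ :=
  -2 * deriv M.H t - 3 * M.H t ^ 2 - (r / 2) / M.scaleSq t₀ t

/-- The perfect fluid supporting the source. -/
noncomputable def fluids (ht₀ : t₀ ∈ M.I) (hM : M.ShearFree) : PerfectFluids M where
  m := 1
  rho _ := hs.fluidRho
  P _ := hs.fluidP
  smooth_rho _ := by
    refine (contDiffOn_const.mul ((M.contDiffOn_H hM).pow 2)).add ?_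
    exact contDiffOn_const.div M.contDiffOn_scaleSq fun t ht => (M.scaleSq_pos ht₀ ht).ne'
  smooth_P _ := by
    refine ((contDiffOn_const.mul ?_).sub (contDiffOn_const.mul ((M.contDiffOn_H hM).pow 2))).sub ?_
    · exact (M.contDiffOn_H hM).deriv_of_isOpen M.isOpen (by simp)
    exact contDiffOn_const.div M.contDiffOn_scaleSq fun t ht => (M.scaleSq_pos ht₀ ht).ne'
  -- Density and pressure are read off from the Friedmann equations with curvature constant r/2, and
  -- these imply the continuity equation for every H.
  conserved t ht ν := by
    have hp := (M.scaleSq_pos ht₀ ht).ne'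
    have h1 := M.divergence_fluid hM ht hs.fluidRho hs.fluidP ν
    simp only [Fin.sum_univ_one]
    refine h1.trans ?_
    rcases ν 0 with _ | a
    · have h2 : HasDerivAt hs.fluidRho (3 * (2 * M.H t * deriv M.H t)
          + (0 * M.scaleSq t₀ t - 3 * (r / 2) * (2 * M.H t * M.scaleSq t₀ t))
            / M.scaleSq t₀ t ^ 2) t := by
        refine HasDerivAt.add ?_ ((hasDerivAt_const t _).div (M.hasDerivAt_scaleSq hM ht) hp)
        refine HasDerivAt.const_mul 3 ?_
        simpa using (M.hasDerivAt_H hM ht).fun_pow 2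
      simp only [h2.deriv, fluidRho, fluidP]
      field_simp
      ring
    · rfl

-- If the trace-free Ricci tensor vanished, v⊗v would be a nonzero multiple of h; but v⊗v has
-- determinant zero and h is positive definite.
include hs ht₀ in
theorem anisotropic : M.Anisotropic := by
  by_contra hcon
  have h0 : ∀ a b, ε * (v a * v b - M.normSq v t₀ / 3 * M.h t₀ a b) = 0 := by
    intro a b
    by_contra h
    refine hcon ⟨t₀, ht₀, a, b, ?_⟩
    rw [tracelessRicci, hs.ricci, hs.scalar ht₀]
    convert h using 1; ring
  have hε : ε ≠ 0 := by rcases hs.sgn with h | h <;> simp [h]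
  have h1 : ∀ a b, v a * v b = M.normSq v t₀ / 3 * M.h t₀ a b := fun a b => by
    have := (mul_eq_zero.1 (h0 a b)).resolve_left hε
    linarith
  have hn := M.normSq_pos ht₀ hs.ne_zero
  have hdet : (Matrix.vecMulVec v v).det = 0 := by
    rw [Matrix.det_fin_three]; simp [Matrix.vecMulVec]; ring
  have h2 : Matrix.vecMulVec v v = (M.normSq v t₀ / 3) • M.h t₀ := by
    ext a b; simp [Matrix.vecMulVec, h1]
  rw [h2, Matrix.det_smul] at hdet
  have h3 := (M.posDef t₀ ht₀).det_pos
  have : 0 < (M.normSq v t₀ / 3) ^ Fintype.card (Fin 3) * (M.h t₀).det := by positivity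
  linarith

/-- A source gives a shear-free solution with a single scalar field. -/
noncomputable def solution (hexp : M.Expanding) : ShearFreeSolution M where
  anisotropic := hs.anisotropic ht₀
  shearFree := hM
  expanding := hexp
  fluids := hs.fluids ht₀ hM
  gauge := hs.gauge ht₀ hM
  comoving t ht a := by simp [gauge_T hs ht₀ hM ht]
  einstein t ht μ ν := by
    have hp := (M.scaleSq_pos ht₀ ht).ne'
    have hrho : (hs.fluids ht₀ hM).totalRho = hs.fluidRho := by
      funext t; exact Fin.sum_univ_one _
    have hP : (hs.fluids ht₀ hM).totalP = hs.fluidP := by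
      funext t; exact Fin.sum_univ_one _
    rw [PerfectFluids.T_eq_fluidTensor, gauge_T hs ht₀ hM ht, hrho, hP]
    rcases μ with _ | a <;> rcases ν with _ | b
    · rw [M.einstein_nn hM ht, M.fluidTensor_nn, M.spatial_scalar_eq ht₀ hM ht, hs.scalar ht₀,
        M.normSq_eq hM ht₀ ht, fluidRho]
      simp
      field_simp
      ring
    · rw [M.einstein_ns hM ht, M.fluidTensor_ns]; simp
    · rw [M.einstein_sn hM ht, M.fluidTensor_sn]; simp
    · rw [M.einstein_ss hM ht, M.fluidTensor_ss, M.spatial_scalar_eq ht₀ hM ht, hs.scalar ht₀,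
        M.spatial_ricci_eq ht₀ hM ht, hs.ricci,
        M.normSq_eq hM ht₀ ht, fluidP]
      simp [M.h_eq_smul ht₀ hM ht]
      field_simp
      ring

end IsSource

end Cosmology

/-! ### The Nomizu map and the isotropy invariance of the curvature -/

open Matrix

open Matrix in
/-- A totally skew and partially symmetric family of matrices vanishes. -/
theorem Matrix.eq_zero_of_skew_of_symm {h : Matrix (Fin 3) (Fin 3) ℝ} (hdet : IsUnit h.det)
    (B : Fin 3 → Matrix (Fin 3) (Fin 3) ℝ) (hskew : ∀ a, B a * h + (B a * h)ᵀ = 0)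
    (hsymm : ∀ a b c, B a b c = B b a c) (a : Fin 3) : B a = 0 := by
  have h1 : ∀ a b c, (B a * h) b c = - (B a * h) c b := fun a b c => by
    have := congrFun (congrFun (hskew a) b) c
    simp only [Matrix.add_apply, Matrix.transpose_apply, Matrix.zero_apply] at this
    linarith
  have h2 : ∀ a b c, (B a * h) b c = (B b * h) a c := fun a b c => by
    simp only [Matrix.mul_apply, hsymm a b]
  -- Applying the symmetry and the skewness alternately six times returns to the same entry with the
  -- opposite sign.
  have h3 : B a * h = 0 := by
    ext b c
    have e1 := h1 a b c
    have e2 := h2 a c b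
    have e3 := h1 c a b
    have e4 := h2 c b a
    have e5 := h1 b c a
    have e6 := h2 b a c
    simp only [Matrix.zero_apply]
    linarith
  calc B a = B a * (h * h⁻¹) := by rw [Matrix.mul_nonsing_inv _ hdet, Matrix.mul_one]
    _ = 0 := by rw [← Matrix.mul_assoc, h3, Matrix.zero_mul]

namespace HomogeneousSpace

variable {𝔤 : Type} [LieRing 𝔤] [LieAlgebra ℝ 𝔤] (S : HomogeneousSpace 𝔤)

/-- Components of the projection of an element of `𝔤` to the tangent space. -/
def coords : 𝔤 →ₗ[ℝ] (Fin 3 → ℝ) := LinearMap.pi S.W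

@[simp] theorem coords_apply (X : 𝔤) (a : Fin 3) : S.coords X a = S.W a X := rfl

theorem coords_E (a : Fin 3) : S.coords (S.E a) = Pi.single a 1 := by
  ext b; simp [S.W_E, Pi.single_apply, eq_comm]

theorem mem_iso_iff {Z : 𝔤} : Z ∈ S.iso ↔ S.coords Z = 0 := by
  rw [S.mem_iso, funext_iff]; rfl

theorem coords_isoPart (X : 𝔤) : S.coords (S.isoPart X) = 0 := by
  ext c; simp [isoPart, S.W_E]

theorem isoPart_mem (X : 𝔤) : S.isoPart X ∈ S.iso := S.mem_iso_iff.2 (S.coords_isoPart X)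

theorem isoPart_of_mem {Z : 𝔤} (hZ : Z ∈ S.iso) : S.isoPart Z = Z := by
  simp [isoPart, (S.mem_iso Z).1 hZ]

theorem decomp (X : 𝔤) : X = ∑ c, S.W c X • S.E c + S.isoPart X := by simp [isoPart]

/-- The isotropy representation, extended by zero to `𝔤`. -/
def isoRep : 𝔤 →ₗ[ℝ] Matrix (Fin 3) (Fin 3) ℝ where
  toFun X := Matrix.of fun a b => S.W b ⁅S.isoPart X, S.E a⁆
  map_add' X Y := by
    ext a b
    have : S.isoPart (X + Y) = S.isoPart X + S.isoPart Y := by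
      simp only [isoPart, map_add, add_smul, Finset.sum_add_distrib]; abel
    simp [this]
  map_smul' r X := by
    ext a b
    have : S.isoPart (r • X) = r • S.isoPart X := by
      simp only [isoPart, map_smul, smul_sub, Finset.smul_sum, smul_smul, smul_eq_mul]
    simp [this]

theorem isoRep_apply (X : 𝔤) (a b : Fin 3) : S.isoRep X a b = S.W b ⁅S.isoPart X, S.E a⁆ := rfl

theorem isoRep_E (a : Fin 3) : S.isoRep (S.E a) = 0 := by
  have : S.isoPart (S.E a) = 0 := by simp [isoPart, S.W_E]
  ext b c; simp [isoRep_apply, this]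

/-- `W` of the commutator of two elements of the isotropy algebra vanishes. -/
theorem W_lie_iso {Z Z' : 𝔤} (hZ : Z ∈ S.iso) (hZ' : Z' ∈ S.iso) (c : Fin 3) : S.W c ⁅Z, Z'⁆ = 0 :=
  (S.mem_iso _).1 (S.iso.lie_mem hZ hZ') c

/-- Both arguments are split into a frame part and an isotropy part; the bracket of the two isotropy
parts stays in the subalgebra `iso`, on which W vanishes. -/
theorem W_lie (X Y : 𝔤) (c : Fin 3) :
    S.W c ⁅X, Y⁆ = ∑ a, ∑ b, S.W a X * S.W b Y * S.D a b c
      + ∑ b, S.W b Y * S.isoRep X b c - ∑ a, S.W a X * S.isoRep Y a c := by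
  conv_lhs => rw [S.decomp X, S.decomp Y]
  simp only [add_lie, lie_add, sum_lie, lie_sum, smul_lie, lie_smul, map_add, map_sum, map_smul,
    smul_eq_mul, S.W_lie_iso (S.isoPart_mem X) (S.isoPart_mem Y), isoRep_apply]
  have : ∀ a, S.W c ⁅S.E a, S.isoPart Y⁆ = - S.W c ⁅S.isoPart Y, S.E a⁆ := fun a => by
    rw [← map_neg, lie_skew]
  have h : ∑ x, S.W x Y * ∑ y, S.W y X * S.W c ⁅S.E y, S.E x⁆
      = ∑ a, ∑ b, S.W a X * S.W b Y * S.W c ⁅S.E a, S.E b⁆ := by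
    simp only [Finset.mul_sum]
    rw [Finset.sum_comm]
    exact Finset.sum_congr rfl fun a _ => Finset.sum_congr rfl fun b _ => by ring
  simp only [this, D, mul_neg, Finset.sum_neg_distrib, mul_add, Finset.sum_add_distrib, h, add_zero]
  ring

end HomogeneousSpace

namespace Cosmology

variable {𝔤 : Type} [LieRing 𝔤] [LieAlgebra ℝ 𝔤] {S : HomogeneousSpace 𝔤} (M : Cosmology S)

/-- Matrix of the connection of the slices in the direction `E_a`. -/
noncomputable def connMatrix (t : ℝ) (a : Fin 3) : Matrix (Fin 3) (Fin 3) ℝ :=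
  Matrix.of fun b c => M.spatial.conn a b c t

/-- The Nomizu map of the slices, in the row convention `∇_X E_b = nomizu X b c E_c`. -/
noncomputable def nomizu (t : ℝ) : 𝔤 →ₗ[ℝ] Matrix (Fin 3) (Fin 3) ℝ :=
  ∑ a, (S.W a).smulRight (M.connMatrix t a) + S.isoRep

theorem nomizu_apply (t : ℝ) (X : 𝔤) :
    M.nomizu t X = ∑ a, S.W a X • M.connMatrix t a + S.isoRep X := by
  simp [nomizu]

theorem nomizu_E (t : ℝ) (a : Fin 3) : M.nomizu t (S.E a) = M.connMatrix t a := by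
  simp [nomizu_apply, S.isoRep_E, S.W_E]

theorem nomizu_of_mem (t : ℝ) {Z : 𝔤} (hZ : Z ∈ S.iso) : M.nomizu t Z = S.isoRep Z := by
  simp [nomizu_apply, (S.mem_iso Z).1 hZ]

/-- Curvature operator of the slices as a function of two elements of `𝔤`. -/
noncomputable def curv (t : ℝ) (X Y : 𝔤) : Matrix (Fin 3) (Fin 3) ℝ :=
  M.nomizu t Y * M.nomizu t X - M.nomizu t X * M.nomizu t Y - M.nomizu t ⁅X, Y⁆


variable {t : ℝ} (ht : t ∈ M.I)
include ht

/-- The connection part is skew because the connection of the slices is metric, the isotropy part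
because h is invariant under isotropies. -/
theorem nomizu_skew (X : 𝔤) : M.nomizu t X * M.h t + (M.nomizu t X * M.h t)ᵀ = 0 := by
  have h1 : ∀ a, M.connMatrix t a * M.h t + (M.connMatrix t a * M.h t)ᵀ = 0 := by
    intro a
    ext b c
    have h2 := M.spatial_conn_compat ht a b c
    simp only [Matrix.add_apply, Matrix.transpose_apply, Matrix.mul_apply, connMatrix,
      Matrix.of_apply, Matrix.zero_apply]
    rw [← h2]
    congr 1
    exact Finset.sum_congr rfl fun d _ => by rw [M.h_symm ht]
  have h2 : S.isoRep X * M.h t + (S.isoRep X * M.h t)ᵀ = 0 := by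
    ext b c
    have h3 := M.invariant _ (S.isoPart_mem X) t ht b c
    rw [Finset.sum_add_distrib] at h3
    simp only [Matrix.add_apply, Matrix.transpose_apply, Matrix.mul_apply, S.isoRep_apply,
      Matrix.zero_apply]
    rw [← h3]
    congr 1
    exact Finset.sum_congr rfl fun d _ => by rw [M.h_symm ht]
  rw [nomizu_apply, Matrix.add_mul, Matrix.transpose_add, add_add_add_comm, h2, add_zero,
    Matrix.sum_mul, Matrix.transpose_sum, ← Finset.sum_add_distrib]
  refine Finset.sum_eq_zero fun a _ => ?_
  rw [Matrix.smul_mul, Matrix.transpose_smul, ← smul_add, h1, smul_zero]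

/-- Torsion-freeness extended from the frame to all of 𝔤; the isotropy terms on both sides match by
`W_lie`. -/
theorem nomizu_torsion (X Y : 𝔤) :
    S.coords Y ᵥ* M.nomizu t X - S.coords X ᵥ* M.nomizu t Y = S.coords ⁅X, Y⁆ := by
  ext c
  have h1 : ∀ X Y, (S.coords Y ᵥ* M.nomizu t X) c
      = ∑ a, ∑ b, S.W a X * S.W b Y * M.spatial.conn a b c t + ∑ b, S.W b Y * S.isoRep X b c := by
    intro X Y
    simp only [Matrix.vecMul, dotProduct, nomizu_apply, Matrix.add_apply, Matrix.sum_apply,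
      Matrix.smul_apply, mul_add, Finset.sum_add_distrib, S.coords_apply, connMatrix,
      Matrix.of_apply, smul_eq_mul, Finset.mul_sum]
    rw [Finset.sum_comm]
    congr 1
    exact Finset.sum_congr rfl fun a _ => Finset.sum_congr rfl fun b _ => by ring
  rw [Pi.sub_apply, h1, h1, S.coords_apply, S.W_lie]
  have h2 : ∑ a, ∑ b, S.W a Y * S.W b X * M.spatial.conn a b c t
      = ∑ a, ∑ b, S.W a X * S.W b Y * M.spatial.conn b a c t := by
    rw [Finset.sum_comm]
    exact Finset.sum_congr rfl fun a _ => Finset.sum_congr rfl fun b _ => by ring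
  have h3 : ∑ a, ∑ b, S.W a X * S.W b Y * S.D a b c
      = ∑ a, ∑ b, S.W a X * S.W b Y * M.spatial.conn a b c t
        - ∑ a, ∑ b, S.W a X * S.W b Y * M.spatial.conn b a c t := by
    simp only [← Finset.sum_sub_distrib]
    refine Finset.sum_congr rfl fun a _ => Finset.sum_congr rfl fun b _ => ?_
    rw [← M.spatial_conn_torsion ht]; ring
  rw [h2, h3]
  ring

theorem coords_vecMul_nomizu_iso {Z : 𝔤} (hZ : Z ∈ S.iso) (Y : 𝔤) :
    S.coords Y ᵥ* M.nomizu t Z = S.coords ⁅Z, Y⁆ := by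
  rw [← M.nomizu_torsion ht, S.mem_iso_iff.1 hZ, Matrix.zero_vecMul, sub_zero]

/-- The Nomizu map is equivariant under the isotropy algebra. -/
theorem curv_iso {Z : 𝔤} (hZ : Z ∈ S.iso) (X : 𝔤) : M.curv t Z X = 0 := by
  -- First Bianchi identity: the Jacobi identity for Z, X, Y combined with vanishing torsion.
  have tor : ∀ X Y, S.coords Y ᵥ* M.curv t Z X = S.coords X ᵥ* M.curv t Z Y := by
    intro X Y
    have e : ∀ X Y, S.coords Y ᵥ* M.curv t Z X = (S.coords Y ᵥ* M.nomizu t X) ᵥ* M.nomizu t Z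
        - S.coords ⁅Z, Y⁆ ᵥ* M.nomizu t X - S.coords Y ᵥ* M.nomizu t ⁅Z, X⁆ := by
      intro X Y
      rw [curv, Matrix.vecMul_sub, Matrix.vecMul_sub, ← Matrix.vecMul_vecMul,
        ← Matrix.vecMul_vecMul, M.coords_vecMul_nomizu_iso ht hZ]
    rw [e, e, ← sub_eq_zero]
    have h1 := M.nomizu_torsion ht X Y
    have h2 := M.nomizu_torsion ht X ⁅Z, Y⁆
    have h3 := M.nomizu_torsion ht Y ⁅Z, X⁆
    have h4 := M.coords_vecMul_nomizu_iso ht hZ ⁅X, Y⁆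
    rw [← h1, Matrix.sub_vecMul] at h4
    have h5 : S.coords ⁅Z, ⁅X, Y⁆⁆ = S.coords ⁅X, ⁅Z, Y⁆⁆ - S.coords ⁅Y, ⁅Z, X⁆⁆ := by
      rw [leibniz_lie Z X Y, map_add, ← lie_skew Y ⁅Z, X⁆, map_neg]; abel
    rw [h5, ← h2, ← h3] at h4
    rw [← sub_eq_zero] at h4
    rw [← h4]
    abel
  -- Values of the Nomizu map are h-skew, and commutators of h-skew endomorphisms are h-skew.
  have skew : ∀ X, M.curv t Z X * M.h t + (M.curv t Z X * M.h t)ᵀ = 0 := by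
    intro X
    have hs : (M.h t)ᵀ = M.h t := by ext a b; exact M.h_symm ht b a
    have h1 : ∀ X, M.h t * (M.nomizu t X)ᵀ = - (M.nomizu t X * M.h t) := fun X => by
      have := M.nomizu_skew ht X
      rw [Matrix.transpose_mul, hs] at this
      exact eq_neg_of_add_eq_zero_right this
    have h2 : ∀ X Y, M.h t * ((M.nomizu t Y)ᵀ * (M.nomizu t X)ᵀ)
        = M.nomizu t Y * M.nomizu t X * M.h t := fun X Y => by
      rw [← Matrix.mul_assoc, h1, Matrix.neg_mul, Matrix.mul_assoc, h1, Matrix.mul_neg, neg_neg,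
        Matrix.mul_assoc]
    rw [Matrix.transpose_mul, hs, curv]
    simp only [Matrix.transpose_sub, Matrix.transpose_mul, Matrix.mul_sub, Matrix.sub_mul, h1, h2]
    abel
  -- Skew in one pair of slots and symmetric in an overlapping pair, hence zero.
  have hE : ∀ a, M.curv t Z (S.E a) = 0 := by
    refine Matrix.eq_zero_of_skew_of_symm (M.isUnit_det_h ht) _ (fun a => skew _) fun a b c => ?_
    have := congrFun (tor (S.E a) (S.E b)) c
    simpa [S.coords_E, Matrix.single_one_vecMul] using this
  ext a c
  have := congrFun (tor X (S.E a)) c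
  simpa [S.coords_E, Matrix.single_one_vecMul, hE] using this

omit ht in
theorem curv_antisymm (X Y : 𝔤) : M.curv t X Y = - M.curv t Y X := by
  simp only [curv]; rw [← lie_skew Y X, map_neg]; abel

omit ht in
theorem curv_add_left (X X' Y : 𝔤) : M.curv t (X + X') Y = M.curv t X Y + M.curv t X' Y := by
  simp only [curv, map_add, add_lie, Matrix.add_mul, Matrix.mul_add]; abel

omit ht in
theorem curv_smul_left (r : ℝ) (X Y : 𝔤) : M.curv t (r • X) Y = r • M.curv t X Y := by
  simp only [curv, map_smul, smul_lie, Matrix.smul_mul, Matrix.mul_smul, smul_sub]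

omit ht in
theorem curv_sum_left {n : ℕ} (f : Fin n → 𝔤) (Y : 𝔤) :
    M.curv t (∑ i, f i) Y = ∑ i, M.curv t (f i) Y := by
  have h0 : M.curv t 0 Y = 0 := by simp [curv]
  exact map_sum (AddMonoidHom.mk' (fun X => M.curv t X Y) fun X X' => M.curv_add_left X X' Y) f _

/-- Isotropy arguments drop out by `curv_iso`, so the curvature is a tensor on the tangent space
although its arguments are elements of 𝔤. -/
theorem curv_left (X Y : 𝔤) : M.curv t X Y = ∑ a, S.W a X • M.curv t (S.E a) Y := by
  conv_lhs => rw [S.decomp X, M.curv_add_left, M.curv_iso ht (S.isoPart_mem X), add_zero,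
    M.curv_sum_left]
  simp only [M.curv_smul_left]

-- Row vectors reverse the order of composition, which explains the order of the products in `curv`.
-- The isotropy part of the bracket inside the Nomizu map yields the `Om` term.
omit ht in
theorem riemann_eq_curv (a b c d : Fin 3) :
    M.spatial.riemann a b c d t = M.curv t (S.E a) (S.E b) c d := by
  have hD : M.spatial.D = S.D := rfl
  have hO : M.spatial.Om = S.Om := rfl
  simp only [FrameGeometry.riemann, FrameGeometry.act, curv, nomizu_E, M.nomizu_apply t ⁅S.E a, S.E b⁆,
    Matrix.sub_apply, Matrix.add_apply, Matrix.mul_apply, Matrix.sum_apply, Matrix.smul_apply,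
    connMatrix, Matrix.of_apply, S.isoRep_apply, smul_eq_mul, hD, hO,
    Finset.sum_sub_distrib, HomogeneousSpace.D, HomogeneousSpace.Om]
  simp [spatial]
  ring

omit ht in
theorem ricci_eq_curv (b c : Fin 3) :
    M.spatial.ricci b c t = ∑ a, M.curv t (S.E a) (S.E b) c a := by
  simp only [FrameGeometry.ricci, M.riemann_eq_curv]

/-- The Ricci tensor of the slices is invariant under isotropies. -/
theorem ricci_invariant {Z : 𝔤} (hZ : Z ∈ S.iso) (b c : Fin 3) :
    ∑ d, (S.W d ⁅Z, S.E b⁆ * M.spatial.ricci d c t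
      + S.W d ⁅Z, S.E c⁆ * M.spatial.ricci b d t) = 0 := by
  have hZX : ∀ X, M.nomizu t ⁅Z, X⁆
      = M.nomizu t X * M.nomizu t Z - M.nomizu t Z * M.nomizu t X := fun X => by
    have := M.curv_iso ht hZ X
    rw [curv, sub_eq_zero] at this
    exact this.symm
  -- By equivariance, Z acts on values of the Nomizu map by commutators, hence as a derivation on
  -- the curvature.
  have key : ∀ X Y, M.curv t ⁅Z, X⁆ Y + M.curv t X ⁅Z, Y⁆
      = M.curv t X Y * M.nomizu t Z - M.nomizu t Z * M.curv t X Y := by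
    intro X Y
    have h1 := hZX ⁅X, Y⁆
    rw [leibniz_lie, map_add] at h1
    simp only [curv, hZX]
    rw [show M.nomizu t ⁅⁅Z, X⁆, Y⁆ = M.nomizu t ⁅X, Y⁆ * M.nomizu t Z
        - M.nomizu t Z * M.nomizu t ⁅X, Y⁆ - M.nomizu t ⁅X, ⁅Z, Y⁆⁆ by rw [← h1]; abel]
    noncomm_ring
  have hρ : ∀ a d, S.isoRep Z a d = S.W d ⁅Z, S.E a⁆ := fun a d => by
    rw [S.isoRep_apply, S.isoPart_of_mem hZ]
  have h2 : ∑ a, (M.curv t ⁅Z, S.E a⁆ (S.E b) + M.curv t (S.E a) ⁅Z, S.E b⁆) c a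
      = ∑ a, (M.curv t (S.E a) (S.E b) * M.nomizu t Z
        - M.nomizu t Z * M.curv t (S.E a) (S.E b)) c a := by
    simp only [key]
  have h3 : ∀ a, M.curv t ⁅Z, S.E a⁆ (S.E b)
      = ∑ d, S.isoRep Z a d • M.curv t (S.E d) (S.E b) := fun a => by
    rw [M.curv_left ht]; simp only [hρ]
  have h4 : ∀ a, M.curv t (S.E a) ⁅Z, S.E b⁆
      = ∑ d, S.isoRep Z b d • M.curv t (S.E a) (S.E d) := fun a => by
    rw [M.curv_antisymm, M.curv_left ht, ← Finset.sum_neg_distrib]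
    refine Finset.sum_congr rfl fun d _ => ?_
    rw [M.curv_antisymm (S.E d), smul_neg, neg_neg, hρ]
  simp only [h3, h4, M.nomizu_of_mem t hZ, Matrix.add_apply, Matrix.sub_apply, Matrix.sum_apply,
    Matrix.smul_apply, Matrix.mul_apply, Finset.sum_add_distrib, Finset.sum_sub_distrib,
    smul_eq_mul] at h2
  -- The action of Z on the contracted pair of indices cancels in the trace.
  have h5 : ∑ a, ∑ d, S.isoRep Z a d * M.curv t (S.E d) (S.E b) c a
      = ∑ a, ∑ d, M.curv t (S.E a) (S.E b) c d * S.isoRep Z d a := by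
    rw [Finset.sum_comm]
    exact Finset.sum_congr rfl fun a _ => Finset.sum_congr rfl fun d _ => by ring
  have h6 : ∀ f : Fin 3 → Fin 3 → ℝ, ∑ a, ∑ d, f a d = ∑ d, ∑ a, f a d :=
    fun f => Finset.sum_comm
  rw [h5, h6 fun a d => S.isoRep Z b d * M.curv t (S.E a) (S.E d) c a,
    h6 fun a d => S.isoRep Z c d * M.curv t (S.E a) (S.E b) d a] at h2
  simp only [← Finset.mul_sum, ← M.ricci_eq_curv, hρ] at h2
  rw [Finset.sum_add_distrib]
  linarith

end Cosmology

/-! ### Connection, curvature and divergence in frames lifted to the Lie algebra -/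

namespace HomogeneousSpace

variable {𝔤 : Type} [LieRing 𝔤] [LieAlgebra ℝ 𝔤] (S : HomogeneousSpace 𝔤)

/-- Components of a triple of elements of `𝔤`. -/
def frameMatrix (L : Fin 3 → 𝔤) : Matrix (Fin 3) (Fin 3) ℝ := Matrix.of fun a c => S.W c (L a)

theorem frameMatrix_apply (L : Fin 3 → 𝔤) (a c : Fin 3) : S.frameMatrix L a c = S.W c (L a) := rfl

end HomogeneousSpace

namespace Cosmology

variable {𝔤 : Type} [LieRing 𝔤] [LieAlgebra ℝ 𝔤] {S : HomogeneousSpace 𝔤} (M : Cosmology S)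

section lift

variable {t : ℝ} (ht : t ∈ M.I) {L : Fin 3 → 𝔤} {Q : Matrix (Fin 3) (Fin 3) ℝ}
  (hQ : Q * S.frameMatrix L = 1) {K : Fin 3 → Matrix (Fin 3) (Fin 3) ℝ}
  {D : Fin 3 → Fin 3 → Fin 3 → ℝ}
  (hbr : ∀ a b, ⁅L a, L b⁆ - ∑ c, D a b c • L c ∈ S.iso)
  (hskew : ∀ a, K a * (S.frameMatrix L * M.h t * (S.frameMatrix L)ᵀ)
    + (K a * (S.frameMatrix L * M.h t * (S.frameMatrix L)ᵀ))ᵀ = 0)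
  (htor : ∀ a b c, K a b c - K b a c = D a b c)
include ht hQ hbr hskew htor

/-- The connection in an arbitrary frame that is lifted to `𝔤`. -/
theorem conn_lift (a : Fin 3) :
    K a = S.frameMatrix L * M.nomizu t (L a) * Q := by
  set P := S.frameMatrix L with hP
  have hPQ : P * Q = 1 := mul_eq_one_comm.1 hQ
  have hs : (M.h t)ᵀ = M.h t := by ext a b; exact M.h_symm ht b a
  have hdet : IsUnit (P * M.h t * Pᵀ).det := by
    have h1 : IsUnit P.det := by
      have := congrArg Matrix.det hPQ
      rw [Matrix.det_mul, Matrix.det_one] at this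
      exact IsUnit.of_mul_eq_one _ this
    rw [Matrix.det_mul, Matrix.det_mul, Matrix.det_transpose]
    exact (h1.mul (M.isUnit_det_h ht)).mul h1
  have hrow : ∀ b (A : Matrix (Fin 3) (Fin 3) ℝ) c, (P * A) b c = (S.coords (L b) ᵥ* A) c := by
    intro b A c; rfl
  -- Uniqueness of the Levi-Civita connection: the difference of the two candidates is metric-skew
  -- and free of torsion. The lifted vectors may have isotropy components.
  have key := Matrix.eq_zero_of_skew_of_symm hdet
    (fun a => K a - P * M.nomizu t (L a) * Q) ?_ ?_ a
  · exact sub_eq_zero.1 key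
  · intro a
    have h1 : P * M.nomizu t (L a) * Q * (P * M.h t * Pᵀ) = P * (M.nomizu t (L a) * M.h t) * Pᵀ := by
      calc _ = P * M.nomizu t (L a) * (Q * P) * M.h t * Pᵀ := by simp only [Matrix.mul_assoc]
        _ = _ := by rw [hQ, Matrix.mul_one]; simp only [Matrix.mul_assoc]
    have h2 := M.nomizu_skew ht (L a)
    have h3 : P * (M.nomizu t (L a) * M.h t) * Pᵀ + (P * (M.nomizu t (L a) * M.h t) * Pᵀ)ᵀ = 0 := by
      have : (P * (M.nomizu t (L a) * M.h t) * Pᵀ)ᵀ = P * (M.nomizu t (L a) * M.h t)ᵀ * Pᵀ := by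
        simp [Matrix.transpose_mul, Matrix.mul_assoc]
      rw [this, ← Matrix.add_mul, ← Matrix.mul_add, h2]
      simp
    simp only [Matrix.sub_mul, h1, Matrix.transpose_sub]
    rw [sub_add_sub_comm, hskew, h3, sub_zero]
  · intro a b c
    have h1 := M.nomizu_torsion ht (L a) (L b)
    have h2 : S.coords ⁅L a, L b⁆ = D a b ᵥ* P := by
      have := S.mem_iso_iff.1 (hbr a b)
      rw [map_sub, sub_eq_zero] at this
      rw [this, map_sum]
      ext c
      simp [Matrix.vecMul, dotProduct, P, S.frameMatrix_apply]
    have h3 : ∀ a b c, (P * M.nomizu t (L a) * Q) b c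
        = ((S.coords (L b) ᵥ* M.nomizu t (L a)) ᵥ* Q) c := fun a b c => by
      rw [Matrix.vecMul_vecMul, ← hrow, Matrix.mul_assoc]
    have h4 := congrFun (congrArg (fun x => x ᵥ* Q) h1) c
    simp only [Matrix.sub_vecMul, Pi.sub_apply, h2, Matrix.vecMul_vecMul (D a b) P Q, hPQ,
      Matrix.vecMul_one] at h4
    simp only [Matrix.sub_apply, h3]
    have := htor a b c
    linarith

/-- The Ricci tensor in an arbitrary frame that is lifted to `𝔤`. -/
theorem ricci_lift {O : Fin 3 → Fin 3 → Matrix (Fin 3) (Fin 3) ℝ}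
    (hO : ∀ a b c d, S.W d ⁅⁅L a, L b⁆ - ∑ c, D a b c • L c, L c⁆
      = ∑ e, O a b c e * S.W d (L e)) (b c : Fin 3) :
    ∑ i, ∑ j, S.W i (L b) * S.W j (L c) * M.spatial.ricci i j t
      = ∑ a, (K b * K a - K a * K b - ∑ e, D a b e • K e - O a b) c a := by
  set P := S.frameMatrix L with hP
  have hPQ : P * Q = 1 := mul_eq_one_comm.1 hQ
  have hK := M.conn_lift ht hQ hbr hskew htor
  -- On the isotropy remainder of a commutator the Nomizu map is the isotropy representation, and
  -- `O` is its matrix in the frame L.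
  have hO' : ∀ a b, P * M.nomizu t (⁅L a, L b⁆ - ∑ c, D a b c • L c) * Q = O a b := by
    intro a b
    have : P * M.nomizu t (⁅L a, L b⁆ - ∑ c, D a b c • L c) = O a b * P := by
      ext c d
      have h1 := congrFun (M.coords_vecMul_nomizu_iso ht (hbr a b) (L c)) d
      exact h1.trans (hO a b c d)
    rw [this, Matrix.mul_assoc, hPQ, Matrix.mul_one]
  have hcurv : ∀ a, K b * K a - K a * K b - ∑ e, D a b e • K e - O a b
      = P * M.curv t (L a) (L b) * Q := by
    intro a
    have e1 : ∀ a b, K a * K b = P * (M.nomizu t (L a) * M.nomizu t (L b)) * Q := fun a b => by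
      rw [hK a, hK b]
      calc _ = P * M.nomizu t (L a) * (Q * P) * M.nomizu t (L b) * Q := by
            simp only [Matrix.mul_assoc]; rfl
        _ = _ := by rw [hQ, Matrix.mul_one]; simp only [Matrix.mul_assoc]
    have e2 : M.nomizu t ⁅L a, L b⁆ = ∑ c, D a b c • M.nomizu t (L c)
        + M.nomizu t (⁅L a, L b⁆ - ∑ c, D a b c • L c) := by
      rw [map_sub, map_sum]; simp
    have hK' : ∀ a, P * M.nomizu t (L a) * Q = K a := fun a => (hK a).symm
    rw [curv, e2, e1, e1, ← hO' a b]
    simp only [Matrix.mul_sub, Matrix.sub_mul, Matrix.mul_add, Matrix.add_mul, Matrix.mul_sum,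
      Matrix.sum_mul, Matrix.mul_smul, Matrix.smul_mul, hK']
    abel
  simp only [hcurv]
  -- The trace over L is rewritten as a trace over `E`: only the W-components of L matter, and Q
  -- inverts P.
  have h1 : ∀ a, (P * M.curv t (L a) (L b) * Q) c a
      = ∑ i, (P * M.curv t (S.E i) (L b) * Q) c a * P a i := by
    intro a
    rw [M.curv_left ht]
    simp only [Matrix.mul_sum, Matrix.sum_mul, Matrix.sum_apply, Matrix.mul_smul, Matrix.smul_mul,
      Matrix.smul_apply, smul_eq_mul]
    exact Finset.sum_congr rfl fun i _ => mul_comm _ _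
  have h2 : ∀ i, ∑ a, (P * M.curv t (S.E i) (L b) * Q) c a * P a i
      = ∑ m, ∑ j, S.W j (L b) * S.W m (L c) * M.curv t (S.E i) (S.E j) m i := by
    intro i
    rw [← Matrix.mul_apply, Matrix.mul_assoc, hQ, Matrix.mul_one, M.curv_antisymm, M.curv_left ht,
      Matrix.mul_apply]
    refine Finset.sum_congr rfl fun m _ => ?_
    rw [Matrix.neg_apply, Matrix.sum_apply, ← Finset.sum_neg_distrib, Finset.mul_sum]
    refine Finset.sum_congr rfl fun j _ => ?_
    rw [M.curv_antisymm (S.E j), Matrix.smul_apply, Matrix.neg_apply, hP, S.frameMatrix_apply,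
      smul_eq_mul]
    ring
  simp only [h1]
  conv_rhs =>
    rw [Finset.sum_comm]
    simp only [h2]
    rw [Finset.sum_comm]
  conv_lhs => rw [Finset.sum_comm]
  refine Finset.sum_congr rfl fun m _ => ?_
  rw [Finset.sum_comm]
  refine Finset.sum_congr rfl fun j _ => ?_
  rw [M.ricci_eq_curv, Finset.mul_sum]

/-- The divergence of an invariant covector in an arbitrary frame that is lifted to `𝔤`. -/
theorem divergence_lift (hinv : (M.h t)⁻¹ = (S.frameMatrix L)ᵀ * S.frameMatrix L) {n : Fin 3 → ℝ}
    (hn : ∀ Z ∈ S.iso, ∀ b, ∑ c, n c * S.W c ⁅Z, S.E b⁆ = 0) :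
    ∑ a, ∑ b, ∑ c, (M.h t)⁻¹ a b * (M.spatial.conn a b c t * n c)
      = ∑ i, (K i *ᵥ (S.frameMatrix L *ᵥ n)) i := by
  have hconn := M.conn_lift ht hQ hbr hskew htor
  set P := S.frameMatrix L with hP
  -- By invariance of n the isotropy component of a lifted vector does not contribute to the
  -- divergence.
  have hrep : ∀ i, S.isoRep (L i) *ᵥ n = 0 := by
    intro i
    ext b
    have := hn _ (S.isoPart_mem (L i)) b
    rw [Pi.zero_apply, ← this, Matrix.mulVec, dotProduct]
    exact Finset.sum_congr rfl fun c _ => by rw [S.isoRep_apply, mul_comm]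
  have h1 : ∀ i, K i *ᵥ (P *ᵥ n) = P *ᵥ (M.nomizu t (L i) *ᵥ n) := by
    intro i
    rw [hconn i, Matrix.mulVec_mulVec, Matrix.mulVec_mulVec, Matrix.mul_assoc _ Q, hQ,
      Matrix.mul_one]
  have h2 : ∀ i, M.nomizu t (L i) *ᵥ n = ∑ a, P i a • (M.connMatrix t a *ᵥ n) := by
    intro i
    rw [nomizu_apply, Matrix.add_mulVec, hrep, add_zero, Matrix.sum_mulVec]
    exact Finset.sum_congr rfl fun a _ => by rw [Matrix.smul_mulVec]; rfl
  rw [hinv]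
  simp only [h1, h2]
  have h4 : ∀ a b, ∑ c, M.spatial.conn a b c t * n c = (M.connMatrix t a *ᵥ n) b :=
    fun _ _ => rfl
  have h5 : ∀ g : Fin 3 → Fin 3 → ℝ, ∑ a, ∑ b, (Pᵀ * P) a b * g a b
      = ∑ i, ∑ b, P i b * ∑ a, P i a * g a b := by
    intro g
    simp only [Matrix.mul_apply, Matrix.transpose_apply, Finset.sum_mul, Finset.mul_sum]
    conv_rhs => rw [Finset.sum_comm]
    rw [Finset.sum_comm]
    refine Finset.sum_congr rfl fun b _ => ?_
    rw [Finset.sum_comm]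
    exact Finset.sum_congr rfl fun i _ => Finset.sum_congr rfl fun a _ => by ring
  have h6 : ∀ i, (P *ᵥ ∑ a, P i a • (M.connMatrix t a *ᵥ n)) i
      = ∑ b, P i b * ∑ a, P i a * (M.connMatrix t a *ᵥ n) b := fun i => by
    rw [Matrix.mulVec, dotProduct]
    simp only [Finset.sum_apply, Pi.smul_apply, smul_eq_mul]
  simp only [← Finset.mul_sum, h4, h6]
  exact h5 _

end lift

end Cosmology

/-! ### Frames adapted to the three classes, and the source they carry -/

namespace Cosmology

variable {𝔤 : Type} [LieRing 𝔤] [LieAlgebra ℝ 𝔤] {S : HomogeneousSpace 𝔤} (M : Cosmology S)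

/-- Structure constants of the frames adapted to the three classes of spacetimes. -/
def adaptedD (s y : ℝ) (a b c : Fin 3) : ℝ :=
  match a, b, c with
  | 0, 1, 1 => s
  | 1, 0, 1 => -s
  | 0, 2, 2 => -s
  | 2, 0, 2 => s
  | 1, 2, 2 => y
  | 2, 1, 2 => -y
  | _, _, _ => 0

/-- Isotropy part of the curvature in an adapted frame. -/
def adaptedOm (κ : ℝ) (a b : Fin 3) : Matrix (Fin 3) (Fin 3) ℝ :=
  Matrix.of fun c d => match a, b, c, d with
    | 1, 2, 1, 2 => κ
    | 1, 2, 2, 1 => -κ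
    | 2, 1, 1, 2 => -κ
    | 2, 1, 2, 1 => κ
    | _, _, _, _ => 0

/-- Connection of an adapted frame. -/
def adaptedConn (s y : ℝ) (a : Fin 3) : Matrix (Fin 3) (Fin 3) ℝ :=
  Matrix.of fun b c => match a, b, c with
    | 1, 0, 1 => -s
    | 1, 1, 0 => s
    | 2, 0, 2 => s
    | 2, 2, 0 => -s
    | 2, 1, 2 => -y
    | 2, 2, 1 => y
    | _, _, _ => 0

/-- Isotropy part of the commutators of an adapted frame. -/
def adaptedIso {V : Type*} [AddCommGroup V] (Z : V) (a b : Fin 3) : V :=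
  match a, b with
  | 1, 2 => Z
  | 2, 1 => -Z
  | _, _ => 0

/-- With `adaptedConn_skew` this identifies, through `conn_lift`, the Levi-Civita connection of
every orthonormal frame with these commutators. -/
theorem adaptedConn_torsion (s y : ℝ) (a b c : Fin 3) :
    adaptedConn s y a b c - adaptedConn s y b a c = adaptedD s y a b c := by
  fin_cases a <;> fin_cases b <;> fin_cases c <;> simp [adaptedConn, adaptedD]

theorem adaptedConn_skew (s y : ℝ) (a : Fin 3) :
    adaptedConn s y a + (adaptedConn s y a)ᵀ = 0 := by
  ext b c
  fin_cases a <;> fin_cases b <;> fin_cases c <;> simp [adaptedConn]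

/-- The off-diagonal entries are multiples of s y, so the hypothesis makes the tensor diagonal; the
two directions orthogonal to the zeroth then have equal curvature. -/
theorem adapted_ricci {s y κ : ℝ} (hsy : s * y = 0) (b c : Fin 3) :
    ∑ a, (adaptedConn s y b * adaptedConn s y a - adaptedConn s y a * adaptedConn s y b
      - ∑ e, adaptedD s y a b e • adaptedConn s y e - adaptedOm κ a b) c a
      = (κ - y ^ 2) * (if b = c then 1 else 0)
        + (-2 * s ^ 2 - (κ - y ^ 2)) * ((if b = 0 then 1 else 0) * (if c = 0 then 1 else 0)) := by
  fin_cases b <;> fin_cases c <;>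
    simp [adaptedConn, adaptedD, adaptedOm, Fin.sum_univ_three, Matrix.mul_apply, hsy,
      mul_comm y s] <;> ring

/-- A covector that is determined by the Ricci tensor is invariant under isotropies. -/
theorem invariant_of_ricci {t : ℝ} (ht : t ∈ M.I) {n : Fin 3 → ℝ} {r k : ℝ}
    (hric : ∀ i j, M.spatial.ricci i j t = r * M.h t i j + k * (n i * n j)) (hk : k ≠ 0)
    (hn : n ≠ 0) : ∀ Z ∈ S.iso, ∀ b, ∑ c, n c * S.W c ⁅Z, S.E b⁆ = 0 := by
  intro Z hZ
  have h1 : ∀ b c, (∑ d, n d * S.W d ⁅Z, S.E b⁆) * n c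
      + (∑ d, n d * S.W d ⁅Z, S.E c⁆) * n b = 0 := by
    intro b c
    have e1 := M.ricci_invariant ht hZ b c
    have e2 := M.invariant Z hZ t ht b c
    simp only [hric] at e1
    have e3 : k * ((∑ d, n d * S.W d ⁅Z, S.E b⁆) * n c
      + (∑ d, n d * S.W d ⁅Z, S.E c⁆) * n b) = 0 := by
      rw [← sub_eq_zero.2 (e1.trans (mul_zero r).symm), ← e2, Finset.mul_sum, Finset.sum_mul,
        Finset.sum_mul, ← Finset.sum_add_distrib, Finset.mul_sum, ← Finset.sum_sub_distrib]
      exact Finset.sum_congr rfl fun d _ => by ring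
    exact (mul_eq_zero.1 e3).resolve_left hk
  -- At an index where n is nonzero the diagonal identity comes first, and then the column of that
  -- index gives all b.
  obtain ⟨c, hc⟩ := Function.ne_iff.1 hn
  have hc' : n c ≠ 0 := hc
  have h2 : ∑ d, n d * S.W d ⁅Z, S.E c⁆ = 0 := by
    have := h1 c c
    rw [← two_mul] at this
    simpa [hc'] using this
  intro b
  have := h1 b c
  rw [h2, zero_mul, add_zero] at this
  exact (mul_eq_zero.1 this).resolve_right hc'

omit M in
/-- An invariant covector that is closed in some frame lifted to `𝔤` vanishes on commutators. -/
theorem char_of_frame {L : Fin 3 → 𝔤} {Q : Matrix (Fin 3) (Fin 3) ℝ}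
    (hQ : Q * S.frameMatrix L = 1) {n : Fin 3 → ℝ}
    (hinv : ∀ Z ∈ S.iso, ∀ b, ∑ c, n c * S.W c ⁅Z, S.E b⁆ = 0)
    (hL : ∀ a b, ∑ c, n c * S.W c ⁅L a, L b⁆ = 0) (X Y : 𝔤) : ∑ c, n c * S.W c ⁅X, Y⁆ = 0 := by
  set P := S.frameMatrix L with hP
  let φ : 𝔤 →ₗ[ℝ] ℝ := ∑ c, n c • S.W c
  have hφ : ∀ X, φ X = ∑ c, n c * S.W c X := fun X => by simp [φ]
  have hφiso : ∀ Z ∈ S.iso, φ Z = 0 := fun Z hZ => by simp [hφ, (S.mem_iso Z).1 hZ]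
  have hφZ : ∀ Z ∈ S.iso, ∀ Y, φ ⁅Z, Y⁆ = 0 := by
    intro Z hZ Y
    rw [S.decomp Y, lie_add, map_add, hφiso _ (S.iso.lie_mem hZ (S.isoPart_mem Y)), lie_sum,
      map_sum, add_zero]
    refine Finset.sum_eq_zero fun a _ => ?_
    rw [lie_smul, map_smul, hφ, hinv Z hZ, smul_zero]
  have hφL : ∀ a b, φ ⁅L a, L b⁆ = 0 := fun a b => (hφ _).trans (hL a b)
  have hdec : ∀ X : 𝔤, X - ∑ a, (S.coords X ᵥ* Q) a • L a ∈ S.iso := by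
    intro X
    rw [S.mem_iso_iff, map_sub, sub_eq_zero]
    have h1 : S.coords (∑ a, (S.coords X ᵥ* Q) a • L a) = (S.coords X ᵥ* Q) ᵥ* P := by
      ext c
      simp [Matrix.vecMul, dotProduct, hP, S.frameMatrix_apply]
    rw [h1, Matrix.vecMul_vecMul, hQ, Matrix.vecMul_one]
  have h1 : X = ∑ a, (S.coords X ᵥ* Q) a • L a + (X - ∑ a, (S.coords X ᵥ* Q) a • L a) := by abel
  have h2 : Y = ∑ a, (S.coords Y ᵥ* Q) a • L a + (Y - ∑ a, (S.coords Y ᵥ* Q) a • L a) := by abel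
  rw [← hφ, h1, add_lie, map_add, hφZ _ (hdec X), add_zero, h2, lie_add, map_add, ← lie_skew _
    (Y - ∑ a, (S.coords Y ᵥ* Q) a • L a), map_neg, hφZ _ (hdec Y), neg_zero, add_zero]
  simp only [sum_lie, lie_sum, smul_lie, lie_smul, map_sum, map_smul, hφL, smul_zero,
    Finset.sum_const_zero]

section adapted

variable {t₀ : ℝ} (ht₀ : t₀ ∈ M.I) {L : Fin 3 → 𝔤}
  (hL : ∀ a b, ∑ c, ∑ d, S.W c (L a) * S.W d (L b) * M.h t₀ c d = if a = b then 1 else 0)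
  {s y κ : ℝ} {Z : 𝔤} (hZ : Z ∈ S.iso) (h01 : ⁅L 0, L 1⁆ = s • L 1) (h02 : ⁅L 0, L 2⁆ = -s • L 2)
  (h12 : ⁅L 1, L 2⁆ = y • L 2 + Z) (hZ0 : ⁅Z, L 0⁆ = 0) (hZ1 : ⁅Z, L 1⁆ = κ • L 2)
  (hZ2 : ⁅Z, L 2⁆ = -κ • L 1) (hsy : s * y = 0) (hne : -2 * s ^ 2 ≠ κ - y ^ 2)
include ht₀ hL hZ h01 h02 h12 hZ0 hZ1 hZ2 hsy hne

/-- In this frame Ric = r h + k n⊗n with n dual to L 0 and k = −2s² − r, nonzero by `hne`. No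
commutator has an L 0 component, so n is closed, and ad L 0 is trace-free, so n is coclosed. The
source is n scaled by the square root of |k|. -/
theorem isSource_of_adapted : ∃ v ε, M.IsSource t₀ v ε (κ - y ^ 2) := by
  set P := S.frameMatrix L with hP
  have hPhP : P * M.h t₀ * Pᵀ = 1 := by
    ext a b
    rw [Matrix.one_apply, ← hL, Matrix.mul_apply]
    simp only [Matrix.mul_apply, Matrix.transpose_apply, hP, S.frameMatrix_apply, Finset.sum_mul]
    rw [Finset.sum_comm]
    exact Finset.sum_congr rfl fun c _ => Finset.sum_congr rfl fun d _ => by ring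
  set Q := M.h t₀ * Pᵀ with hQdef
  have hPQ : P * Q = 1 := by rw [hQdef, ← Matrix.mul_assoc, hPhP]
  have hQ : Q * P = 1 := mul_eq_one_comm.1 hPQ
  have hsym : (M.h t₀)ᵀ = M.h t₀ := by ext a b; exact M.h_symm ht₀ b a
  have hQQ : Q * Qᵀ = M.h t₀ := by
    rw [hQdef, Matrix.transpose_mul, Matrix.transpose_transpose, hsym, ← Matrix.mul_assoc,
      ← hQdef, hQ, Matrix.one_mul]
  have hinv : (M.h t₀)⁻¹ = Pᵀ * P := by
    apply Matrix.inv_eq_right_inv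
    rw [← Matrix.mul_assoc, ← hQdef, hQ]
  have h10 : ⁅L 1, L 0⁆ = -s • L 1 := by rw [← lie_skew, h01, neg_smul]
  have h20 : ⁅L 2, L 0⁆ = s • L 2 := by rw [← lie_skew, h02, neg_smul, neg_neg]
  have h21 : ⁅L 2, L 1⁆ = -(y • L 2 + Z) := by rw [← lie_skew, h12]
  have hdiff : ∀ a b, ⁅L a, L b⁆ - ∑ c, adaptedD s y a b c • L c
      = adaptedIso Z a b := by
    intro a b
    fin_cases a <;> fin_cases b <;>
      simp [adaptedD, adaptedIso, Fin.sum_univ_three, h01, h02, h12, h10, h20, h21]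
  have hbr : ∀ a b, ⁅L a, L b⁆ - ∑ c, adaptedD s y a b c • L c ∈ S.iso := by
    intro a b
    rw [hdiff]
    fin_cases a <;> fin_cases b <;> simp [adaptedIso, hZ]
  have hskew : ∀ a, adaptedConn s y a * (P * M.h t₀ * Pᵀ)
      + (adaptedConn s y a * (P * M.h t₀ * Pᵀ))ᵀ = 0 := by
    intro a
    rw [hPhP, Matrix.mul_one, adaptedConn_skew]
  have hO : ∀ a b c d, S.W d ⁅⁅L a, L b⁆ - ∑ c, adaptedD s y a b c • L c, L c⁆
      = ∑ e, adaptedOm κ a b c e * S.W d (L e) := by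
    intro a b c d
    rw [hdiff]
    fin_cases a <;> fin_cases b <;> fin_cases c <;>
      simp [adaptedOm, adaptedIso, Fin.sum_univ_three, hZ0, hZ1, hZ2]
  have hric := fun b c => (M.ricci_lift ht₀ hQ hbr hskew (adaptedConn_torsion s y) hO b c).trans
    (adapted_ricci hsy b c)
  set n : Fin 3 → ℝ := fun a => Q a 0 with hn
  set r : ℝ := κ - y ^ 2 with hr
  -- the Ricci tensor in the original frame
  set R : Matrix (Fin 3) (Fin 3) ℝ := Matrix.of fun i j => M.spatial.ricci i j t₀ with hR
  have hRL : P * R * Pᵀ = r • (1 : Matrix (Fin 3) (Fin 3) ℝ)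
      + (-2 * s ^ 2 - r) • Matrix.vecMulVec (Pi.single 0 1) (Pi.single 0 1) := by
    ext b c
    have := hric b c
    simp only [Matrix.add_apply, Matrix.smul_apply, Matrix.one_apply, Matrix.vecMulVec_apply,
      Pi.single_apply, smul_eq_mul]
    rw [← this, Matrix.mul_apply]
    simp only [Matrix.mul_apply, Matrix.transpose_apply, hP, S.frameMatrix_apply, Finset.sum_mul]
    rw [Finset.sum_comm]
    exact Finset.sum_congr rfl fun c _ => Finset.sum_congr rfl fun d _ => by
      rw [hR, Matrix.of_apply]; ring
  have hRQ : R = Q * (P * R * Pᵀ) * Qᵀ := by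
    calc R = (Q * P) * R * (Q * P)ᵀ := by rw [hQ]; simp
      _ = _ := by rw [Matrix.transpose_mul]; simp only [Matrix.mul_assoc]
  have hric' : ∀ i j, M.spatial.ricci i j t₀
      = r * M.h t₀ i j + (-2 * s ^ 2 - r) * (n i * n j) := by
    intro i j
    have h1 : R i j = M.spatial.ricci i j t₀ := rfl
    rw [← h1, hRQ, hRL, Matrix.mul_add, Matrix.add_mul, Matrix.mul_smul, Matrix.mul_one,
      Matrix.smul_mul, hQQ, Matrix.mul_smul, Matrix.smul_mul, Matrix.mul_vecMulVec,
      Matrix.vecMulVec_mul]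
    simp [Matrix.vecMulVec_apply, Matrix.vecMul_transpose, hn]
  have hne' : -2 * s ^ 2 - r ≠ 0 := sub_ne_zero.2 hne
  have hnL : ∀ a, ∑ c, n c * S.W c (L a) = if a = 0 then 1 else 0 := by
    intro a
    have := congrFun (congrFun hPQ a) 0
    rw [Matrix.mul_apply, Matrix.one_apply] at this
    rw [← this]
    exact Finset.sum_congr rfl fun c _ => mul_comm _ _
  have hn0 : n ≠ 0 := by
    intro h
    have := hnL 0
    simp [h] at this
  have hinvE := M.invariant_of_ricci ht₀ hric' hne' hn0
  have hchar := char_of_frame hQ hinvE fun a b => by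
    have h1 : ⁅L a, L b⁆ = ∑ c, adaptedD s y a b c • L c
        + (⁅L a, L b⁆ - ∑ c, adaptedD s y a b c • L c) := by abel
    have h3 : ∀ c, S.W c (⁅L a, L b⁆ - ∑ c, adaptedD s y a b c • L c) = 0 :=
      (S.mem_iso _).1 (hbr a b)
    have h4 : ∑ c, n c * S.W c ⁅L a, L b⁆ = ∑ d, adaptedD s y a b d * ∑ c, n c * S.W c (L d) := by
      rw [h1]
      simp only [map_add, h3, add_zero, map_sum, map_smul, smul_eq_mul, Finset.mul_sum]
      rw [Finset.sum_comm]
      exact Finset.sum_congr rfl fun d _ => Finset.sum_congr rfl fun c _ => by ring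
    rw [h4]
    simp only [hnL]
    fin_cases a <;> fin_cases b <;> simp [adaptedD, Fin.sum_univ_three]
  -- divergence
  have hcocl : ∑ a, ∑ b, ∑ c, (M.h t₀)⁻¹ a b * (M.spatial.conn a b c t₀ * n c) = 0 := by
    have hPn : P *ᵥ n = Pi.single 0 1 := by
      ext a
      rw [Pi.single_apply, ← hnL a, Matrix.mulVec, dotProduct]
      exact Finset.sum_congr rfl fun c _ => mul_comm (S.W c (L a)) (n c)
    rw [M.divergence_lift ht₀ hQ hbr hskew (adaptedConn_torsion s y) hinv hinvE, ← hP, hPn]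
    simp [adaptedConn, Fin.sum_univ_three]
  -- The sign of k becomes the sign of the action and its size the length of the covector.
  have hε : ∃ ε : ℝ, (ε = 1 ∨ ε = -1) ∧ -2 * s ^ 2 - r = ε * |-2 * s ^ 2 - r| := by
    rcases abs_choice (-2 * s ^ 2 - r) with h | h
    · exact ⟨1, Or.inl rfl, by rw [h]; ring⟩
    · exact ⟨-1, Or.inr rfl, by rw [h]; ring⟩
  obtain ⟨ε, hε1, hε2⟩ := hε
  set c := √|-2 * s ^ 2 - r| with hc
  have hc0 : c ≠ 0 := (Real.sqrt_pos.2 (abs_pos.2 hne')).ne'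
  have hc2 : |-2 * s ^ 2 - r| = c ^ 2 := (Real.sq_sqrt (abs_nonneg _)).symm
  refine ⟨c • n, ε, smul_ne_zero hc0 hn0, hε1, fun X Y => ?_, ?_, fun a b => ?_⟩
  · have := hchar X Y
    simp only [Pi.smul_apply, smul_eq_mul, mul_assoc, ← Finset.mul_sum, this, mul_zero]
  · have : ∑ a, ∑ b, ∑ d, (M.h t₀)⁻¹ a b * (M.spatial.conn a b d t₀ * (c • n) d)
        = c * ∑ a, ∑ b, ∑ d, (M.h t₀)⁻¹ a b * (M.spatial.conn a b d t₀ * n d) := by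
      simp only [Finset.mul_sum]
      exact Finset.sum_congr rfl fun a _ => Finset.sum_congr rfl fun b _ =>
        Finset.sum_congr rfl fun d _ => by simp; ring
    rw [this, hcocl, mul_zero]
  · rw [hric', hε2, hc2]
    simp
    ring

end adapted

end Cosmology

/-! ### Each of the three classes admits a source -/

namespace Cosmology

variable {𝔤 : Type} [LieRing 𝔤] [LieAlgebra ℝ 𝔤] {S : HomogeneousSpace 𝔤} (M : Cosmology S)

/-- The spatial metric, pulled back to `𝔤`. -/
def bil (t : ℝ) (X Y : 𝔤) : ℝ := ∑ c, ∑ d, S.W c X * S.W d Y * M.h t c d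

theorem bil_add_left (t : ℝ) (X X' Y : 𝔤) : M.bil t (X + X') Y = M.bil t X Y + M.bil t X' Y := by
  simp only [bil, map_add, add_mul, Finset.sum_add_distrib]

theorem bil_smul_left (t r : ℝ) (X Y : 𝔤) : M.bil t (r • X) Y = r * M.bil t X Y := by
  simp only [bil, map_smul, smul_eq_mul, Finset.mul_sum, mul_assoc]

theorem bil_add_right (t : ℝ) (X Y Y' : 𝔤) : M.bil t X (Y + Y') = M.bil t X Y + M.bil t X Y' := by
  simp only [bil, map_add, add_mul, mul_add, Finset.sum_add_distrib]

theorem bil_smul_right (t r : ℝ) (X Y : 𝔤) : M.bil t X (r • Y) = r * M.bil t X Y := by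
  simp only [bil, map_smul, smul_eq_mul, Finset.mul_sum]
  exact Finset.sum_congr rfl fun _ _ => Finset.sum_congr rfl fun _ _ => by ring

theorem bil_neg_left (t : ℝ) (X Y : 𝔤) : M.bil t (-X) Y = - M.bil t X Y := by
  rw [← neg_one_smul ℝ X, bil_smul_left]; ring

theorem bil_neg_right (t : ℝ) (X Y : 𝔤) : M.bil t X (-Y) = - M.bil t X Y := by
  rw [← neg_one_smul ℝ Y, bil_smul_right]; ring

theorem bil_sub_left (t : ℝ) (X X' Y : 𝔤) : M.bil t (X - X') Y = M.bil t X Y - M.bil t X' Y := by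
  rw [sub_eq_add_neg, bil_add_left, bil_neg_left]; ring

theorem bil_sub_right (t : ℝ) (X Y Y' : 𝔤) : M.bil t X (Y - Y') = M.bil t X Y - M.bil t X Y' := by
  rw [sub_eq_add_neg, bil_add_right, bil_neg_right]; ring

section

variable {t : ℝ} (ht : t ∈ M.I)
include ht

theorem bil_symm (X Y : 𝔤) : M.bil t X Y = M.bil t Y X := by
  rw [bil, bil, Finset.sum_comm]
  exact Finset.sum_congr rfl fun _ _ => Finset.sum_congr rfl fun _ _ => by
    rw [M.h_symm ht]; ring

theorem bil_pos {X : 𝔤} (hX : X ∉ S.iso) : 0 < M.bil t X X := by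
  have h0 : S.coords X ≠ 0 := fun h => hX (S.mem_iso_iff.2 h)
  have := (M.posDef t ht).dotProduct_mulVec_pos h0
  refine lt_of_lt_of_eq this ?_
  simp only [bil, dotProduct, Matrix.mulVec, star_trivial, Finset.mul_sum, S.coords_apply]
  exact Finset.sum_congr rfl fun _ _ => Finset.sum_congr rfl fun _ _ => by ring

theorem bil_invariant {Z : 𝔤} (hZ : Z ∈ S.iso) (X Y : 𝔤) :
    M.bil t ⁅Z, X⁆ Y + M.bil t X ⁅Z, Y⁆ = 0 := by
  have e1 : ∀ X Y, M.bil t X Y = S.coords X ⬝ᵥ (M.h t *ᵥ S.coords Y) := by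
    intro X Y
    simp only [bil, dotProduct, Matrix.mulVec, Finset.mul_sum, S.coords_apply]
    exact Finset.sum_congr rfl fun _ _ => Finset.sum_congr rfl fun _ _ => by ring
  have hs := M.nomizu_skew ht Z
  have hsym : (M.h t)ᵀ = M.h t := by ext a b; exact M.h_symm ht b a
  rw [Matrix.transpose_mul, hsym] at hs
  rw [e1, e1, ← M.coords_vecMul_nomizu_iso ht hZ, ← M.coords_vecMul_nomizu_iso ht hZ,
    ← Matrix.dotProduct_mulVec, ← Matrix.mulVec_transpose, Matrix.mulVec_mulVec,
    Matrix.mulVec_mulVec, ← dotProduct_add, ← Matrix.add_mulVec, hs, Matrix.zero_mulVec,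
    dotProduct_zero]

end

/-- The product is bracketed as it arises from `bil_smul_left` and `bil_smul_right`. -/
theorem hasUnitMultiple {t : ℝ} (ht : t ∈ M.I) {X : 𝔤} (hX : X ∉ S.iso) :
    ∃ a : ℝ, 0 < a ∧ a * (a * M.bil t X X) = 1 := by
  have hp := M.bil_pos ht hX
  refine ⟨(√(M.bil t X X))⁻¹, by positivity, ?_⟩
  have : √(M.bil t X X) * √(M.bil t X X) = M.bil t X X := Real.mul_self_sqrt hp.le
  rw [← mul_assoc, ← mul_inv, this, inv_mul_cancel₀ hp.ne']

/-- Orthogonalization of `T` against two orthogonal elements `X`, `V`. -/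
theorem exists_orthogonal {t : ℝ} (ht : t ∈ M.I) {T X V : 𝔤} (hX : X ∉ S.iso) (hV : V ∉ S.iso)
    (hXV : M.bil t X V = 0) :
    ∃ α β : ℝ, M.bil t (T + α • X + β • V) X = 0 ∧ M.bil t (T + α • X + β • V) V = 0 := by
  have h1 := (M.bil_pos ht hX).ne'
  have h2 := (M.bil_pos ht hV).ne'
  refine ⟨-(M.bil t T X / M.bil t X X), -(M.bil t T V / M.bil t V V), ?_, ?_⟩
  · simp only [bil_add_left, bil_smul_left, M.bil_symm ht V X, hXV]
    field_simp; ring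
  · simp only [bil_add_left, bil_smul_left, hXV]
    field_simp; ring

theorem orthonormal_of_orthogonal {t : ℝ} (ht : t ∈ M.I) {X Y V : 𝔤} {a b c : ℝ}
    (hX : a * (a * M.bil t X X) = 1) (hY : b * (b * M.bil t Y Y) = 1)
    (hV : c * (c * M.bil t V V) = 1) (hXY : M.bil t X Y = 0) (hXV : M.bil t X V = 0)
    (hYV : M.bil t Y V = 0) (i j : Fin 3) :
    M.bil t ((![a • X, b • Y, c • V] : Fin 3 → 𝔤) i) ((![a • X, b • Y, c • V] : Fin 3 → 𝔤) j)
      = if i = j then 1 else 0 := by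
  fin_cases i <;> fin_cases j <;>
    simp [bil_smul_left, bil_smul_right, hX, hY, hV, hXY, hXV, hYV, M.bil_symm ht Y X,
      M.bil_symm ht V X, M.bil_symm ht V Y]

/-- Expresses transversality: the coordinates of the combination are the image of x under an
invertible matrix. -/
theorem not_mem_iso_of_det {Y : Fin 3 → 𝔤} (hdet : (Matrix.of fun a b => S.W a (Y b)).det ≠ 0)
    {x : Fin 3 → ℝ} (hx : x ≠ 0) : ∑ b, x b • Y b ∉ S.iso := by
  intro h
  have h0 := S.mem_iso_iff.1 h
  refine hdet (Matrix.exists_mulVec_eq_zero_iff.1 ⟨x, hx, ?_⟩)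
  ext a
  have := congrFun h0 a
  simp only [map_sum, map_smul, Finset.sum_apply, Pi.smul_apply, S.coords_apply, smul_eq_mul,
    Pi.zero_apply] at this
  rw [Pi.zero_apply, ← this]
  simp only [Matrix.mulVec, dotProduct, Matrix.of_apply]
  exact Finset.sum_congr rfl fun b _ => mul_comm _ _

theorem epsilon_table : epsilon 0 1 2 = 1 ∧ epsilon 0 2 1 = -1 ∧ epsilon 1 2 0 = 1 ∧
    (∀ a b, epsilon a b a = 0) ∧ (∀ a b, epsilon a b b = 0) ∧ (∀ a b, epsilon a a b = 0) := by
  refine ⟨?_, ?_, ?_, fun a b => ?_, fun a b => ?_, fun a b => ?_⟩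
  · simp [epsilon, Matrix.det_fin_three]
  · simp [epsilon, Matrix.det_fin_three]
  · simp [epsilon, Matrix.det_fin_three]
  · exact Matrix.det_zero_of_row_eq (i := 0) (j := 2) (by decide) rfl
  · exact Matrix.det_zero_of_row_eq (i := 1) (j := 2) (by decide) rfl
  · exact Matrix.det_zero_of_row_eq (i := 0) (j := 1) (by decide) rfl

section classes

variable {M}

/-- On the abelian ideal spanned by Y 1 and Y 2, ad (Y 0) has eigenvectors Y 1 ± Y 2 with
eigenvalues ±1 − A 0. The trace condition says that Y 1 and Y 2 have equal length, that is, that the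
eigenvectors are orthogonal. Orthogonalizing Y 0 against the ideal does not change its action on it.
-/
theorem IsTracefreeBianchi.exists_frame {A : Fin 3 → ℝ}
    (h : M.IsTracefreeBianchi A (Matrix.diagonal ![0, 1, -1])) (hA : A 1 = 0 ∧ A 2 = 0)
    {t : ℝ} (ht : t ∈ M.I) :
    ∃ T X V : 𝔤, T ∉ S.iso ∧ X ∉ S.iso ∧ V ∉ S.iso ∧ M.bil t T X = 0 ∧ M.bil t T V = 0 ∧
      M.bil t X V = 0 ∧ ⁅T, X⁆ = (1 - A 0) • X ∧ ⁅T, V⁆ = (-1 - A 0) • V ∧ ⁅X, V⁆ = 0 := by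
  obtain ⟨Y, hY, hdet, htr⟩ := h
  obtain ⟨e1, e2, e3, e4, e5, e6⟩ := epsilon_table
  have h01 : ⁅Y 0, Y 1⁆ = Y 2 - A 0 • Y 1 := by
    rw [hY]
    simp [behr, Fin.sum_univ_three, e1, e2, e3, e4, e5, e6, hA]
    abel
  have h02 : ⁅Y 0, Y 2⁆ = Y 1 - A 0 • Y 2 := by
    rw [hY]
    simp [behr, Fin.sum_univ_three, e1, e2, e3, e4, e5, e6, hA]
    abel
  have h12 : ⁅Y 1, Y 2⁆ = 0 := by
    rw [hY]
    simp [behr, Fin.sum_univ_three, e1, e2, e3, e4, e5, e6, hA]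
  have h21 : ⁅Y 2, Y 1⁆ = 0 := by rw [← lie_skew, h12, neg_zero]
  have h11 : M.bil t (Y 1) (Y 1) = M.bil t (Y 2) (Y 2) := by
    have := htr t ht
    have e : ∀ a b, ∑ c, ∑ d, S.W c (Y a) * S.W d (Y b) * M.h t c d = M.bil t (Y a) (Y b) :=
      fun _ _ => rfl
    simp only [e] at this
    simp [Fin.sum_univ_three] at this
    linarith
  have hX : Y 1 + Y 2 ∉ S.iso := by
    have := not_mem_iso_of_det hdet (x := ![0, 1, 1]) (by
      intro h; have := congrFun h 1; simp at this)
    simpa [Fin.sum_univ_three] using this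
  have hV : Y 1 - Y 2 ∉ S.iso := by
    have := not_mem_iso_of_det hdet (x := ![0, 1, -1]) (by
      intro h; have := congrFun h 1; simp at this)
    simpa [Fin.sum_univ_three, sub_eq_add_neg] using this
  have hXV : M.bil t (Y 1 + Y 2) (Y 1 - Y 2) = 0 := by
    simp only [bil_add_left, bil_sub_right, h11, M.bil_symm ht (Y 2) (Y 1)]; ring
  obtain ⟨α, β, hα, hβ⟩ := M.exists_orthogonal ht (T := Y 0) hX hV hXV
  have hT : Y 0 + α • (Y 1 + Y 2) + β • (Y 1 - Y 2) ∉ S.iso := by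
    have := not_mem_iso_of_det hdet (x := ![1, α + β, α - β]) (by
      intro h; have := congrFun h 0; simp at this)
    have e : Y 0 + α • (Y 1 + Y 2) + β • (Y 1 - Y 2)
        = ∑ b, (![1, α + β, α - β] : Fin 3 → ℝ) b • Y b := by
      simp [Fin.sum_univ_three]
      module
    rwa [e]
  refine ⟨_, _, _, hT, hX, hV, hα, hβ, hXV, ?_, ?_, ?_⟩
  · simp only [add_lie, sub_lie, lie_add, lie_sub, smul_lie, lie_smul, h01, h02, h12, h21, lie_self]
    module
  · simp only [add_lie, sub_lie, lie_add, lie_sub, smul_lie, lie_smul, h01, h02, h12, h21, lie_self]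
    module
  · simp [add_lie, sub_lie, lie_add, lie_sub, smul_lie, lie_smul, h01, h02, h12, h21, lie_self]

/-- With A 0 = 1 the vector X commutes with T and V, so it goes first in the adapted frame; only the
bracket of T and V survives and gives r = −(2a)², where a normalizes T. -/
theorem IsLRSBianchiIII.exists_isSource (h : M.IsLRSBianchiIII) {t : ℝ} (ht : t ∈ M.I) :
    ∃ v ε r, M.IsSource t v ε r ∧ r < 0 := by
  obtain ⟨T, X, V, hT, hX, hV, hTX, hTV, hXV, bTX, bTV, bXV⟩ :=
    h.2.exists_frame ⟨by simp, by simp⟩ ht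
  obtain ⟨a, ha, ha1⟩ := M.hasUnitMultiple ht hT
  obtain ⟨b, hb, hb1⟩ := M.hasUnitMultiple ht hX
  obtain ⟨c, hc, hc1⟩ := M.hasUnitMultiple ht hV
  have hpos : 0 < (-2 * a) ^ 2 := by positivity
  simp at bTX bTV
  have bXT : ⁅X, T⁆ = 0 := by rw [← lie_skew, bTX, neg_zero]
  obtain ⟨v, ε, hs⟩ := M.isSource_of_adapted ht (L := ![b • X, a • T, c • V])
    (M.orthonormal_of_orthogonal ht hb1 ha1 hc1 (by rw [M.bil_symm ht]; exact hTX) hXV hTV)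
    (s := 0) (y := -2 * a) (κ := 0) (Z := 0) S.iso.zero_mem
    (by simp [bXT]) (by simp [bXV])
    (by
      simp [bTV]
      module) (by simp) (by simp) (by simp) (by simp)
    (by simp; exact ha.ne')
  exact ⟨v, ε, _, hs, by linarith⟩

/-- With A 0 = 0 the vector T acts by opposite eigenvalues on the commuting pair X, V, so T goes
first and κ = y = 0. -/
theorem IsBianchiVI0.exists_isSource (h : M.IsBianchiVI0) {t : ℝ} (ht : t ∈ M.I) :
    ∃ v ε r, M.IsSource t v ε r ∧ r = 0 := by
  obtain ⟨T, X, V, hT, hX, hV, hTX, hTV, hXV, bTX, bTV, bXV⟩ :=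
    IsTracefreeBianchi.exists_frame h ⟨by simp, by simp⟩ ht
  obtain ⟨a, ha, ha1⟩ := M.hasUnitMultiple ht hT
  obtain ⟨b, hb, hb1⟩ := M.hasUnitMultiple ht hX
  obtain ⟨c, hc, hc1⟩ := M.hasUnitMultiple ht hV
  simp at bTX bTV
  obtain ⟨v, ε, hs⟩ := M.isSource_of_adapted ht (L := ![a • T, b • X, c • V])
    (M.orthonormal_of_orthogonal ht ha1 hb1 hc1 hTX hTV hXV)
    (s := a) (y := 0) (κ := 0) (Z := 0) S.iso.zero_mem
    (by simp [bTX, smul_comm b a]) (by simp [bTV, smul_comm c a])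
    (by simp [bXV]) (by simp) (by simp) (by simp) (by simp)
    (by simp; exact ha.ne')
  exact ⟨v, ε, _, hs, by simp⟩

/-- The isotropy fixes the translation and rotates the first two rotation generators, so an
invariant metric makes the three orthogonal, the last two of equal length. The commutator of the
normalized pair is the isotropy generator times c², which is the curvature r. -/
theorem IsKantowskiSachs.exists_isSource (h : M.IsKantowskiSachs) {t : ℝ} (ht : t ∈ M.I) :
    ∃ v ε r, M.IsSource t v ε r ∧ 0 < r := by
  obtain ⟨b, hb0, hb, hiso⟩ := h
  obtain ⟨e1, e2, e3, e4, e5, e6⟩ := epsilon_table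
  have h01 : ⁅b (some 0), b (some 1)⁆ = b (some 2) := by
    rw [hb]; simp [Fin.sum_univ_three, e1, e4, e5]
  have h02 : ⁅b (some 0), b (some 2)⁆ = - b (some 1) := by
    rw [hb]; simp [Fin.sum_univ_three, e2, e4, e5]
  have h12 : ⁅b (some 1), b (some 2)⁆ = b (some 0) := by
    rw [hb]; simp [Fin.sum_univ_three, e3, e4, e5]
  have h20 : ⁅b (some 2), b (some 0)⁆ = b (some 1) := by rw [← lie_skew, h02, neg_neg]
  have h21 : ⁅b (some 2), b (some 1)⁆ = - b (some 0) := by rw [← lie_skew, h12]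
  have h2n : ⁅b (some 2), b none⁆ = 0 := by rw [← lie_skew, hb0, neg_zero]
  have hmem : ∀ Z, Z ∈ S.iso ↔ ∃ r : ℝ, r • b (some 2) = Z := fun Z => by
    rw [← LieSubalgebra.mem_toSubmodule, hiso, Submodule.mem_span_singleton]
  have hZ : b (some 2) ∈ S.iso := (hmem _).2 ⟨1, one_smul _ _⟩
  have hnot : ∀ i, i ≠ some 2 → b i ∉ S.iso := by
    intro i hi hmem'
    obtain ⟨r, hr⟩ := (hmem _).1 hmem'
    have := congrArg (fun x => b.repr x i) hr
    simp [Finsupp.single_apply, hi.symm] at this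
  have i1 := M.bil_invariant ht hZ (b (some 0)) (b (some 0))
  have i2 := M.bil_invariant ht hZ (b (some 0)) (b (some 1))
  have i3 := M.bil_invariant ht hZ (b none) (b (some 0))
  have i4 := M.bil_invariant ht hZ (b none) (b (some 1))
  have bil0 : ∀ Y, M.bil t 0 Y = 0 := fun Y => by simp [bil]
  rw [h20, M.bil_symm ht (b (some 1))] at i1
  rw [h20, h21, bil_neg_right] at i2
  rw [h2n, h20, bil0, zero_add] at i3
  rw [h2n, h21, bil0, zero_add, bil_neg_right, neg_eq_zero] at i4
  obtain ⟨a, ha, ha1⟩ := M.hasUnitMultiple ht (hnot none (by simp))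
  obtain ⟨c, hc, hc1⟩ := M.hasUnitMultiple ht (hnot (some 0) (by simp))
  have hc2 : c * (c * M.bil t (b (some 1)) (b (some 1))) = 1 := by
    rw [← hc1, show M.bil t (b (some 1)) (b (some 1)) = M.bil t (b (some 0)) (b (some 0)) by
      linarith]
  have hpos : 0 < c * c := by positivity
  obtain ⟨v, ε, hs⟩ := M.isSource_of_adapted ht (L := ![a • b none, c • b (some 0), c • b (some 1)])
    (M.orthonormal_of_orthogonal ht ha1 hc1 hc2 i4 i3 (by linarith))
    (s := 0) (y := 0) (κ := c * c) (Z := (c * c) • b (some 2)) (S.iso.smul_mem _ hZ)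
    (by simp [hb0]) (by simp [hb0])
    (by simp [h01, smul_smul]) (by simp [h2n]) (by simp [h20, smul_smul, mul_assoc])
    (by simp [h21, smul_smul, mul_assoc]) (by simp)
    (by simp; exact hc.ne')
  exact ⟨v, ε, _, hs, by simpa using hc.ne'⟩

end classes

end Cosmology

/-! ### Orthonormal frames for a given source -/

namespace Cosmology

variable {𝔤 : Type} [LieRing 𝔤] [LieAlgebra ℝ 𝔤] {S : HomogeneousSpace 𝔤} (M : Cosmology S)

section orthonormal

variable {t : ℝ} (ht : t ∈ M.I) {L : Fin 3 → 𝔤}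
  (hL : ∀ a b, M.bil t (L a) (L b) = if a = b then 1 else 0)
include hL

theorem frameMatrix_orthonormal :
    S.frameMatrix L * M.h t * (S.frameMatrix L)ᵀ = 1 := by
  ext a b
  rw [Matrix.one_apply, ← hL, Matrix.mul_apply, bil]
  simp only [Matrix.mul_apply, Matrix.transpose_apply, S.frameMatrix_apply, Finset.sum_mul]
  rw [Finset.sum_comm]
  exact Finset.sum_congr rfl fun c _ => Finset.sum_congr rfl fun d _ => by ring

theorem frameMatrix_left_inverse :
    M.h t * (S.frameMatrix L)ᵀ * S.frameMatrix L = 1 := by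
  refine mul_eq_one_comm.1 ?_
  rw [← Matrix.mul_assoc, M.frameMatrix_orthonormal hL]

theorem h_inv_orthonormal : (M.h t)⁻¹ = (S.frameMatrix L)ᵀ * S.frameMatrix L := by
  apply Matrix.inv_eq_right_inv
  rw [← Matrix.mul_assoc, M.frameMatrix_left_inverse hL]

include ht

theorem coords_eq_sum (X : 𝔤) : S.coords X = S.coords (∑ a, M.bil t (L a) X • L a) := by
  have h1 : S.coords (∑ a, M.bil t (L a) X • L a)
      = (S.coords X ᵥ* (M.h t * (S.frameMatrix L)ᵀ)) ᵥ* S.frameMatrix L := by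
    ext c
    simp only [map_sum, map_smul, Finset.sum_apply, Pi.smul_apply, smul_eq_mul]
    show _ = ∑ a, (S.coords X ᵥ* (M.h t * (S.frameMatrix L)ᵀ)) a * S.coords (L a) c
    refine Finset.sum_congr rfl fun a _ => ?_
    congr 1
    rw [M.bil_symm ht, bil, Matrix.vecMul, dotProduct]
    simp only [Matrix.mul_apply, Finset.mul_sum]
    exact Finset.sum_congr rfl fun i _ => Finset.sum_congr rfl fun j _ => by
      rw [S.coords_apply, Matrix.transpose_apply, S.frameMatrix_apply]; ring
  rw [h1, Matrix.vecMul_vecMul, M.frameMatrix_left_inverse hL, Matrix.vecMul_one]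

theorem sub_sum_mem_iso (X : 𝔤) : X - ∑ a, M.bil t (L a) X • L a ∈ S.iso := by
  rw [S.mem_iso_iff, map_sub, sub_eq_zero]
  exact M.coords_eq_sum ht hL X

/-- An orthonormal frame expands every element if there is no isotropy. -/
theorem eq_sum_of_iso_eq_bot (hiso : S.iso = ⊥) (X : 𝔤) : X = ∑ a, M.bil t (L a) X • L a := by
  have := M.sub_sum_mem_iso ht hL X
  rw [hiso, LieSubalgebra.mem_bot, sub_eq_zero] at this
  exact this

variable {K : Fin 3 → Matrix (Fin 3) (Fin 3) ℝ} {D : Fin 3 → Fin 3 → Fin 3 → ℝ}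
  (hbr : ∀ a b, ⁅L a, L b⁆ - ∑ c, D a b c • L c ∈ S.iso)
  (hskew : ∀ a, K a + (K a)ᵀ = 0) (htor : ∀ a b c, K a b c - K b a c = D a b c)
  {v : Fin 3 → ℝ} {ε r : ℝ} (hs : M.IsSource t v ε r)
include hbr hskew htor hs

/-- Evaluates the Ricci equation from commutators alone: any K that is skew with the right torsion
may be inserted. -/
theorem IsSource.ricci_orthonormal {O : Fin 3 → Fin 3 → Matrix (Fin 3) (Fin 3) ℝ}
    (hO : ∀ a b c d, S.W d ⁅⁅L a, L b⁆ - ∑ c, D a b c • L c, L c⁆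
      = ∑ e, O a b c e * S.W d (L e)) (b c : Fin 3) :
    ∑ a, (K b * K a - K a * K b - ∑ e, D a b e • K e - O a b) c a
      = r * (if b = c then 1 else 0)
        + ε * ((∑ i, v i * S.W i (L b)) * ∑ i, v i * S.W i (L c)) := by
  have hsk : ∀ a, K a * (S.frameMatrix L * M.h t * (S.frameMatrix L)ᵀ)
      + (K a * (S.frameMatrix L * M.h t * (S.frameMatrix L)ᵀ))ᵀ = 0 := fun a => by
    rw [M.frameMatrix_orthonormal hL, Matrix.mul_one, hskew]
  rw [← M.ricci_lift ht (M.frameMatrix_left_inverse hL) hbr hsk htor hO, ← hL, bil,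
    Finset.mul_sum, Finset.sum_mul_sum, Finset.mul_sum, ← Finset.sum_add_distrib]
  refine Finset.sum_congr rfl fun i _ => ?_
  rw [Finset.mul_sum, Finset.mul_sum, ← Finset.sum_add_distrib]
  refine Finset.sum_congr rfl fun j _ => ?_
  rw [hs.ricci]
  ring

theorem IsSource.trace_orthonormal :
    ∑ i, ∑ c, K i i c * ∑ j, v j * S.W j (L c) = 0 := by
  have hsk : ∀ a, K a * (S.frameMatrix L * M.h t * (S.frameMatrix L)ᵀ)
      + (K a * (S.frameMatrix L * M.h t * (S.frameMatrix L)ᵀ))ᵀ = 0 := fun a => by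
    rw [M.frameMatrix_orthonormal hL, Matrix.mul_one, hskew]
  rw [← hs.coclosed, M.divergence_lift ht (M.frameMatrix_left_inverse hL) hbr hsk htor
    (M.h_inv_orthonormal hL) fun Z _ b => hs.char Z (S.E b)]
  refine Finset.sum_congr rfl fun i _ => ?_
  rw [Matrix.mulVec, dotProduct]
  refine Finset.sum_congr rfl fun c _ => ?_
  rw [Matrix.mulVec, dotProduct]
  congr 1
  exact Finset.sum_congr rfl fun j _ => mul_comm (v j) (S.W j (L c))

end orthonormal

variable {M}

/-- An orthonormal frame adapted to a covector, in the invariant complement of the isotropy. -/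
theorem exists_orthonormal_frame {t : ℝ} (ht : t ∈ M.I) {v : Fin 3 → ℝ} (hv0 : v ≠ 0) :
    ∃ (L : Fin 3 → 𝔤) (ν : ℝ), ν ≠ 0 ∧ (∀ a, S.isoPart (L a) = 0) ∧
      (∀ a b, M.bil t (L a) (L b) = if a = b then 1 else 0) ∧
      ∀ X, ∑ c, v c * S.W c X = ν * M.bil t (L 0) X := by
  let hor : (Fin 3 → ℝ) →ₗ[ℝ] 𝔤 := Fintype.linearCombination ℝ S.E
  have hhor : ∀ x, hor x = ∑ a, x a • S.E a := fun x => rfl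
  have hW : ∀ x a, S.W a (hor x) = x a := fun x a => by simp [hhor, S.W_E]
  have hiso : ∀ x, S.isoPart (hor x) = 0 := fun x => by
    simp only [HomogeneousSpace.isoPart, hW]
    rw [hhor, sub_self]
  have hnot : ∀ x a, x a ≠ 0 → hor x ∉ S.iso := fun x a hx hmem => hx <| by
    rw [← hW x a, (S.mem_iso _).1 hmem a]
  -- The metric dual of v: its inner product with any element evaluates v there.
  set n := (M.h t)⁻¹ *ᵥ v with hn
  have hbn : ∀ X, M.bil t (hor n) X = ∑ c, v c * S.W c X := by
    intro X
    have h1 : M.h t *ᵥ n = v := by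
      rw [hn, Matrix.mulVec_mulVec, Matrix.mul_nonsing_inv _ (M.isUnit_det_h ht),
        Matrix.one_mulVec]
    rw [M.bil_symm ht, bil]
    refine Finset.sum_congr rfl fun c _ => ?_
    have := congrFun h1 c
    rw [← this, Matrix.mulVec, dotProduct, Finset.sum_mul]
    exact Finset.sum_congr rfl fun d _ => by rw [hW]; ring
  have hn0 : n ≠ 0 := by
    intro h
    apply hv0
    have h1 : M.h t *ᵥ n = v := by
      rw [hn, Matrix.mulVec_mulVec, Matrix.mul_nonsing_inv _ (M.isUnit_det_h ht),
        Matrix.one_mulVec]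
    rw [← h1, h, Matrix.mulVec_zero]
  obtain ⟨a₀, ha₀⟩ := Function.ne_iff.1 hn0
  obtain ⟨k, hk⟩ := Function.ne_iff.1 hv0
  have hk' : v k ≠ 0 := hk
  obtain ⟨i, j, hik, hjk, hij⟩ : ∃ i j : Fin 3, i ≠ k ∧ j ≠ k ∧ i ≠ j := by
    have : ∀ k : Fin 3, ∃ i j : Fin 3, i ≠ k ∧ j ≠ k ∧ i ≠ j := by decide
    exact this k
  -- Since v k is nonzero, these vectors for the two indices other than k form a basis of the kernel
  -- of v.
  have hperp : ∀ i, i ≠ k → M.bil t (hor n) (hor (Pi.single i (v k) - Pi.single k (v i))) = 0 := by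
    intro i hi
    rw [hbn]
    simp only [hW]
    simp [mul_sub, Finset.sum_sub_distrib, Pi.single_apply, mul_comm]
  obtain ⟨x, hxi, hxj, hnx⟩ : ∃ x : Fin 3 → ℝ, x i ≠ 0 ∧ x j = 0 ∧ M.bil t (hor n) (hor x) = 0 :=
    ⟨_, by simp [hik, hk'], by simp [hjk, hij.symm], hperp i hik⟩
  obtain ⟨y, hyj, hny⟩ : ∃ y : Fin 3 → ℝ, y j ≠ 0 ∧ M.bil t (hor n) (hor y) = 0 :=
    ⟨_, by simp [hjk, hk'], hperp j hjk⟩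
  have hxx := (M.bil_pos ht (hnot x i hxi)).ne'
  -- A Gram-Schmidt step. As x j = 0, the entry y j is unchanged, so the result is nonzero.
  obtain ⟨z, hz⟩ : ∃ z, z = y - (M.bil t (hor x) (hor y) / M.bil t (hor x) (hor x)) • x :=
    ⟨_, rfl⟩
  have hzj : z j ≠ 0 := by simp [hz, hxj, hyj]
  have hxz : M.bil t (hor x) (hor z) = 0 := by
    rw [hz, map_sub, map_smul, bil_sub_right, bil_smul_right]
    field_simp; ring
  have hnz : M.bil t (hor n) (hor z) = 0 := by
    rw [hz, map_sub, map_smul, bil_sub_right, bil_smul_right, hnx, hny]; ring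
  obtain ⟨a, ha, ha1⟩ := M.hasUnitMultiple ht (hnot n a₀ ha₀)
  obtain ⟨b, hb, hb1⟩ := M.hasUnitMultiple ht (hnot x i hxi)
  obtain ⟨c, hc, hc1⟩ := M.hasUnitMultiple ht (hnot z j hzj)
  refine ⟨![a • hor n, b • hor x, c • hor z], a⁻¹, inv_ne_zero ha.ne', ?_,
    M.orthonormal_of_orthogonal ht ha1 hb1 hc1 hnx hnz hxz, fun X => ?_⟩
  · intro i
    have h : ∀ (c : ℝ) x, S.isoPart (c • hor x) = 0 := fun c x => by rw [← map_smul, hiso]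
    fin_cases i
    exacts [h _ _, h _ _, h _ _]
  · rw [← hbn]
    simp [bil_smul_left, ha.ne']

/-- Converse of `IsTracefreeBianchi.exists_frame`. -/
theorem IsTracefreeBianchi.of_frame {t : ℝ} (ht : t ∈ M.I) (hM : M.ShearFree) {A : Fin 3 → ℝ}
    (hA : A 1 = 0 ∧ A 2 = 0) {T X V : 𝔤} (hT : T ∉ S.iso) (hX : X ∉ S.iso) (hV : V ∉ S.iso)
    (hTX : M.bil t T X = 0) (hTV : M.bil t T V = 0) (hXV : M.bil t X V = 0)
    (bTX : ⁅T, X⁆ = (1 - A 0) • X) (bTV : ⁅T, V⁆ = (-1 - A 0) • V) (bXV : ⁅X, V⁆ = 0) :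
    M.IsTracefreeBianchi A (Matrix.diagonal ![0, 1, -1]) := by
  obtain ⟨e1, e2, e3, e4, e5, e6⟩ := epsilon_table
  obtain ⟨e7, e8, e9⟩ : epsilon 1 0 2 = -1 ∧ epsilon 2 0 1 = 1 ∧ epsilon 2 1 0 = -1 := by
    refine ⟨?_, ?_, ?_⟩ <;> simp [epsilon, Matrix.det_fin_three]
  have bXT : ⁅X, T⁆ = -((1 - A 0) • X) := by rw [← lie_skew, bTX]
  have bVT : ⁅V, T⁆ = -((-1 - A 0) • V) := by rw [← lie_skew, bTV]
  have bVX : ⁅V, X⁆ = 0 := by rw [← lie_skew, bXV, neg_zero]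
  -- Half sum and half difference undo the passage to eigenvectors in `exists_frame`.
  refine ⟨![T, (2⁻¹ : ℝ) • (X + V), (2⁻¹ : ℝ) • (X - V)], fun a b => ?_, fun hdet => ?_,
    fun t' ht' => ?_⟩
  · fin_cases a <;> fin_cases b <;>
      simp [behr, Fin.sum_univ_three, e1, e2, e3, e4, e5, e6, e7, e8, e9, hA, bTX, bTV, bXV,
        bXT, bVT, bVX] <;> module
  -- A kernel vector gives a combination of T, X, V inside the isotropy; pairing it with each of
  -- these orthogonal elements kills its coefficients.
  · obtain ⟨x, hx, hx0⟩ := Matrix.exists_mulVec_eq_zero_iff.2 hdet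
    have hU : S.coords (x 0 • T + ((x 1 + x 2) / 2) • X + ((x 1 - x 2) / 2) • V) = 0 := by
      ext a
      have := congrFun hx0 a
      simp [Matrix.mulVec, dotProduct, Fin.sum_univ_three] at this
      simp
      linarith
    have hU' : ∀ Y, M.bil t (x 0 • T + ((x 1 + x 2) / 2) • X + ((x 1 - x 2) / 2) • V) Y = 0 := by
      intro Y
      refine Finset.sum_eq_zero fun c _ => Finset.sum_eq_zero fun d _ => ?_
      rw [← S.coords_apply, hU]
      simp
    have u1 := hU' T
    have u2 := hU' X
    have u3 := hU' V
    simp only [bil_add_left, bil_smul_left, hTX, hTV, hXV, M.bil_symm ht X T, M.bil_symm ht V T,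
      M.bil_symm ht V X, mul_zero, add_zero, zero_add, mul_eq_zero, (M.bil_pos ht hT).ne',
      (M.bil_pos ht hX).ne', (M.bil_pos ht hV).ne', or_false] at u1 u2 u3
    apply hx
    ext i
    fin_cases i
    · exact u1
    · show x 1 = 0
      linarith
    · show x 2 = 0
      linarith
  · have e : ∀ X Y : 𝔤, ∑ c, ∑ d, S.W c X * S.W d Y * M.h t' c d = M.bil t' X Y :=
      fun _ _ => rfl
    -- The metrics at all times are proportional, so orthogonality of X and V at one time gives the
    -- trace condition at every time.
    have e' : ∀ X Y : 𝔤, M.bil t' X Y = M.scaleSq t t' * M.bil t X Y := by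
      intro X Y
      simp only [bil, M.h_eq_smul ht hM ht', Matrix.smul_apply, smul_eq_mul, Finset.mul_sum]
      exact Finset.sum_congr rfl fun _ _ => Finset.sum_congr rfl fun _ _ => by ring
    simp only [e, e']
    simp [Fin.sum_univ_three, bil_smul_left, bil_smul_right, bil_add_left, bil_add_right,
      bil_sub_left, bil_sub_right, hXV, M.bil_symm ht V X]
    ring

end Cosmology

/-! ### The symmetry algebra of a line times a surface of constant curvature -/

/-- The four-dimensional Lie algebra with central element `e_0` and
`[e_3, e_1] = e_2`, `[e_3, e_2] = -e_1`, `[e_1, e_2] = c e_3`. -/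
def LRSAlgebra (_c : ℝ) : Type := Fin 4 → ℝ

namespace LRSAlgebra

variable {c : ℝ}

instance : AddCommGroup (LRSAlgebra c) := inferInstanceAs (AddCommGroup (Fin 4 → ℝ))
instance : Module ℝ (LRSAlgebra c) := inferInstanceAs (Module ℝ (Fin 4 → ℝ))

/-- Coordinates with respect to the basis `e_i`. -/
def coord (i : Fin 4) : LRSAlgebra c →ₗ[ℝ] ℝ := LinearMap.proj (R := ℝ) (φ := fun _ : Fin 4 => ℝ) i

/-- The element with given coordinates. -/
def mk : (Fin 4 → ℝ) →ₗ[ℝ] LRSAlgebra c := LinearMap.id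

@[simp] theorem coord_mk (x : Fin 4 → ℝ) (i : Fin 4) : coord i (mk x : LRSAlgebra c) = x i := rfl

theorem ext {X Y : LRSAlgebra c} (h : ∀ i, coord i X = coord i Y) : X = Y := funext h

instance : Bracket (LRSAlgebra c) (LRSAlgebra c) where
  bracket X Y := mk ![0, coord 2 X * coord 3 Y - coord 3 X * coord 2 Y,
    coord 3 X * coord 1 Y - coord 1 X * coord 3 Y,
    c * (coord 1 X * coord 2 Y - coord 2 X * coord 1 Y)]

theorem coord_lie_zero (X Y : LRSAlgebra c) : coord 0 ⁅X, Y⁆ = 0 := rfl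

theorem coord_lie_one (X Y : LRSAlgebra c) :
    coord 1 ⁅X, Y⁆ = coord 2 X * coord 3 Y - coord 3 X * coord 2 Y := rfl

theorem coord_lie_two (X Y : LRSAlgebra c) :
    coord 2 ⁅X, Y⁆ = coord 3 X * coord 1 Y - coord 1 X * coord 3 Y := rfl

theorem coord_lie_three (X Y : LRSAlgebra c) :
    coord 3 ⁅X, Y⁆ = c * (coord 1 X * coord 2 Y - coord 2 X * coord 1 Y) := rfl

theorem ext' {X Y : LRSAlgebra c} (h0 : coord 0 X = coord 0 Y) (h1 : coord 1 X = coord 1 Y)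
    (h2 : coord 2 X = coord 2 Y) (h3 : coord 3 X = coord 3 Y) : X = Y := by
  refine ext fun i => ?_
  fin_cases i
  exacts [h0, h1, h2, h3]

instance : LieRing (LRSAlgebra c) where
  add_lie X Y Z := by
    apply ext' <;> simp only [coord_lie_zero, coord_lie_one, coord_lie_two, coord_lie_three,
      map_add] <;> ring
  lie_add X Y Z := by
    apply ext' <;> simp only [coord_lie_zero, coord_lie_one, coord_lie_two, coord_lie_three,
      map_add] <;> ring
  lie_self X := by
    apply ext' <;> simp only [coord_lie_zero, coord_lie_one, coord_lie_two, coord_lie_three,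
      map_zero] <;> ring
  leibniz_lie X Y Z := by
    apply ext' <;> simp only [coord_lie_zero, coord_lie_one, coord_lie_two, coord_lie_three,
      map_add] <;> ring

instance : LieAlgebra ℝ (LRSAlgebra c) where
  lie_smul r X Y := by
    apply ext' <;> simp only [coord_lie_zero, coord_lie_one, coord_lie_two, coord_lie_three,
      map_smul, smul_eq_mul] <;> ring

/-- The rotation about `e_0`. -/
def rot : LieSubalgebra ℝ (LRSAlgebra c) where
  carrier := {X | ∀ a : Fin 3, coord a.castSucc X = 0}
  add_mem' hX hY a := by rw [map_add, hX a, hY a, add_zero]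
  zero_mem' a := map_zero _
  smul_mem' r X hX a := by rw [map_smul, hX a, smul_zero]
  lie_mem' {X Y} hX hY a := by
    have h1 := hX 1
    have h2 := hX 2
    have h3 := hY 1
    have h4 := hY 2
    simp only [show (1 : Fin 3).castSucc = (1 : Fin 4) from rfl,
      show (2 : Fin 3).castSucc = (2 : Fin 4) from rfl] at h1 h2 h3 h4
    fin_cases a
    · rfl
    · show coord 1 ⁅X, Y⁆ = 0
      rw [coord_lie_one, h2, h4]; ring
    · show coord 2 ⁅X, Y⁆ = 0
      rw [coord_lie_two, h1, h3]; ring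

theorem mem_rot {X : LRSAlgebra c} : X ∈ rot ↔ ∀ a : Fin 3, coord a.castSucc X = 0 := Iff.rfl

theorem rot_ne_bot : (rot : LieSubalgebra ℝ (LRSAlgebra c)) ≠ ⊥ := by
  intro h
  have h1 : (mk ![0, 0, 0, 1] : LRSAlgebra c) ∈ rot := by
    intro a
    fin_cases a <;> rfl
  rw [h, LieSubalgebra.mem_bot] at h1
  have := congrArg (coord 3) h1
  simp at this

/-- Generator of rotations about `e_0`. -/
def rotMatrix : Matrix (Fin 3) (Fin 3) ℝ := Matrix.of fun a b => match a, b with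
  | 1, 2 => 1
  | 2, 1 => -1
  | _, _ => 0

theorem rotMatrix_transpose : rotMatrixᵀ = -rotMatrix := by
  ext a b
  fin_cases a <;> fin_cases b <;> simp [rotMatrix]

/-- The horizontal element with components `x`. -/
def hor (x : Fin 3 → ℝ) : LRSAlgebra c := mk (Fin.snoc x 0)

theorem coord_hor (x : Fin 3 → ℝ) (a : Fin 3) :
    coord a.castSucc (hor x : LRSAlgebra c) = x a := by
  simp [hor]

theorem coord_three_hor (x : Fin 3 → ℝ) : coord 3 (hor x : LRSAlgebra c) = 0 := rfl

theorem lie_hor {Z : LRSAlgebra c} (hZ : Z ∈ rot) (x : Fin 3 → ℝ) :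
    ⁅Z, (hor x : LRSAlgebra c)⁆ = hor (coord 3 Z • (x ᵥ* rotMatrix)) := by
  have h1 : coord 1 Z = 0 := hZ 1
  have h2 : coord 2 Z = 0 := hZ 2
  have e1 : coord 1 (hor x : LRSAlgebra c) = x 1 := coord_hor x 1
  have e2 : coord 2 (hor x : LRSAlgebra c) = x 2 := coord_hor x 2
  apply ext'
  · refine Eq.trans ?_ (coord_hor _ 0).symm
    simp [coord_lie_zero, Matrix.vecMul, dotProduct, Fin.sum_univ_three, rotMatrix]
  · refine Eq.trans ?_ (coord_hor _ 1).symm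
    simp [coord_lie_one, Matrix.vecMul, dotProduct, Fin.sum_univ_three, rotMatrix, h1, h2, e1, e2]
  · refine Eq.trans ?_ (coord_hor _ 2).symm
    simp [coord_lie_two, Matrix.vecMul, dotProduct, Fin.sum_univ_three, rotMatrix, h1, h2, e1, e2,
      coord_three_hor]
  · rw [coord_lie_three, h1, h2, coord_three_hor]; ring

section space

variable (c) {P Q : Matrix (Fin 3) (Fin 3) ℝ} (hPQ : P * Q = 1)

/-- The homogeneous space of `LRSAlgebra c` with isotropy `rot`, in the frame with components `Q`
and dual coframe with components `P`. -/
def space : HomogeneousSpace (LRSAlgebra c) where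
  iso := rot
  E a := hor (Q a)
  W a := ∑ i, P i a • coord i.castSucc
  W_E a b := by
    have h : Q * P = 1 := mul_eq_one_comm.1 hPQ
    have := congrFun (congrFun h b) a
    rw [Matrix.mul_apply, Matrix.one_apply] at this
    simp only [LinearMap.sum_apply, LinearMap.smul_apply, coord_hor, smul_eq_mul, eq_comm (a := a)]
    rw [← this]
    exact Finset.sum_congr rfl fun i _ => mul_comm _ _
  mem_iso Z := by
    rw [mem_rot]
    constructor
    · intro h a
      simp [h]
    · intro h
      have h1 : (fun i : Fin 3 => coord i.castSucc Z) ᵥ* P = 0 := by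
        ext a
        have := h a
        simp only [LinearMap.sum_apply, LinearMap.smul_apply, smul_eq_mul] at this
        rw [Pi.zero_apply, ← this, Matrix.vecMul, dotProduct]
        exact Finset.sum_congr rfl fun i _ => mul_comm _ _
      have h2 := congrArg (fun x => x ᵥ* Q) h1
      simp only [Matrix.vecMul_vecMul, hPQ, Matrix.vecMul_one, Matrix.zero_vecMul] at h2
      exact congrFun h2
  reductive Z hZ a := by
    rw [lie_hor hZ]
    set y := coord 3 Z • (Q a ᵥ* rotMatrix) with hy
    have h1 : ∀ b, (∑ i, P i b • (coord i.castSucc : LRSAlgebra c →ₗ[ℝ] ℝ)) (hor y)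
        = (y ᵥ* P) b := by
      intro b
      simp only [LinearMap.sum_apply, LinearMap.smul_apply, coord_hor, smul_eq_mul]
      rw [Matrix.vecMul, dotProduct]
      exact Finset.sum_congr rfl fun i _ => mul_comm _ _
    have h2 : ∀ x : Fin 3 → ℝ, ∑ b, x b • (hor (Q b) : LRSAlgebra c) = hor (x ᵥ* Q) := by
      intro x
      refine ext fun i => ?_
      refine Fin.lastCases ?_ (fun j => ?_) i
      · rw [map_sum]
        refine (Finset.sum_eq_zero fun b _ => ?_).trans (coord_three_hor _).symm
        rw [map_smul]
        exact (congrArg (x b • ·) (coord_three_hor (c := c) (Q b))).trans (smul_zero _)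
      · rw [map_sum, coord_hor, Matrix.vecMul, dotProduct]
        refine Finset.sum_congr rfl fun b _ => ?_
        rw [map_smul, coord_hor]; rfl
    simp only [h1]
    rw [h2, Matrix.vecMul_vecMul, hPQ, Matrix.vecMul_one]
  effective Z hZ h := by
    have h3 : coord 3 Z = 0 := by
      by_contra h3
      have h4 : ∀ a, Q a ᵥ* rotMatrix = 0 := by
        intro a
        have := h a
        rw [lie_hor hZ] at this
        have h5 : coord 3 Z • (Q a ᵥ* rotMatrix) = 0 := by
          ext i
          rw [← coord_hor (c := c) (coord 3 Z • (Q a ᵥ* rotMatrix)) i, this, map_zero,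
            Pi.zero_apply]
        exact (smul_eq_zero.1 h5).resolve_left h3
      have h5 : Q * rotMatrix = 0 := by
        ext a b
        exact congrFun (h4 a) b
      have h6 : rotMatrix = 0 := by
        rw [← Matrix.one_mul rotMatrix, ← hPQ, Matrix.mul_assoc, h5, Matrix.mul_zero]
      have := congrFun (congrFun h6 1) 2
      simp [rotMatrix] at this
    exact ext' (hZ 0) (hZ 1) (hZ 2) h3

/-- A spacetime with the homogeneous slices `LRSAlgebra.space`, if the frame is orthonormal up to
scale at all times. -/
def cosmology {I : Set ℝ} (hI : IsOpen I) (hI' : I.Nonempty) (hI'' : I.OrdConnected)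
    {h : ℝ → Matrix (Fin 3) (Fin 3) ℝ} (hsmooth : ∀ a b, ContDiffOn ℝ (⊤ : ℕ∞) (fun t => h t a b) I)
    (hpos : ∀ t ∈ I, (h t).PosDef) (hh : ∀ t ∈ I, ∃ φ : ℝ, h t = φ • (Q * Qᵀ)) :
    Cosmology (space c hPQ) where
  I := I
  isOpen := hI
  nonempty := hI'
  ordConnected := hI''
  h := h
  smooth := hsmooth
  posDef := hpos
  invariant Z hZ t ht a b := by
    obtain ⟨φ, hφ⟩ := hh t ht
    -- The rotation generator in the frame `E`; it is skew for Q Qᵀ, and so for its multiples,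
    -- because `rotMatrix` is skew.
    set A := Q * rotMatrix * P with hA
    have hQP : Q * P = 1 := mul_eq_one_comm.1 hPQ
    have h1 : ∀ a d, (space c hPQ).W d ⁅Z, (space c hPQ).E a⁆ = coord 3 Z * A a d := by
      intro a d
      show (∑ i, P i d • (coord i.castSucc : LRSAlgebra c →ₗ[ℝ] ℝ)) ⁅Z, hor (Q a)⁆ = _
      rw [lie_hor hZ]
      simp only [LinearMap.sum_apply, LinearMap.smul_apply, coord_hor, smul_eq_mul, hA]
      rw [Matrix.mul_apply, Finset.mul_sum]
      refine Finset.sum_congr rfl fun i _ => ?_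
      show P i d * (coord 3 Z * (Q a ᵥ* rotMatrix) i)
        = coord 3 Z * ((Q a ᵥ* rotMatrix) i * P i d)
      ring
    have h2 : A * h t + (A * h t)ᵀ = 0 := by
      have e : A * h t = φ • (Q * rotMatrix * Qᵀ) := by
        rw [hA, hφ, Matrix.mul_smul]
        congr 1
        calc Q * rotMatrix * P * (Q * Qᵀ) = Q * rotMatrix * (P * Q) * Qᵀ := by
              simp only [Matrix.mul_assoc]
          _ = _ := by rw [hPQ, Matrix.mul_one]
      rw [e, Matrix.transpose_smul, Matrix.transpose_mul, Matrix.transpose_mul,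
        Matrix.transpose_transpose, rotMatrix_transpose]
      simp [Matrix.mul_assoc]
    have h3 : ∀ a b, h t a b = h t b a := by
      intro a b
      rw [hφ, Matrix.smul_apply, Matrix.smul_apply]
      congr 1
      exact congrFun (congrFun (Matrix.isSymm_mul_transpose_self Q) b) a
    have h4 := congrFun (congrFun h2 a) b
    rw [Matrix.add_apply, Matrix.transpose_apply, Matrix.mul_apply, Matrix.mul_apply,
      ← Finset.sum_add_distrib] at h4
    have h5 : ∑ d, (coord 3 Z * A a d * h t d b + coord 3 Z * A b d * h t a d)
        = coord 3 Z * ∑ d, (A a d * h t d b + A b d * h t d a) := by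
      rw [Finset.mul_sum]
      exact Finset.sum_congr rfl fun d _ => by rw [h3 a d]; ring
    simp only [h1]
    rw [h5, h4, Matrix.zero_apply, mul_zero]

end space

end LRSAlgebra

/-! ### Classification of sources on spaces without isotropy -/

namespace Cosmology

variable {𝔤 : Type} [LieRing 𝔤] [LieAlgebra ℝ 𝔤] {S : HomogeneousSpace 𝔤} {M : Cosmology S}

/-- Structure constants of a frame adapted to a source on a Bianchi model. -/
noncomputable def sourceD (s p q x y : ℝ) (a b c : Fin 3) : ℝ :=
  match a, b, c with
  | 0, 1, 1 => s
  | 1, 0, 1 => -s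
  | 0, 1, 2 => p
  | 1, 0, 2 => -p
  | 0, 2, 1 => q
  | 2, 0, 1 => -q
  | 0, 2, 2 => -s
  | 2, 0, 2 => s
  | 1, 2, 1 => x
  | 2, 1, 1 => -x
  | 1, 2, 2 => y
  | 2, 1, 2 => -y
  | _, _, _ => 0

/-- Connection of a frame adapted to a source on a Bianchi model. -/
noncomputable def sourceConn (s p q x y : ℝ) (a : Fin 3) : Matrix (Fin 3) (Fin 3) ℝ :=
  Matrix.of fun b c => match a, b, c with
    | 0, 1, 2 => (p - q) / 2
    | 0, 2, 1 => -((p - q) / 2)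
    | 1, 0, 1 => -s
    | 1, 1, 0 => s
    | 1, 0, 2 => -((p + q) / 2)
    | 1, 2, 0 => (p + q) / 2
    | 1, 1, 2 => -x
    | 1, 2, 1 => x
    | 2, 0, 1 => -((p + q) / 2)
    | 2, 1, 0 => (p + q) / 2
    | 2, 0, 2 => s
    | 2, 2, 0 => -s
    | 2, 1, 2 => -y
    | 2, 2, 1 => y
    | _, _, _ => 0

theorem sourceConn_torsion (s p q x y : ℝ) (a b c : Fin 3) :
    sourceConn s p q x y a b c - sourceConn s p q x y b a c = sourceD s p q x y a b c := by
  fin_cases a <;> fin_cases b <;> fin_cases c <;> simp [sourceConn, sourceD] <;> ring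

theorem sourceConn_skew (s p q x y : ℝ) (a : Fin 3) :
    sourceConn s p q x y a + (sourceConn s p q x y a)ᵀ = 0 := by
  ext b c
  fin_cases a <;> fin_cases b <;> fin_cases c <;> simp [sourceConn]

/-- Ricci tensor of a frame adapted to a source on a Bianchi model. -/
noncomputable def sourceRicci (s p q x y : ℝ) (b c : Fin 3) : ℝ :=
  ∑ a, (sourceConn s p q x y b * sourceConn s p q x y a
    - sourceConn s p q x y a * sourceConn s p q x y b
    - ∑ e, sourceD s p q x y a b e • sourceConn s p q x y e - 0) c a

theorem sourceRicci_zero_zero (s p q x y : ℝ) :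
    sourceRicci s p q x y 0 0 = -2 * s ^ 2 - (p + q) ^ 2 / 2 := by
  simp [sourceRicci, sourceConn, sourceD, Fin.sum_univ_three, Matrix.mul_apply]; ring

theorem sourceRicci_zero_one (s p q x y : ℝ) :
    sourceRicci s p q x y 0 1 = s * y - q * x := by
  simp [sourceRicci, sourceConn, sourceD, Fin.sum_univ_three, Matrix.mul_apply]; ring

theorem sourceRicci_zero_two (s p q x y : ℝ) :
    sourceRicci s p q x y 0 2 = s * x + p * y := by
  simp [sourceRicci, sourceConn, sourceD, Fin.sum_univ_three, Matrix.mul_apply]; ring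

theorem sourceRicci_one_one (s p q x y : ℝ) :
    sourceRicci s p q x y 1 1 = -x ^ 2 - y ^ 2 + (q ^ 2 - p ^ 2) / 2 := by
  simp [sourceRicci, sourceConn, sourceD, Fin.sum_univ_three, Matrix.mul_apply]; ring

theorem sourceRicci_one_two (s p q x y : ℝ) :
    sourceRicci s p q x y 1 2 = s * (p - q) := by
  simp [sourceRicci, sourceConn, sourceD, Fin.sum_univ_three, Matrix.mul_apply]; ring

theorem sourceRicci_two_two (s p q x y : ℝ) :
    sourceRicci s p q x y 2 2 = -x ^ 2 - y ^ 2 + (p ^ 2 - q ^ 2) / 2 := by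
  simp [sourceRicci, sourceConn, sourceD, Fin.sum_univ_three, Matrix.mul_apply]; ring

/-- A spacetime with the commutators of a Bianchi type III model with a central unit vector
orthogonal to the other two is locally rotationally symmetric. -/
theorem isLRS_of_frame {t₀ : ℝ} (ht₀ : t₀ ∈ M.I) (hM : M.ShearFree) (hiso : S.iso = ⊥)
    {L : Fin 3 → 𝔤} (hL : ∀ a b, M.bil t₀ (L a) (L b) = if a = b then 1 else 0) {x y : ℝ}
    (h01 : ⁅L 0, L 1⁆ = 0) (h02 : ⁅L 0, L 2⁆ = 0) (h12 : ⁅L 1, L 2⁆ = x • L 1 + y • L 2) :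
    M.IsLRS := by
  have hexp := M.eq_sum_of_iso_eq_bot ht₀ hL hiso
  have hPhP := M.frameMatrix_orthonormal hL
  set P := S.frameMatrix L with hP
  have hPQ : P * (M.h t₀ * Pᵀ) = 1 := by rw [← Matrix.mul_assoc, hPhP]
  have hQQ : M.h t₀ = (M.h t₀ * Pᵀ) * (M.h t₀ * Pᵀ)ᵀ := by
    have hsym : (M.h t₀)ᵀ = M.h t₀ := by ext a b; exact M.h_symm ht₀ b a
    rw [Matrix.transpose_mul, Matrix.transpose_transpose, hsym, ← Matrix.mul_assoc,
      M.frameMatrix_left_inverse hL, Matrix.one_mul]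
  -- The plane of L 1 and L 2 generates a surface of curvature −(x² + y²), and rotations about L 0
  -- are the additional isometries.
  let N := LRSAlgebra.cosmology (-(x ^ 2 + y ^ 2)) hPQ M.isOpen M.nonempty M.ordConnected
    M.smooth M.posDef (fun t ht => ⟨M.scaleSq t₀ t, by rw [← hQQ]; exact M.h_eq_smul ht₀ hM ht⟩)
  -- The rotation components −x and −y make e 1 and e 2 reproduce the bracket of L 1 and L 2; the
  -- rotation part of that bracket is what fixes the constant −(x² + y²).
  let e : Fin 3 → LRSAlgebra (-(x ^ 2 + y ^ 2)) := fun a => LRSAlgebra.mk (match a with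
    | 0 => ![1, 0, 0, 0]
    | 1 => ![0, 1, 0, -x]
    | 2 => ![0, 0, 1, -y])
  let ℓ : Fin 3 → 𝔤 →ₗ[ℝ] ℝ := fun a => LinearMap.mk
    ⟨fun X => M.bil t₀ (L a) X, fun X Y => M.bil_add_right t₀ _ X Y⟩
    (fun r X => M.bil_smul_right t₀ r _ X)
  let f : 𝔤 →ₗ[ℝ] LRSAlgebra (-(x ^ 2 + y ^ 2)) := ∑ a, (ℓ a).smulRight (e a)
  have hf : ∀ X, f X = ∑ a, M.bil t₀ (L a) X • e a := fun X => by
    simp only [f, LinearMap.sum_apply, LinearMap.smulRight_apply]; rfl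
  have hfL : ∀ a, f (L a) = e a := fun a => by simp [hf, hL]
  have e01 : ⁅e 0, e 1⁆ = 0 := by
    apply LRSAlgebra.ext' <;> simp [LRSAlgebra.coord_lie_zero, LRSAlgebra.coord_lie_one,
      LRSAlgebra.coord_lie_two, LRSAlgebra.coord_lie_three, e]
  have e02 : ⁅e 0, e 2⁆ = 0 := by
    apply LRSAlgebra.ext' <;> simp [LRSAlgebra.coord_lie_zero, LRSAlgebra.coord_lie_one,
      LRSAlgebra.coord_lie_two, LRSAlgebra.coord_lie_three, e]
  have e12 : ⁅e 1, e 2⁆ = x • e 1 + y • e 2 := by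
    apply LRSAlgebra.ext' <;> simp [LRSAlgebra.coord_lie_zero, LRSAlgebra.coord_lie_one,
      LRSAlgebra.coord_lie_two, LRSAlgebra.coord_lie_three, e]
    ring
  have hbr : ∀ a b, f ⁅L a, L b⁆ = ⁅e a, e b⁆ := by
    intro a b
    have h10 : ⁅L 1, L 0⁆ = 0 := by rw [← lie_skew, h01, neg_zero]
    have h20 : ⁅L 2, L 0⁆ = 0 := by rw [← lie_skew, h02, neg_zero]
    have h21 : ⁅L 2, L 1⁆ = -(x • L 1 + y • L 2) := by rw [← lie_skew, h12]
    have e10 : ⁅e 1, e 0⁆ = 0 := by rw [← lie_skew, e01, neg_zero]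
    have e20 : ⁅e 2, e 0⁆ = 0 := by rw [← lie_skew, e02, neg_zero]
    have e21 : ⁅e 2, e 1⁆ = -(x • e 1 + y • e 2) := by rw [← lie_skew, e12]
    fin_cases a <;> fin_cases b <;>
      simp only [Fin.zero_eta, Fin.mk_one, Fin.reduceFinMk, lie_self, map_zero, h01, h02, h12, h10,
        h20, h21, e01, e02, e12, e10, e20, e21, map_neg, map_add, map_smul, hfL]
  have hlie : ∀ X Y : 𝔤, f ⁅X, Y⁆ = ⁅f X, f Y⁆ := by
    intro X Y
    conv_lhs => rw [hexp X, hexp Y]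
    rw [hf X, hf Y]
    simp only [sum_lie, lie_sum, smul_lie, lie_smul, map_sum, map_smul, hbr]
  refine ⟨LRSAlgebra (-(x ^ 2 + y ^ 2)), inferInstance, inferInstance, _, N,
    { f with map_lie' := fun {X Y} => hlie X Y }, LRSAlgebra.rot_ne_bot, fun a X => ?_, rfl,
    fun t _ => rfl⟩
  show (∑ i, P i a • (LRSAlgebra.coord i.castSucc : LRSAlgebra _ →ₗ[ℝ] ℝ)) (f X) = S.W a X
  have he : ∀ i b : Fin 3, LRSAlgebra.coord i.castSucc (e b) = if i = b then 1 else 0 := by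
    intro i b
    fin_cases i <;> fin_cases b <;> rfl
  conv_rhs => rw [hexp X]
  rw [hf X]
  simp only [LinearMap.sum_apply, LinearMap.smul_apply, map_sum, map_smul, he, smul_eq_mul]
  simp [hP, S.frameMatrix_apply, Finset.mul_sum, mul_comm]

/-- The divergence of the dual of v is a multiple of the trace of ad (L 0) over the frame, and that
multiple is nonzero. -/
theorem IsSource.trace_lie {t : ℝ} {v : Fin 3 → ℝ} {ε r ν : ℝ} (hs : M.IsSource t v ε r)
    (ht : t ∈ M.I) {L : Fin 3 → 𝔤} (hL : ∀ a b, M.bil t (L a) (L b) = if a = b then 1 else 0)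
    (hν : ν ≠ 0) (hv : ∀ X, ∑ c, v c * S.W c X = ν * M.bil t (L 0) X) :
    M.bil t (L 1) ⁅L 0, L 1⁆ + M.bil t (L 2) ⁅L 0, L 2⁆ = 0 := by
  let D : Fin 3 → Fin 3 → Fin 3 → ℝ := fun a b c => M.bil t (L c) ⁅L a, L b⁆
  have hD : ∀ a b c, D a b c = - D b a c := fun a b c => by
    show M.bil t _ _ = - M.bil t _ _
    rw [← lie_skew, bil_neg_right]
  have := hs.trace_orthonormal M ht hL (D := D)
    -- Koszul's formula for an orthonormal frame with commutation constants D.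
    (K := fun a => Matrix.of fun b c => (D a b c - D b c a + D c a b) / 2)
    (fun a b => M.sub_sum_mem_iso ht hL _)
    (fun a => by
      ext b c
      simp only [Matrix.add_apply, Matrix.transpose_apply, Matrix.of_apply, Matrix.zero_apply]
      rw [hD a c b, hD c b a, hD b a c]; ring)
    (fun a b c => by
      simp only [Matrix.of_apply]
      rw [hD b a c, hD a c b, hD c b a]; ring)
  simp only [hv, hL] at this
  have e : ∀ i, D i i 0 = 0 := fun i => by show M.bil t _ _ = 0; rw [lie_self]; simp [bil]
  have e' : ∀ i, D i 0 i = - D 0 i i := fun i => hD _ _ _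
  simp [Fin.sum_univ_three, e, e', e' 1, e' 2] at this
  have e3 : D 0 1 1 + D 0 2 2 = 0 := by
    have h : ν * (D 0 1 1 + D 0 2 2) = 0 := by linarith [e 0]
    exact (mul_eq_zero.1 h).resolve_left hν
  exact e3

/-- With L 0 dual to v, closedness removes the L 0 component of every commutator and `trace_lie`
makes the two diagonal entries of ad (L 0) opposite. Five constants remain, and Einstein's equation
becomes algebra in them. -/
theorem IsSource.exists_bianchi_frame {t : ℝ} {v : Fin 3 → ℝ} {ε r : ℝ} (hs : M.IsSource t v ε r)
    (ht : t ∈ M.I) (hiso : S.iso = ⊥) :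
    ∃ (L : Fin 3 → 𝔤) (s p q x y k : ℝ), k ≠ 0 ∧
      (∀ a b, M.bil t (L a) (L b) = if a = b then 1 else 0) ∧
      ⁅L 0, L 1⁆ = s • L 1 + p • L 2 ∧ ⁅L 0, L 2⁆ = q • L 1 + -s • L 2 ∧
      ⁅L 1, L 2⁆ = x • L 1 + y • L 2 ∧
      ∀ b c, sourceRicci s p q x y b c = r * (if b = c then 1 else 0)
        + k * ((if b = 0 then 1 else 0) * (if c = 0 then 1 else 0)) := by
  obtain ⟨L, ν, hν, -, hL, hv⟩ := exists_orthonormal_frame ht hs.ne_zero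
  have hexp := M.eq_sum_of_iso_eq_bot ht hL hiso
  have h0 : ∀ X Y : 𝔤, M.bil t (L 0) ⁅X, Y⁆ = 0 := by
    intro X Y
    have := hs.char X Y
    rw [hv] at this
    exact (mul_eq_zero.1 this).resolve_left hν
  obtain ⟨s, hs1⟩ : ∃ s, M.bil t (L 1) ⁅L 0, L 1⁆ = s := ⟨_, rfl⟩
  obtain ⟨p, hp⟩ : ∃ p, M.bil t (L 2) ⁅L 0, L 1⁆ = p := ⟨_, rfl⟩
  obtain ⟨q, hq⟩ : ∃ q, M.bil t (L 1) ⁅L 0, L 2⁆ = q := ⟨_, rfl⟩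
  obtain ⟨x, hx⟩ : ∃ x, M.bil t (L 1) ⁅L 1, L 2⁆ = x := ⟨_, rfl⟩
  obtain ⟨y, hy⟩ : ∃ y, M.bil t (L 2) ⁅L 1, L 2⁆ = y := ⟨_, rfl⟩
  have hs2 : M.bil t (L 2) ⁅L 0, L 2⁆ = -s := by
    have := hs.trace_lie ht hL hν hv
    linarith
  have b01 : ⁅L 0, L 1⁆ = s • L 1 + p • L 2 := by
    rw [hexp ⁅L 0, L 1⁆, Fin.sum_univ_three, h0, hs1, hp, zero_smul, zero_add]
  have b02 : ⁅L 0, L 2⁆ = q • L 1 + -s • L 2 := by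
    rw [hexp ⁅L 0, L 2⁆, Fin.sum_univ_three, h0, hq, hs2, zero_smul, zero_add]
  have b12 : ⁅L 1, L 2⁆ = x • L 1 + y • L 2 := by
    rw [hexp ⁅L 1, L 2⁆, Fin.sum_univ_three, h0, hx, hy, zero_smul, zero_add]
  have b10 : ⁅L 1, L 0⁆ = -(s • L 1 + p • L 2) := by rw [← lie_skew, b01]
  have b20 : ⁅L 2, L 0⁆ = -(q • L 1 + -s • L 2) := by rw [← lie_skew, b02]
  have b21 : ⁅L 2, L 1⁆ = -(x • L 1 + y • L 2) := by rw [← lie_skew, b12]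
  have hdiff : ∀ a b, ⁅L a, L b⁆ - ∑ c, sourceD s p q x y a b c • L c = 0 := by
    intro a b
    fin_cases a <;> fin_cases b <;>
      simp [sourceD, Fin.sum_univ_three, b01, b02, b12, b10, b20, b21] <;> module
  have hric : ∀ b c, sourceRicci s p q x y b c = r * (if b = c then 1 else 0)
      + ε * ν ^ 2 * ((if b = 0 then 1 else 0) * (if c = 0 then 1 else 0)) := by
    intro b c
    have := hs.ricci_orthonormal M ht hL (O := fun _ _ => 0)
      (fun a b => by rw [hdiff]; exact S.iso.zero_mem) (sourceConn_skew s p q x y)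
      (sourceConn_torsion s p q x y) (fun a b c d => by rw [hdiff]; simp) b c
    refine this.trans ?_
    simp only [hv, hL, eq_comm (a := (0 : Fin 3))]
    ring
  have hεν : ε * ν ^ 2 ≠ 0 := by
    have : ν ^ 2 ≠ 0 := pow_ne_zero 2 hν
    rcases hs.sgn with h | h <;> simp [h, this]
  exact ⟨L, s, p, q, x, y, ε * ν ^ 2, hεν, hL, b01, b02, b12, hric⟩

/-- ad (L 0) acts on the plane of L 1 and L 2 by a symmetric trace-free matrix with eigenvalues ±μ;
X and V are its orthogonal eigenvectors and T is L 0 divided by μ. The condition μ ≠ s keeps these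
formulas for the eigenvectors from vanishing. -/
theorem isBianchiVI0_of_frame {t : ℝ} (ht : t ∈ M.I) (hM : M.ShearFree) (hiso : S.iso = ⊥)
    {L : Fin 3 → 𝔤} (hL : ∀ a b, M.bil t (L a) (L b) = if a = b then 1 else 0) {s p μ : ℝ}
    (b01 : ⁅L 0, L 1⁆ = s • L 1 + p • L 2) (b02 : ⁅L 0, L 2⁆ = p • L 1 + -s • L 2)
    (b12 : ⁅L 1, L 2⁆ = 0) (hμ : μ ^ 2 = s ^ 2 + p ^ 2) (hμ0 : μ ≠ 0) (hμs : μ - s ≠ 0) :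
    M.IsBianchiVI0 := by
  have hmem : ∀ {X : 𝔤}, X ≠ 0 → X ∉ S.iso := by
    intro X hX h
    rw [hiso, LieSubalgebra.mem_bot] at h
    exact hX h
  have b21 : ⁅L 2, L 1⁆ = 0 := by rw [← lie_skew, b12, neg_zero]
  refine (IsTracefreeBianchi.of_frame ht hM ⟨rfl, rfl⟩ (T := μ⁻¹ • L 0)
    (X := p • L 1 + (μ - s) • L 2) (V := (-(μ - s)) • L 1 + p • L 2) (hmem fun h => ?_)
    (hmem fun h => ?_) (hmem fun h => ?_) ?_ ?_ ?_ ?_ ?_ ?_)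
  · have := congrArg (M.bil t (L 0)) h
    simp [bil_smul_right, hL, hμ0] at this
    simp [bil] at this
    exact hμ0 this
  · have := congrArg (M.bil t (L 2)) h
    simp [bil_smul_right, bil_add_right, hL, hμs] at this
    simp [bil, hμs] at this
  · have := congrArg (M.bil t (L 1)) h
    simp [bil_smul_right, bil_add_right, hL, hμs] at this
    simp [bil] at this
    exact hμs (by linarith)
  · simp [bil_smul_right, bil_add_right, bil_smul_left, hL]
  · simp [bil_smul_right, bil_add_right, bil_smul_left, hL]
  · simp [bil_smul_right, bil_add_right, bil_smul_left, bil_add_left, hL]; ring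
  · simp only [smul_lie, lie_add, lie_smul, b01, b02, Pi.zero_apply]
    match_scalars
    · field_simp
      linarith
    · field_simp
      linarith
  · simp only [smul_lie, lie_add, lie_smul, b01, b02, Pi.zero_apply]
    match_scalars
    · field_simp
      linarith
    · field_simp
      linarith
  · simp [add_lie, smul_lie, lie_add, lie_smul, b12, b21]

/-- V is the commutator of L 1 and L 2, and T is its perpendicular in their plane, scaled to act on
V by −2; the central L 0 plays the part of X. -/
theorem isTracefreeBianchiIII_of_frame {t : ℝ} (ht : t ∈ M.I) (hM : M.ShearFree)
    (hiso : S.iso = ⊥) {L : Fin 3 → 𝔤} (hL : ∀ a b, M.bil t (L a) (L b) = if a = b then 1 else 0)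
    {x y : ℝ} (b01 : ⁅L 0, L 1⁆ = 0) (b02 : ⁅L 0, L 2⁆ = 0) (b12 : ⁅L 1, L 2⁆ = x • L 1 + y • L 2)
    (hxy : x ^ 2 + y ^ 2 ≠ 0) :
    M.IsTracefreeBianchi ![1, 0, 0] (Matrix.diagonal ![0, 1, -1]) := by
  have hmem : ∀ {X : 𝔤}, X ≠ 0 → X ∉ S.iso := by
    intro X hX h
    rw [hiso, LieSubalgebra.mem_bot] at h
    exact hX h
  have hLnot : ∀ a, L a ∉ S.iso := by
    intro a h
    rw [hiso, LieSubalgebra.mem_bot] at h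
    have := hL a a
    simp [h, bil] at this
  have b10 : ⁅L 1, L 0⁆ = 0 := by rw [← lie_skew, b01, neg_zero]
  have b20 : ⁅L 2, L 0⁆ = 0 := by rw [← lie_skew, b02, neg_zero]
  have b21 : ⁅L 2, L 1⁆ = -(x • L 1 + y • L 2) := by rw [← lie_skew, b12]
  refine IsTracefreeBianchi.of_frame ht hM ⟨by simp, by simp⟩
    (T := (-2 * y / (x ^ 2 + y ^ 2)) • L 1 + (2 * x / (x ^ 2 + y ^ 2)) • L 2) (X := L 0)
    (V := x • L 1 + y • L 2) (hmem fun h => ?_) (hLnot 0) (hmem fun h => ?_) ?_ ?_ ?_ ?_ ?_ ?_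
  · have h1 := congrArg (M.bil t (L 1)) h
    have h2 := congrArg (M.bil t (L 2)) h
    simp [bil_smul_right, bil_add_right, hL, hxy] at h1 h2
    simp [bil, hxy] at h1 h2
    apply hxy
    simp [h1, h2]
  · have h1 := congrArg (M.bil t (L 1)) h
    have h2 := congrArg (M.bil t (L 2)) h
    simp [bil_smul_right, bil_add_right, hL] at h1 h2
    simp [bil] at h1 h2
    apply hxy
    simp [h1, h2]
  · simp [bil_smul_left, bil_add_left, hL]
  · simp [bil_smul_right, bil_add_right, bil_smul_left, bil_add_left, hL]; ring
  · simp [bil_smul_right, bil_add_right, hL]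
  · simp [add_lie, smul_lie, b10, b20]
  · simp only [add_lie, smul_lie, lie_add, lie_smul, b12, b21, lie_self]
    simp
    match_scalars
    · field_simp
      ring
    · field_simp
      ring
  · simp [lie_add, lie_smul, b01, b02]

/-- The alternative is whether L 1 and L 2 commute. If they do, the type is VI₀; if not, the Jacobi
and off-diagonal Ricci equations make L 0 central. -/
theorem IsSource.bianchi {t : ℝ} {v : Fin 3 → ℝ} {ε r : ℝ} (hs : M.IsSource t v ε r)
    (ht : t ∈ M.I) (hM : M.ShearFree) (hiso : S.iso = ⊥) :
    M.IsLRSBianchiIII ∨ M.IsBianchiVI0 := by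
  obtain ⟨L, s, p, q, x, y, k, hk, hL, b01, b02, b12, hric⟩ := hs.exists_bianchi_frame ht hiso
  have r00 := hric 0 0
  have r01 := hric 0 1
  have r02 := hric 0 2
  have r11 := hric 1 1
  have r12 := hric 1 2
  have r22 := hric 2 2
  rw [sourceRicci_zero_zero] at r00
  rw [sourceRicci_zero_one] at r01
  rw [sourceRicci_zero_two] at r02
  rw [sourceRicci_one_one] at r11
  rw [sourceRicci_one_two] at r12
  rw [sourceRicci_two_two] at r22
  simp at r00 r01 r02 r11 r12 r22
  -- The bracket of L 1 and L 2 is annihilated by ad (L 0), because ad (L 0) is trace-free on their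
  -- plane.
  have jac := leibniz_lie (L 0) (L 1) (L 2)
  simp only [b01, b02, b12, add_lie, lie_add, smul_lie, lie_smul, lie_self, smul_zero, add_zero,
    zero_add] at jac
  have j1 := congrArg (M.bil t (L 1)) jac
  have j2 := congrArg (M.bil t (L 2)) jac
  simp [bil_add_right, bil_smul_right, bil_neg_right, hL] at j1 j2
  by_cases hxy : x ^ 2 + y ^ 2 = 0
  · have hx0 : x = 0 := by nlinarith [sq_nonneg x, sq_nonneg y]
    have hy0 : y = 0 := by nlinarith [sq_nonneg x, sq_nonneg y]
    subst hx0 hy0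
    -- If p ≠ q, the Ricci equations give s = 0 and then p + q = 0, which makes the slice flat and
    -- contradicts k ≠ 0.
    have hpq : p = q := by
      by_contra hpq
      have hs0 : s = 0 := r12.resolve_right (sub_ne_zero.2 hpq)
      have h1 : (p - q) * (p + q) = 0 := by nlinarith
      have h2 : p + q = 0 := (mul_eq_zero.1 h1).resolve_left (sub_ne_zero.2 hpq)
      subst hs0
      rw [h2] at r00
      apply hk
      nlinarith
    subst hpq
    have hpos : 0 < s ^ 2 + p ^ 2 := by
      refine lt_of_le_of_ne (by positivity) fun h => hk ?_
      nlinarith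
    -- At most one of the two square roots of s² + p² can equal s, so the other one serves.
    obtain ⟨μ, hμ, hμs⟩ : ∃ μ : ℝ, μ ^ 2 = s ^ 2 + p ^ 2 ∧ μ - s ≠ 0 := by
      by_cases h : √(s ^ 2 + p ^ 2) - s = 0
      · refine ⟨-√(s ^ 2 + p ^ 2), by rw [neg_sq, Real.sq_sqrt hpos.le], fun h' => ?_⟩
        have := Real.sqrt_pos.2 hpos
        linarith
      · exact ⟨_, Real.sq_sqrt hpos.le, h⟩
    have hμ0 : μ ≠ 0 := by
      rintro rfl
      linarith
    exact Or.inr (isBianchiVI0_of_frame ht hM hiso hL b01 b02 (by simpa using b12) hμ hμ0 hμs)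
  · have hpos : 0 < x ^ 2 + y ^ 2 := lt_of_le_of_ne (by positivity) (Ne.symm hxy)
    -- Each pair of linear equations in x and y combines to x² + y² times one of s, q, p.
    have hs0 : s = 0 := by
      have : s * (x ^ 2 + y ^ 2) = 0 := by linear_combination x * j1 + y * r01
      exact (mul_eq_zero.1 this).resolve_right hxy
    subst hs0
    have hq0 : q = 0 := by
      have : q * (x ^ 2 + y ^ 2) = 0 := by linear_combination y * j1 - x * r01
      exact (mul_eq_zero.1 this).resolve_right hxy
    have hp0 : p = 0 := by
      have : p * (x ^ 2 + y ^ 2) = 0 := by linear_combination x * j2 + y * r02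
      exact (mul_eq_zero.1 this).resolve_right hxy
    subst hq0 hp0
    simp only [zero_smul, neg_zero, add_zero] at b01 b02
    exact Or.inl ⟨isLRS_of_frame ht hM hiso hL b01 b02 b12,
      isTracefreeBianchiIII_of_frame ht hM hiso hL b01 b02 b12 hxy⟩

end Cosmology

/-! ### Classification of sources on spaces with isotropy -/

namespace HomogeneousSpace

variable {𝔤 : Type} [LieRing 𝔤] [LieAlgebra ℝ 𝔤] (S : HomogeneousSpace 𝔤)

theorem isoPart_eq_zero_iff {X : 𝔤} : S.isoPart X = 0 ↔ X ∈ Submodule.span ℝ (Set.range S.E) := by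
  rw [isoPart, sub_eq_zero]
  constructor
  · intro h
    rw [h]
    exact Submodule.sum_mem _ fun c _ =>
      Submodule.smul_mem _ _ (Submodule.subset_span (Set.mem_range_self c))
  · intro h
    induction h using Submodule.span_induction with
    | mem x hx =>
      obtain ⟨a, rfl⟩ := hx
      simp [S.W_E]
    | zero => simp
    | add x y _ _ hx hy =>
      conv_lhs => rw [hx, hy]
      simp only [map_add, add_smul, Finset.sum_add_distrib]
    | smul r x _ hx =>
      conv_lhs => rw [hx]
      simp only [map_smul, smul_eq_mul, mul_smul, Finset.smul_sum]

theorem isoPart_lie {Z X : 𝔤} (hZ : Z ∈ S.iso) (hX : S.isoPart X = 0) : S.isoPart ⁅Z, X⁆ = 0 := by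
  rw [isoPart_eq_zero_iff] at hX ⊢
  induction hX using Submodule.span_induction with
  | mem x hx =>
    obtain ⟨a, rfl⟩ := hx
    rw [S.reductive Z hZ a]
    exact Submodule.sum_mem _ fun c _ =>
      Submodule.smul_mem _ _ (Submodule.subset_span (Set.mem_range_self c))
  | zero => simp
  | add x y _ _ hx hy => rw [lie_add]; exact Submodule.add_mem _ hx hy
  | smul r x _ hx => rw [lie_smul]; exact Submodule.smul_mem _ _ hx

end HomogeneousSpace

namespace Cosmology

variable {𝔤 : Type} [LieRing 𝔤] [LieAlgebra ℝ 𝔤] {S : HomogeneousSpace 𝔤} {M : Cosmology S}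

theorem bil_of_mem_right (t : ℝ) (X : 𝔤) {Z : 𝔤} (hZ : Z ∈ S.iso) : M.bil t X Z = 0 := by
  simp [bil, (S.mem_iso Z).1 hZ]

/-- A frame adapted to a source on a space with isotropy. -/
theorem IsSource.exists_isotropic_frame {t : ℝ} {v : Fin 3 → ℝ} {ε r : ℝ} (hs : M.IsSource t v ε r)
    (ht : t ∈ M.I) (hiso : S.iso ≠ ⊥) :
    ∃ (L : Fin 3 → 𝔤) (Z : 𝔤), r ≠ 0 ∧
      (∀ a b, M.bil t (L a) (L b) = if a = b then 1 else 0) ∧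
      ⁅L 0, L 1⁆ = 0 ∧ ⁅L 0, L 2⁆ = 0 ∧ ⁅L 0, Z⁆ = 0 ∧ ⁅L 1, L 2⁆ = r • Z ∧ ⁅Z, L 1⁆ = L 2 ∧
      ⁅Z, L 2⁆ = -L 1 ∧ S.iso.toSubmodule = Submodule.span ℝ {Z} := by
  obtain ⟨L, ν, hν, hhor, hL, hv⟩ := exists_orthonormal_frame ht hs.ne_zero
  have h0 : ∀ X Y : 𝔤, M.bil t (L 0) ⁅X, Y⁆ = 0 := by
    intro X Y
    have := hs.char X Y
    rw [hv] at this
    exact (mul_eq_zero.1 this).resolve_left hν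
  have hexp : ∀ X, S.isoPart X = 0 → X = ∑ a, M.bil t (L a) X • L a := by
    intro X hX
    have h1 := M.sub_sum_mem_iso ht hL X
    have h2 : S.isoPart (X - ∑ a, M.bil t (L a) X • L a) = 0 := by
      rw [S.isoPart_eq_zero_iff] at hX ⊢
      exact Submodule.sub_mem _ hX (Submodule.sum_mem _ fun a _ =>
        Submodule.smul_mem _ _ (S.isoPart_eq_zero_iff.1 (hhor a)))
    rw [S.isoPart_of_mem h1, sub_eq_zero] at h2
    exact h2
  have hZL : ∀ Z ∈ S.iso, ∀ a, ⁅Z, L a⁆ = ∑ b, M.bil t (L b) ⁅Z, L a⁆ • L b := fun Z hZ a =>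
    hexp _ (S.isoPart_lie hZ (hhor a))
  have hsk : ∀ Z ∈ S.iso, ∀ a b, M.bil t (L b) ⁅Z, L a⁆ = - M.bil t (L a) ⁅Z, L b⁆ := by
    intro Z hZ a b
    have := M.bil_invariant ht hZ (L a) (L b)
    rw [M.bil_symm ht] at this
    linarith
  -- Commutators have no L 0 component, and isotropies act by skew endomorphisms, so L 0 is fixed.
  have hZ0 : ∀ Z ∈ S.iso, ⁅Z, L 0⁆ = 0 := by
    intro Z hZ
    rw [hZL Z hZ]
    refine Finset.sum_eq_zero fun b _ => ?_
    rw [hsk Z hZ, h0, neg_zero, zero_smul]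
  have hdiag : ∀ Z ∈ S.iso, ∀ a, M.bil t (L a) ⁅Z, L a⁆ = 0 := by
    intro Z hZ a
    linarith [hsk Z hZ a a]
  have hZ1 : ∀ Z ∈ S.iso, ⁅Z, L 1⁆ = M.bil t (L 2) ⁅Z, L 1⁆ • L 2 := by
    intro Z hZ
    conv_lhs => rw [hZL Z hZ, Fin.sum_univ_three, h0, hdiag Z hZ, zero_smul, zero_smul, zero_add,
      zero_add]
  have hZ2 : ∀ Z ∈ S.iso, ⁅Z, L 2⁆ = -(M.bil t (L 2) ⁅Z, L 1⁆) • L 1 := by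
    intro Z hZ
    conv_lhs => rw [hZL Z hZ, Fin.sum_univ_three, h0, hdiag Z hZ, zero_smul, zero_smul, zero_add,
      add_zero, hsk Z hZ]
  -- By effectiveness an isotropy is determined by its rotation rate in the plane of L 1 and L 2, so
  -- the isotropy algebra is one-dimensional.
  have heff : ∀ Z ∈ S.iso, M.bil t (L 2) ⁅Z, L 1⁆ = 0 → Z = 0 := by
    intro Z hZ h
    refine S.effective Z hZ fun a => ?_
    have hE : S.isoPart (S.E a) = 0 :=
      S.isoPart_eq_zero_iff.2 (Submodule.subset_span (Set.mem_range_self a))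
    have h1 := hZ1 Z hZ
    have h2 := hZ2 Z hZ
    rw [h] at h1 h2
    rw [hexp _ hE, lie_sum, Fin.sum_univ_three, lie_smul, lie_smul, lie_smul, hZ0 Z hZ, h1, h2]
    simp
  obtain ⟨Z₀, hZ₀, hne⟩ : ∃ Z ∈ S.iso, Z ≠ 0 := by
    by_contra h
    push Not at h
    exact hiso ((LieSubalgebra.eq_bot_iff S.iso).2 h)
  have hz₀ : M.bil t (L 2) ⁅Z₀, L 1⁆ ≠ 0 := fun h => hne (heff Z₀ hZ₀ h)
  obtain ⟨Z, hZ, hz⟩ : ∃ Z ∈ S.iso, M.bil t (L 2) ⁅Z, L 1⁆ = 1 :=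
    ⟨(M.bil t (L 2) ⁅Z₀, L 1⁆)⁻¹ • Z₀, S.iso.smul_mem _ hZ₀, by
      rw [smul_lie, bil_smul_right, inv_mul_cancel₀ hz₀]⟩
  have hspan : ∀ Z' ∈ S.iso, Z' = M.bil t (L 2) ⁅Z', L 1⁆ • Z := by
    intro Z' hZ'
    rw [← sub_eq_zero]
    refine heff _ (S.iso.sub_mem hZ' (S.iso.smul_mem _ hZ)) ?_
    rw [sub_lie, smul_lie, bil_sub_right, bil_smul_right, hz]
    ring
  have c1 : ⁅Z, L 1⁆ = L 2 := by rw [hZ1 Z hZ, hz, one_smul]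
  have c2 : ⁅Z, L 2⁆ = -L 1 := by rw [hZ2 Z hZ, hz, neg_smul, one_smul]
  have c0 : ⁅Z, L 0⁆ = 0 := hZ0 Z hZ
  have hdec : ∀ X : 𝔤, ∃ z : ℝ, X = ∑ a, M.bil t (L a) X • L a + z • Z := by
    intro X
    exact ⟨_, eq_add_of_sub_eq' (hspan _ (M.sub_sum_mem_iso ht hL X))⟩
  obtain ⟨z01, h01⟩ := hdec ⁅L 0, L 1⁆
  obtain ⟨z02, h02⟩ := hdec ⁅L 0, L 2⁆
  obtain ⟨κ, h12⟩ := hdec ⁅L 1, L 2⁆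
  have htr := hs.trace_lie ht hL hν hv
  rw [Fin.sum_univ_three, h0, zero_smul, zero_add] at h01 h02 h12
  set s := M.bil t (L 1) ⁅L 0, L 1⁆
  set p := M.bil t (L 2) ⁅L 0, L 1⁆
  set q := M.bil t (L 1) ⁅L 0, L 2⁆
  set s' := M.bil t (L 2) ⁅L 0, L 2⁆
  set x := M.bil t (L 1) ⁅L 1, L 2⁆
  set y := M.bil t (L 2) ⁅L 1, L 2⁆
  have hbil : ∀ a, M.bil t (L a) Z = 0 := fun a => bil_of_mem_right t _ hZ
  have hZne : Z ≠ 0 := by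
    rintro rfl
    simp [bil] at hz
  -- The Jacobi identities with Z say that ad (L 0) commutes with the rotation; together with its
  -- vanishing trace this makes it p times the rotation on the plane. The third identity leaves no
  -- invariant vector for the bracket of L 1 and L 2.
  have E1 : s • L 2 - p • L 1 = q • L 1 + s' • L 2 + z02 • Z := by
    have := leibniz_lie Z (L 0) (L 1)
    rw [c0, c1, zero_lie, zero_add, h01, h02] at this
    rw [← this]
    simp [c1, c2, sub_eq_add_neg]
  have E2 : q • L 2 - s' • L 1 = -(s • L 1 + p • L 2 + z01 • Z) := by
    have := leibniz_lie Z (L 0) (L 2)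
    rw [c0, c2, zero_lie, zero_add, lie_neg, h01, h02] at this
    rw [← this]
    simp [c1, c2, sub_eq_add_neg]
  have E3 : x • L 2 - y • L 1 = 0 := by
    have := leibniz_lie Z (L 1) (L 2)
    rw [c1, c2, lie_self, lie_neg, lie_self, h12] at this
    simp [c1, c2] at this
    rw [← this]
    abel
  have F1 := congrArg (M.bil t (L 1)) E1
  have F2 := congrArg (M.bil t (L 2)) E1
  have F3 := congrArg (M.bil t (L 1)) E3
  have F4 := congrArg (M.bil t (L 2)) E3
  have b0 : ∀ X, M.bil t X 0 = 0 := fun X => by simp [bil]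
  simp [bil_add_right, bil_sub_right, bil_smul_right, hL, hbil, b0] at F1 F2 F3 F4
  have hs0 : s = 0 := by linarith
  have hs0' : s' = 0 := by linarith
  rw [hs0, hs0', ← F1] at E1
  rw [hs0, hs0', ← F1] at E2
  have hz01 : z01 = 0 := by
    simpa [hZne] using E2
  have hz02 : z02 = 0 := by
    simpa [hZne] using E1
  rw [hs0, hz01, zero_smul, zero_smul, zero_add, add_zero] at h01
  rw [hs0', ← F1, hz02, zero_smul, zero_smul, add_zero, add_zero] at h02
  rw [F3, F4, zero_smul, zero_smul, zero_add, zero_add] at h12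
  -- Subtracting p Z from L 0 cancels this rotation and changes no tangent components; the new lift
  -- need not be horizontal.
  obtain ⟨L', hL'0, hL'1, hL'2⟩ : ∃ L' : Fin 3 → 𝔤, L' 0 = L 0 - p • Z ∧ L' 1 = L 1 ∧ L' 2 = L 2 :=
    ⟨![L 0 - p • Z, L 1, L 2], rfl, rfl, rfl⟩
  have hc : ∀ a, S.coords (L' a) = S.coords (L a) := by
    intro a
    fin_cases a
    · show S.coords (L' 0) = S.coords (L 0)
      rw [hL'0, map_sub, S.mem_iso_iff.1 (S.iso.smul_mem p hZ), sub_zero]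
    · show S.coords (L' 1) = S.coords (L 1)
      rw [hL'1]
    · show S.coords (L' 2) = S.coords (L 2)
      rw [hL'2]
  have hWL : ∀ a b, S.W a (L' b) = S.W a (L b) := fun a b => congrFun (hc b) a
  have hLL' : ∀ a b, M.bil t (L' a) (L' b) = if a = b then 1 else 0 := by
    intro a b
    rw [← hL a b]
    simp only [bil, hWL]
  have d01 : ⁅L' 0, L' 1⁆ = 0 := by
    rw [hL'0, hL'1, sub_lie, smul_lie, h01, c1, sub_self]
  have d02 : ⁅L' 0, L' 2⁆ = 0 := by
    rw [hL'0, hL'2, sub_lie, smul_lie, h02, c2]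
    simp
  have d0Z : ⁅L' 0, Z⁆ = 0 := by
    rw [hL'0, sub_lie, smul_lie, lie_self, ← lie_skew, c0]
    simp
  have d12 : ⁅L' 1, L' 2⁆ = κ • Z := by rw [hL'1, hL'2, h12]
  have d10 : ⁅L' 1, L' 0⁆ = 0 := by rw [← lie_skew, d01, neg_zero]
  have d20 : ⁅L' 2, L' 0⁆ = 0 := by rw [← lie_skew, d02, neg_zero]
  have d21 : ⁅L' 2, L' 1⁆ = -(κ • Z) := by rw [← lie_skew, d12]
  have dZ0 : ⁅Z, L' 0⁆ = 0 := by rw [← lie_skew, d0Z, neg_zero]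
  have dZ1 : ⁅Z, L' 1⁆ = L' 2 := by rw [hL'1, hL'2, c1]
  have dZ2 : ⁅Z, L' 2⁆ = - L' 1 := by rw [hL'1, hL'2, c2]
  have hdiff : ∀ a b, ⁅L' a, L' b⁆ - ∑ c, adaptedD 0 0 a b c • L' c = adaptedIso (κ • Z) a b := by
    intro a b
    fin_cases a <;> fin_cases b <;>
      simp [adaptedD, adaptedIso, Fin.sum_univ_three, d01, d02, d12, d10, d20, d21]
  have hO : ∀ a b c d, S.W d ⁅⁅L' a, L' b⁆ - ∑ c, adaptedD 0 0 a b c • L' c, L' c⁆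
      = ∑ e, adaptedOm κ a b c e * S.W d (L' e) := by
    intro a b c d
    rw [hdiff]
    fin_cases a <;> fin_cases b <;> fin_cases c <;>
      simp [adaptedOm, adaptedIso, Fin.sum_univ_three, dZ0, dZ1, dZ2]
  have hbr : ∀ a b, ⁅L' a, L' b⁆ - ∑ c, adaptedD 0 0 a b c • L' c ∈ S.iso := by
    intro a b
    rw [hdiff]
    fin_cases a <;> fin_cases b <;> simp [adaptedIso, S.iso.smul_mem κ hZ]
  have hric := fun b c => (adapted_ricci (κ := κ) (zero_mul (0 : ℝ)) b c).symm.trans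
    (hs.ricci_orthonormal M ht hLL' hbr (adaptedConn_skew 0 0) (adaptedConn_torsion 0 0) hO b c)
  have r11 := hric 1 1
  have r00 := hric 0 0
  simp only [hWL, hv, hL] at r11 r00
  simp at r11 r00
  subst r11
  refine ⟨L', Z, ?_, hLL', d01, d02, d0Z, d12, dZ1, dZ2, ?_⟩
  -- The Ricci curvature along L 0 is zero, so r would have to cancel ε ν², which is nonzero.
  · rintro rfl
    rcases hs.sgn with h | h <;> simp [h, hν] at r00
  · refine le_antisymm (fun Z' hZ' => ?_) ?_
    · exact Submodule.mem_span_singleton.2 ⟨_, (hspan Z' hZ').symm⟩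
    · rw [Submodule.span_singleton_le_iff_mem]
      exact hZ

/-- L 1, L 2 and Z span the isometry algebra of a surface of curvature r. For r > 0 it is so(3). For
r < 0 it has a two-dimensional subalgebra transversal to the rotation, which together with L 0 is
simply transitive. -/
theorem IsSource.isotropic {t : ℝ} {v : Fin 3 → ℝ} {ε r : ℝ} (hs : M.IsSource t v ε r)
    (ht : t ∈ M.I) (hM : M.ShearFree) (hiso : S.iso ≠ ⊥) :
    M.IsLRSBianchiIII ∨ M.IsKantowskiSachs := by
  obtain ⟨L, Z, hr, hL, h01, h02, h0Z, h12, hZ1, hZ2, hspan⟩ := hs.exists_isotropic_frame ht hiso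
  have hZ : Z ∈ S.iso := by
    rw [← LieSubalgebra.mem_toSubmodule, hspan]
    exact Submodule.mem_span_singleton_self Z
  have hZne : Z ≠ 0 := by
    rintro rfl
    have := hL 2 2
    simp [← hZ1, bil] at this
  have hbil : ∀ a, M.bil t (L a) Z = 0 := fun a => bil_of_mem_right t _ hZ
  have h1Z : ⁅L 1, Z⁆ = - L 2 := by rw [← lie_skew, hZ1]
  have h2Z : ⁅L 2, Z⁆ = L 1 := by rw [← lie_skew, hZ2, neg_neg]
  have h10 : ⁅L 1, L 0⁆ = 0 := by rw [← lie_skew, h01, neg_zero]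
  have h20 : ⁅L 2, L 0⁆ = 0 := by rw [← lie_skew, h02, neg_zero]
  have h21 : ⁅L 2, L 1⁆ = -(r • Z) := by rw [← lie_skew, h12]
  have hnot : ∀ (a : Fin 3) {X : 𝔤}, M.bil t (L a) X ≠ 0 → X ∉ S.iso := by
    intro a X hX hmem
    exact hX (bil_of_mem_right t _ hmem)
  rcases lt_or_gt_of_ne hr with hneg | hpos
  · obtain ⟨m, hm, hmr⟩ : ∃ m : ℝ, m ≠ 0 ∧ r = -(m * m) :=
      ⟨√(-r), (Real.sqrt_pos.2 (neg_pos.2 hneg)).ne', by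
        rw [Real.mul_self_sqrt (neg_pos.2 hneg).le, neg_neg]⟩
    -- The given group already has isotropy, so it witnesses local rotational symmetry itself.
    refine Or.inl ⟨⟨𝔤, inferInstance, inferInstance, S, M, LieHom.id, hiso, fun _ _ => rfl, rfl,
      fun _ _ => rfl⟩, ?_⟩
    -- With r = −m², the element L 2 − m Z is an eigenvector of ad (L 1) with eigenvalue m, so T is
    -- scaled to make this −2.
    refine IsTracefreeBianchi.of_frame ht hM ⟨by simp, by simp⟩ (T := (-2 / m) • L 1) (X := L 0)
      (V := L 2 - m • Z) (hnot 1 ?_) (hnot 0 ?_) (hnot 2 ?_) ?_ ?_ ?_ ?_ ?_ ?_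
    · simp [bil_smul_right, hL, hm]
    · simp [hL]
    · simp [bil_sub_right, bil_smul_right, hL, hbil]
    · simp [bil_smul_left, hL]
    · simp [bil_smul_left, bil_sub_right, bil_smul_right, hL, hbil]
    · simp [bil_sub_right, bil_smul_right, hL, hbil]
    · simp [h10]
    · simp only [smul_lie, lie_sub, lie_smul, h12, h1Z, hmr]
      simp
      match_scalars
      · field_simp
        try ring
      · field_simp
        try ring
    · simp [h02, h0Z]
  · refine Or.inr ?_
    obtain ⟨m, hm, hmr⟩ : ∃ m : ℝ, m ≠ 0 ∧ m * (m * r) = 1 := by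
      have h := (Real.sqrt_pos.2 hpos).ne'
      refine ⟨(√r)⁻¹, inv_ne_zero h, ?_⟩
      rw [← mul_assoc, ← mul_inv, Real.mul_self_sqrt hpos.le, inv_mul_cancel₀ hpos.ne']
    -- The factor m, with m² r = 1, normalizes the commutator of the first two rotation generators
    -- to Z.
    let b' : Option (Fin 3) → 𝔤 := fun
      | none => L 0
      | some 0 => m • L 1
      | some 1 => m • L 2
      | some 2 => Z
    have hli : LinearIndependent ℝ b' := by
      rw [Fintype.linearIndependent_iff]
      intro g hg
      rw [Fintype.sum_option, Fin.sum_univ_three] at hg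
      have g0 := congrArg (M.bil t (L 0)) hg
      have g1 := congrArg (M.bil t (L 1)) hg
      have g2 := congrArg (M.bil t (L 2)) hg
      have b0 : ∀ X, M.bil t X 0 = 0 := fun X => by simp [bil]
      simp [b', bil_add_right, bil_smul_right, hL, hbil, hm, b0] at g0 g1 g2
      simp [b', g0, g1, g2, hZne] at hg
      rintro (_ | i)
      · exact g0
      · fin_cases i
        exacts [g1, g2, hg]
    have hsp : ⊤ ≤ Submodule.span ℝ (Set.range b') := by
      intro X _
      have hX := M.sub_sum_mem_iso ht hL X
      rw [← LieSubalgebra.mem_toSubmodule, hspan, Submodule.mem_span_singleton] at hX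
      obtain ⟨z, hz⟩ := hX
      have hmem : ∀ i, b' i ∈ Submodule.span ℝ (Set.range b') := fun i =>
        Submodule.subset_span (Set.mem_range_self i)
      have hLmem : ∀ a, L a ∈ Submodule.span ℝ (Set.range b') := by
        intro a
        fin_cases a
        · exact hmem none
        · have := Submodule.smul_mem _ m⁻¹ (hmem (some 0))
          simpa [b', smul_smul, hm] using this
        · have := Submodule.smul_mem _ m⁻¹ (hmem (some 1))
          simpa [b', smul_smul, hm] using this
      rw [eq_add_of_sub_eq hz.symm]
      exact Submodule.add_mem _ (Submodule.smul_mem _ _ (hmem (some 2)))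
        (Submodule.sum_mem _ fun a _ => Submodule.smul_mem _ _ (hLmem a))
    obtain ⟨e1, e2, e3, e4, e5, e6⟩ := epsilon_table
    obtain ⟨e7, e8, e9⟩ : epsilon 1 0 2 = -1 ∧ epsilon 2 0 1 = 1 ∧ epsilon 2 1 0 = -1 := by
      refine ⟨?_, ?_, ?_⟩ <;> simp [epsilon, Matrix.det_fin_three]
    refine ⟨Module.Basis.mk hli hsp, fun a => ?_, fun a c => ?_, ?_⟩
    · rw [Module.Basis.mk_apply, Module.Basis.mk_apply]
      fin_cases a <;> simp [b', h01, h02, h0Z]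
    · simp only [Module.Basis.mk_apply]
      have hmr' : m • m • r • Z = Z := by rw [smul_smul, smul_smul, mul_assoc, hmr, one_smul]
      fin_cases a <;> fin_cases c <;>
        simp [b', Fin.sum_univ_three, e1, e2, e3, e4, e5, e6, e7, e8, e9, h12, h21, h1Z, h2Z, hZ1,
          hZ2, hmr']
    · rw [Module.Basis.mk_apply]
      exact hspan

/-- Spacetimes that admit a source belong to one of the three classes. -/
theorem IsSource.classification {t : ℝ} {v : Fin 3 → ℝ} {ε r : ℝ} (hs : M.IsSource t v ε r)
    (ht : t ∈ M.I) (hM : M.ShearFree) :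
    M.IsLRSBianchiIII ∨ M.IsBianchiVI0 ∨ M.IsKantowskiSachs := by
  by_cases hiso : S.iso = ⊥
  · rcases hs.bianchi ht hM hiso with h | h
    · exact Or.inl h
    · exact Or.inr (Or.inl h)
  · rcases hs.isotropic ht hM hiso with h | h
    · exact Or.inl h
    · exact Or.inr (Or.inr h)

end Cosmology

/-! ### The gauge energy-momentum tensor in an orthogonal frame -/

namespace FrameGeometry

variable {ι : Type} [Fintype ι] [DecidableEq ι] (G : FrameGeometry ι)

omit [DecidableEq ι] in
theorem sum_fin_succ {k : ℕ} (f : (Fin (k + 1) → ι) → ℝ) :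
    ∑ α, f α = ∑ a, ∑ β : Fin k → ι, f (Fin.cons a β) := by
  rw [← Fintype.sum_prod_type']
  exact (Fintype.sum_equiv (Fin.consEquiv fun _ => ι) (fun x => f (Fin.cons x.1 x.2)) _
    fun x => rfl).symm

omit [DecidableEq ι] in
theorem sum_fin_zero (f : (Fin 0 → ι) → ℝ) : ∑ α, f α = f ![] := by
  rw [Fintype.sum_unique]
  congr 1

/-- Components of a covariant tensor in the frame `P e`. -/
noncomputable def reframe (P : Matrix ι ι ℝ) {k : ℕ} (T : (Fin k → ι) → ℝ) (ν : Fin k → ι) : ℝ :=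
  ∑ μ, (∏ i, P (ν i) (μ i)) * T μ

omit [DecidableEq ι] in
theorem reframe_cons (P : Matrix ι ι ℝ) {k : ℕ} (T : (Fin (k + 1) → ι) → ℝ) (a : ι)
    (ν : Fin k → ι) :
    reframe P T (Fin.cons a ν) = ∑ b, P a b * reframe P (fun μ => T (Fin.cons b μ)) ν := by
  rw [reframe, sum_fin_succ]
  refine Finset.sum_congr rfl fun b _ => ?_
  rw [reframe, Finset.mul_sum]
  refine Finset.sum_congr rfl fun μ _ => ?_
  rw [Fin.prod_univ_succ]
  simp only [Fin.cons_zero, Fin.cons_succ]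
  ring

omit [DecidableEq ι] in
theorem reframe_zero (P : Matrix ι ι ℝ) (T : (Fin 0 → ι) → ℝ) (ν : Fin 0 → ι) :
    reframe P T ν = T ![] := by
  rw [reframe, sum_fin_zero]
  simp

omit [DecidableEq ι] in
theorem reframe_perm (P : Matrix ι ι ℝ) {k : ℕ} {T : (Fin k → ι) → ℝ}
    (hT : ∀ (τ : Equiv.Perm (Fin k)) (μ : Fin k → ι),
      T (fun i => μ (τ i)) = ((Equiv.Perm.sign τ : ℤ) : ℝ) * T μ)
    (τ : Equiv.Perm (Fin k)) (ν : Fin k → ι) :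
    reframe P T (fun i => ν (τ i)) = ((Equiv.Perm.sign τ : ℤ) : ℝ) * reframe P T ν := by
  rw [reframe, reframe, Finset.mul_sum]
  refine Fintype.sum_equiv (Equiv.arrowCongr τ (Equiv.refl ι)) _ _ fun μ => ?_
  have h1 : ∀ i, (Equiv.arrowCongr τ (Equiv.refl ι)) μ (τ i) = μ i := fun i => by simp
  have h2 : T μ = ((Equiv.Perm.sign τ : ℤ) : ℝ) * T ((Equiv.arrowCongr τ (Equiv.refl ι)) μ) := by
    rw [← hT]
    congr 1
    funext i
    exact (h1 i).symm
  have h3 : ∏ i, P (ν i) ((Equiv.arrowCongr τ (Equiv.refl ι)) μ i) = ∏ i, P (ν (τ i)) (μ i) := by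
    rw [← Equiv.prod_comp τ]
    simp only [h1]
  rw [h3, h2]
  ring

/-- Contraction in a frame with diagonal metric. -/
theorem contract_eq {t : ℝ} {P : Matrix ι ι ℝ} {η : ι → ℝ}
    (hP : (G.g t)⁻¹ = Pᵀ * Matrix.diagonal η * P) {k : ℕ} (X Y : (Fin k → ι) → ℝ) :
    G.contract X Y t = ∑ γ, (∏ i, η (γ i)) * (reframe P X γ * reframe P Y γ) := by
  have h1 : ∀ a b, (G.g t)⁻¹ a b = ∑ c, η c * (P c a * P c b) := by
    intro a b
    rw [hP, Matrix.mul_apply]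
    refine Finset.sum_congr rfl fun c _ => ?_
    rw [Matrix.mul_diagonal, Matrix.transpose_apply]
    ring
  have h2 : ∀ α β : Fin k → ι, ∏ i, (G.g t)⁻¹ (α i) (β i)
      = ∑ γ : Fin k → ι, (∏ i, η (γ i)) * ((∏ i, P (γ i) (α i)) * ∏ i, P (γ i) (β i)) := by
    intro α β
    simp only [h1]
    rw [Finset.prod_univ_sum, Fintype.piFinset_univ]
    simp only [Finset.prod_mul_distrib]
  rw [contract]
  simp only [h2, reframe, Finset.sum_mul_sum, Finset.mul_sum, Finset.sum_mul]
  rw [Finset.sum_comm]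
  conv_lhs =>
    enter [2, β]
    rw [Finset.sum_comm]
  rw [Finset.sum_comm]
  refine Finset.sum_congr rfl fun γ _ => ?_
  exact Finset.sum_congr rfl fun α _ => Finset.sum_congr rfl fun β _ => by ring

end FrameGeometry

namespace Cosmology

variable {𝔤 : Type} [LieRing 𝔤] [LieAlgebra ℝ 𝔤] {S : HomogeneousSpace 𝔤} (M : Cosmology S)

/-- Extension of a change of spatial frame by `∂_t`. -/
def timeExtend (P : Matrix (Fin 3) (Fin 3) ℝ) : Matrix SIdx SIdx ℝ :=
  Matrix.of fun μ ν => match μ, ν with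
    | none, none => 1
    | some a, some b => P a b
    | _, _ => 0

@[simp] theorem timeExtend_nn (P : Matrix (Fin 3) (Fin 3) ℝ) : timeExtend P none none = 1 := rfl
@[simp] theorem timeExtend_ns (P : Matrix (Fin 3) (Fin 3) ℝ) (a : Fin 3) :
    timeExtend P none (some a) = 0 := rfl
@[simp] theorem timeExtend_sn (P : Matrix (Fin 3) (Fin 3) ℝ) (a : Fin 3) :
    timeExtend P (some a) none = 0 := rfl
@[simp] theorem timeExtend_ss (P : Matrix (Fin 3) (Fin 3) ℝ) (a b : Fin 3) :
    timeExtend P (some a) (some b) = P a b := rfl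

/-- Inverse metric in an orthogonal frame. -/
noncomputable def frameMetricInv (t₀ t : ℝ) : SIdx → ℝ
  | none => -1
  | some _ => (M.scaleSq t₀ t)⁻¹

@[simp] theorem frameMetricInv_none (t₀ t : ℝ) : M.frameMetricInv t₀ t none = -1 := rfl
@[simp] theorem frameMetricInv_some (t₀ t : ℝ) (a : Fin 3) :
    M.frameMetricInv t₀ t (some a) = (M.scaleSq t₀ t)⁻¹ := rfl

section frame

variable {M} (hM : M.ShearFree) {t₀ t : ℝ} (ht₀ : t₀ ∈ M.I) (ht : t ∈ M.I) {L : Fin 3 → 𝔤}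
  (hL : ∀ a b, M.bil t₀ (L a) (L b) = if a = b then 1 else 0)
include hM ht₀ ht hL

/-- The frame is orthonormal at t₀, and at t it is still orthogonal with the common squared length
`scaleSq`. -/
theorem metric_inv_frame : (M.metric t)⁻¹ = (timeExtend (S.frameMatrix L))ᵀ
    * Matrix.diagonal (M.frameMetricInv t₀ t) * timeExtend (S.frameMatrix L) := by
  have h1 : ∀ a b, (M.h t)⁻¹ a b
      = (M.scaleSq t₀ t)⁻¹ * ((S.frameMatrix L)ᵀ * S.frameMatrix L) a b := by
    intro a b
    rw [M.h_inv_eq ht₀ hM ht, M.h_inv_orthonormal hL, div_eq_inv_mul]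
  ext μ ν
  rw [Matrix.mul_apply]
  simp only [Matrix.mul_diagonal, Matrix.transpose_apply, Fintype.sum_option]
  rcases μ with _ | a <;> rcases ν with _ | b
  · simp [M.metric_inv_nn ht]
  · simp [M.metric_inv_ns ht]
  · simp [M.metric_inv_sn ht]
  · rw [M.metric_inv_ss ht, h1, Matrix.mul_apply, Finset.mul_sum]
    simp only [timeExtend_ns, timeExtend_ss, mul_zero, zero_mul, zero_add, frameMetricInv_some,
      Matrix.transpose_apply]
    exact Finset.sum_congr rfl fun c _ => by ring

theorem h_frame (a b : Fin 3) :
    ∑ c, ∑ d, S.W c (L a) * S.W d (L b) * M.h t c d = if a = b then M.scaleSq t₀ t else 0 := by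
  have := hL a b
  rw [bil] at this
  have h1 : ∑ c, ∑ d, S.W c (L a) * S.W d (L b) * M.h t c d
      = M.scaleSq t₀ t * ∑ c, ∑ d, S.W c (L a) * S.W d (L b) * M.h t₀ c d := by
    simp only [M.h_eq_smul ht₀ hM ht, Matrix.smul_apply, smul_eq_mul, Finset.mul_sum]
    exact Finset.sum_congr rfl fun c _ => Finset.sum_congr rfl fun d _ => by ring
  rw [h1, this]
  simp

theorem sum_h_inv_frame (X : Fin 3 → Fin 3 → ℝ) :
    ∑ c, ∑ d, (M.h t)⁻¹ c d * X c d
      = (M.scaleSq t₀ t)⁻¹ * ∑ a, ∑ c, ∑ d, S.W c (L a) * S.W d (L a) * X c d := by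
  have h1 : ∀ a b, (M.h t)⁻¹ a b
      = (M.scaleSq t₀ t)⁻¹ * ∑ c, S.W a (L c) * S.W b (L c) := by
    intro a b
    rw [M.h_inv_eq ht₀ hM ht, M.h_inv_orthonormal hL, div_eq_inv_mul]
    rfl
  simp only [h1, Finset.mul_sum, Finset.sum_mul]
  conv_rhs => rw [Finset.sum_comm]
  refine Finset.sum_congr rfl fun c _ => ?_
  conv_rhs => rw [Finset.sum_comm]
  exact Finset.sum_congr rfl fun d _ => Finset.sum_congr rfl fun a _ => by ring

end frame

end Cosmology

namespace GaugeField

variable {𝔤 : Type} [LieRing 𝔤] [LieAlgebra ℝ 𝔤] {S : HomogeneousSpace 𝔤} {M : Cosmology S}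
  (A : GaugeField M)

/-- Components of the field strength in a spatial frame lifted to `𝔤`. -/
noncomputable def frameF (L : Fin 3 → 𝔤) (t : ℝ) : (Fin (A.p + 1) → SIdx) → ℝ :=
  FrameGeometry.reframe (Cosmology.timeExtend (S.frameMatrix L)) (A.F t)

/-- `F_{μ α…} F_ν^{α…}` in an orthogonal frame. -/
noncomputable def frameSq (L : Fin 3 → 𝔤) (t₀ t : ℝ) (μ ν : SIdx) : ℝ :=
  ∑ γ : Fin A.p → SIdx, (∏ i, M.frameMetricInv t₀ t (γ i))
    * (A.frameF L t (Fin.cons μ γ) * A.frameF L t (Fin.cons ν γ))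

section frame

variable (hM : M.ShearFree) {t₀ t : ℝ} (ht₀ : t₀ ∈ M.I) (ht : t ∈ M.I) {L : Fin 3 → 𝔤}
  (hL : ∀ a b, M.bil t₀ (L a) (L b) = if a = b then 1 else 0)
include hM ht₀ ht hL

theorem contract_frame (μ ν : SIdx) :
    ∑ ρ, ∑ σ, Cosmology.timeExtend (S.frameMatrix L) μ ρ
        * Cosmology.timeExtend (S.frameMatrix L) ν σ
        * M.spacetime.contract (fun α : Fin A.p → SIdx => A.F t (Fin.cons ρ α))
          (fun α => A.F t (Fin.cons σ α)) t
      = A.frameSq L t₀ t μ ν := by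
  have hP : (M.spacetime.g t)⁻¹ = _ := Cosmology.metric_inv_frame hM ht₀ ht hL
  simp only [M.spacetime.contract_eq hP, frameSq, frameF, FrameGeometry.reframe_cons]
  set P := Cosmology.timeExtend (S.frameMatrix L)
  have e : ∀ (x : ℝ) (f g : SIdx → ℝ), x * ((∑ ρ, P μ ρ * f ρ) * ∑ σ, P ν σ * g σ)
      = ∑ ρ, ∑ σ, P μ ρ * P ν σ * (x * (f ρ * g σ)) := by
    intro x f g
    rw [Finset.sum_mul_sum, Finset.mul_sum]
    refine Finset.sum_congr rfl fun ρ _ => ?_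
    rw [Finset.mul_sum]
    exact Finset.sum_congr rfl fun σ _ => by ring
  simp only [e]
  conv_rhs => rw [Finset.sum_comm]
  refine Finset.sum_congr rfl fun ρ _ => ?_
  conv_rhs => rw [Finset.sum_comm]
  refine Finset.sum_congr rfl fun σ _ => ?_
  rw [Finset.mul_sum]

/-- Splitting off the first index exhibits the full contraction as the metric trace of `frameSq`. -/
theorem contract_self_frame :
    M.spacetime.contract (A.F t) (A.F t) t
      = -A.frameSq L t₀ t none none
        + (M.scaleSq t₀ t)⁻¹ * ∑ a, A.frameSq L t₀ t (some a) (some a) := by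
  have hP : (M.spacetime.g t)⁻¹ = _ := Cosmology.metric_inv_frame hM ht₀ ht hL
  rw [M.spacetime.contract_eq hP, FrameGeometry.sum_fin_succ, Fintype.sum_option, frameSq,
    Finset.mul_sum]
  congr 1
  · rw [← Finset.sum_neg_distrib]
    refine Finset.sum_congr rfl fun γ _ => ?_
    rw [Fin.prod_univ_succ]
    simp only [Fin.cons_zero, Fin.cons_succ, Cosmology.frameMetricInv_none, frameF]
    ring
  · refine Finset.sum_congr rfl fun a _ => ?_
    rw [frameSq, Finset.mul_sum]
    refine Finset.sum_congr rfl fun γ _ => ?_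
    rw [Fin.prod_univ_succ]
    simp only [Fin.cons_zero, Fin.cons_succ, Cosmology.frameMetricInv_some, frameF]
    ring

/-- Energy density in terms of the field strength in an orthogonal frame. -/
theorem T_nn_frame : A.T none none t = A.sgn * (A.frameSq L t₀ t none none / (A.p.factorial : ℝ)
    + (-A.frameSq L t₀ t none none
        + (M.scaleSq t₀ t)⁻¹ * ∑ a, A.frameSq L t₀ t (some a) (some a))
      / (2 * ((A.p + 1).factorial : ℝ))) := by
  rw [GaugeField.T, A.contract_self_frame hM ht₀ ht hL, Cosmology.metric_nn,
    ← A.contract_frame hM ht₀ ht hL none none]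
  simp only [Fintype.sum_option, Cosmology.timeExtend_nn, Cosmology.timeExtend_ns, zero_mul,
    mul_zero, Finset.sum_const_zero, add_zero, one_mul]
  ring

theorem T_sn_frame (a : Fin 3) : ∑ c, S.W c (L a) * A.T (some c) none t
    = A.sgn * (A.frameSq L t₀ t (some a) none / (A.p.factorial : ℝ)) := by
  rw [← A.contract_frame hM ht₀ ht hL (some a) none]
  simp only [Fintype.sum_option, Cosmology.timeExtend_nn, Cosmology.timeExtend_ns,
    Cosmology.timeExtend_sn, Cosmology.timeExtend_ss, zero_mul,
    mul_zero, Finset.sum_const_zero, add_zero, zero_add, mul_one]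
  rw [Finset.sum_div, Finset.mul_sum]
  refine Finset.sum_congr rfl fun c _ => ?_
  rw [GaugeField.T, Cosmology.metric_sn, S.frameMatrix_apply]
  ring

theorem T_ss_frame (a b : Fin 3) : ∑ c, ∑ d, S.W c (L a) * S.W d (L b) * A.T (some c) (some d) t
    = A.sgn * (A.frameSq L t₀ t (some a) (some b) / (A.p.factorial : ℝ)
      - (if a = b then M.scaleSq t₀ t else 0) * ((-A.frameSq L t₀ t none none
        + (M.scaleSq t₀ t)⁻¹ * ∑ a, A.frameSq L t₀ t (some a) (some a))
      / (2 * ((A.p + 1).factorial : ℝ)))) := by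
  rw [← A.contract_self_frame hM ht₀ ht hL, ← A.contract_frame hM ht₀ ht hL (some a) (some b),
    ← Cosmology.h_frame hM ht₀ ht hL a b]
  simp only [Fintype.sum_option, Cosmology.timeExtend_nn, Cosmology.timeExtend_ns,
    Cosmology.timeExtend_sn, Cosmology.timeExtend_ss, zero_mul,
    mul_zero, Finset.sum_const_zero, add_zero, zero_add, mul_one]
  rw [Finset.sum_div, Finset.sum_mul, ← Finset.sum_sub_distrib, Finset.mul_sum]
  refine Finset.sum_congr rfl fun c _ => ?_
  rw [Finset.sum_div, Finset.sum_mul, ← Finset.sum_sub_distrib, Finset.mul_sum]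
  refine Finset.sum_congr rfl fun d _ => ?_
  rw [GaugeField.T, Cosmology.metric_ss, S.frameMatrix_apply, S.frameMatrix_apply]
  ring

/-- Trace of the spatial stress. -/
theorem T_trace_frame : ∑ c, ∑ d, (M.h t)⁻¹ c d * A.T (some c) (some d) t
    = A.sgn * ((M.scaleSq t₀ t)⁻¹ * (∑ a, A.frameSq L t₀ t (some a) (some a))
        / (A.p.factorial : ℝ)
      - 3 * ((-A.frameSq L t₀ t none none
        + (M.scaleSq t₀ t)⁻¹ * ∑ a, A.frameSq L t₀ t (some a) (some a))
      / (2 * ((A.p + 1).factorial : ℝ)))) := by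
  have hp := (M.scaleSq_pos ht₀ ht).ne'
  rw [Cosmology.sum_h_inv_frame hM ht₀ ht hL]
  simp only [A.T_ss_frame hM ht₀ ht hL]
  simp only [Fin.sum_univ_three, if_true]
  field_simp
  ring

end frame

end GaugeField

/-! ### Quadratic contractions of alternating forms in four dimensions -/

namespace FrameGeometry

/-- A tensor is totally antisymmetric. -/
def IsAlternating {ι : Type} {k : ℕ} (F : (Fin k → ι) → ℝ) : Prop :=
  ∀ (τ : Equiv.Perm (Fin k)) (μ : Fin k → ι),
    F (fun i => μ (τ i)) = ((Equiv.Perm.sign τ : ℤ) : ℝ) * F μ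

theorem IsAlternating.swap_two {ι : Type} {F : (Fin 2 → ι) → ℝ} (hF : IsAlternating F) (a b : ι) :
    F ![b, a] = -F ![a, b] := by
  have := hF (Equiv.swap 0 1) ![a, b]
  rw [Equiv.Perm.sign_swap (by decide)] at this
  have e : (fun i => ![a, b] (Equiv.swap (0 : Fin 2) 1 i)) = ![b, a] := by
    funext i; fin_cases i <;> rfl
  rw [e] at this
  simpa using this

theorem IsAlternating.swap_left {ι : Type} {F : (Fin 3 → ι) → ℝ} (hF : IsAlternating F)
    (a b c : ι) : F ![b, a, c] = -F ![a, b, c] := by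
  have := hF (Equiv.swap 0 1) ![a, b, c]
  rw [Equiv.Perm.sign_swap (by decide)] at this
  have e : (fun i => ![a, b, c] (Equiv.swap (0 : Fin 3) 1 i)) = ![b, a, c] := by
    funext i; fin_cases i <;> rfl
  rw [e] at this
  simpa using this

theorem IsAlternating.swap_right {ι : Type} {F : (Fin 3 → ι) → ℝ} (hF : IsAlternating F)
    (a b c : ι) : F ![a, c, b] = -F ![a, b, c] := by
  have := hF (Equiv.swap 1 2) ![a, b, c]
  rw [Equiv.Perm.sign_swap (by decide)] at this
  have e : (fun i => ![a, b, c] (Equiv.swap (1 : Fin 3) 2 i)) = ![a, c, b] := by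
    funext i; fin_cases i <;> rfl
  rw [e] at this
  simpa using this

theorem IsAlternating.eq_zero {ι : Type} [DecidableEq ι] {k : ℕ} {F : (Fin k → ι) → ℝ}
    (hF : IsAlternating F) {μ : Fin k → ι} {i j : Fin k} (hij : i ≠ j) (h : μ i = μ j) :
    F μ = 0 := by
  have h1 := hF (Equiv.swap i j) μ
  rw [Equiv.Perm.sign_swap hij] at h1
  have e : (fun l => μ (Equiv.swap i j l)) = μ := by
    funext l
    by_cases hi : l = i
    · rw [hi, Equiv.swap_apply_left, h]
    · by_cases hj : l = j
      · rw [hj, Equiv.swap_apply_right, h]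
      · rw [Equiv.swap_apply_of_ne_of_ne hi hj]
  rw [e] at h1
  simp at h1
  linarith

/-- Contraction of two copies of a tensor over all but the first index, for the diagonal
inverse metric `η`. -/
noncomputable def sqOf {ι : Type} [Fintype ι] (η : ι → ℝ) {p : ℕ} (F : (Fin (p + 1) → ι) → ℝ)
    (μ ν : ι) : ℝ :=
  ∑ γ : Fin p → ι, (∏ i, η (γ i)) * (F (Fin.cons μ γ) * F (Fin.cons ν γ))

theorem sqOf_one {ι : Type} [Fintype ι] (η : ι → ℝ) (F : (Fin 1 → ι) → ℝ) (μ ν : ι) :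
    sqOf η F μ ν = F ![μ] * F ![ν] := by
  rw [sqOf, sum_fin_zero, Fin.prod_univ_zero, one_mul]
  rfl

theorem sqOf_two {ι : Type} [Fintype ι] (η : ι → ℝ) (F : (Fin 2 → ι) → ℝ) (μ ν : ι) :
    sqOf η F μ ν = ∑ κ, η κ * (F ![μ, κ] * F ![ν, κ]) := by
  rw [sqOf, sum_fin_succ]
  refine Finset.sum_congr rfl fun κ _ => ?_
  rw [sum_fin_zero, Fin.prod_univ_one]
  rfl

theorem sqOf_three {ι : Type} [Fintype ι] (η : ι → ℝ) (F : (Fin 3 → ι) → ℝ) (μ ν : ι) :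
    sqOf η F μ ν = ∑ κ, ∑ l, η κ * η l * (F ![μ, κ, l] * F ![ν, κ, l]) := by
  rw [sqOf, sum_fin_succ]
  refine Finset.sum_congr rfl fun κ _ => ?_
  rw [sum_fin_succ]
  refine Finset.sum_congr rfl fun l _ => ?_
  rw [sum_fin_zero, Fin.prod_univ_two]
  rfl

section components

variable {η : SIdx → ℝ} {ψ : ℝ} (hη0 : η none = -1) (hη : ∀ a, η (some a) = ψ)
include hη0 hη

omit hη0 in
theorem sqOf_two_none (F : (Fin 2 → SIdx) → ℝ) (hF : IsAlternating F) :
    sqOf η F none none = ψ * ∑ a, F ![none, some a] ^ 2 := by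
  have h0 : F ![none, none] = 0 := hF.eq_zero (i := 0) (j := 1) (by decide) rfl
  rw [sqOf_two, Fintype.sum_option, h0, Finset.mul_sum]
  simp only [hη]
  rw [mul_zero, mul_zero, zero_add]
  exact Finset.sum_congr rfl fun a _ => by ring

/-- Squares of a two-form in terms of its electric part `E` and its magnetic part `b`. -/
theorem sqOf_two_some {F : (Fin 2 → SIdx) → ℝ} (hF : IsAlternating F) {E b : Fin 3 → ℝ}
    (hE : ∀ a, F ![none, some a] = E a) (hb0 : F ![some 1, some 2] = b 0)
    (hb1 : F ![some 2, some 0] = b 1) (hb2 : F ![some 0, some 1] = b 2) (a c : Fin 3) :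
    sqOf η F (some a) (some c)
      = (if a = c then ψ * ∑ i, b i ^ 2 else 0) - (E a * E c + ψ * (b a * b c)) := by
  have hd : ∀ a : SIdx, F ![a, a] = 0 := fun a => hF.eq_zero (i := 0) (j := 1) (by decide) rfl
  have hE' : ∀ a, F ![some a, none] = -E a := fun a => by rw [hF.swap_two, hE]
  have hb0' : F ![some 2, some 1] = -b 0 := by rw [hF.swap_two, hb0]
  have hb1' : F ![some 0, some 2] = -b 1 := by rw [hF.swap_two, hb1]
  have hb2' : F ![some 1, some 0] = -b 2 := by rw [hF.swap_two, hb2]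
  rw [sqOf_two, Fintype.sum_option, Fin.sum_univ_three, hη0, hη, hη, hη]
  fin_cases a <;> fin_cases c <;>
    simp [hE', hd, hb0, hb1, hb2, hb0', hb1', hb2', Fin.sum_univ_three] <;> ring

/-- The Poynting vector E × b; its vanishing is the parallelism used for degree one. -/
theorem sqOf_two_mixed {F : (Fin 2 → SIdx) → ℝ} (hF : IsAlternating F) {E b : Fin 3 → ℝ}
    (hE : ∀ a, F ![none, some a] = E a) (hb0 : F ![some 1, some 2] = b 0)
    (hb1 : F ![some 2, some 0] = b 1) (hb2 : F ![some 0, some 1] = b 2) :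
    sqOf η F (some 0) none = ψ * (b 2 * E 1 - b 1 * E 2) ∧
    sqOf η F (some 1) none = ψ * (b 0 * E 2 - b 2 * E 0) ∧
    sqOf η F (some 2) none = ψ * (b 1 * E 0 - b 0 * E 1) := by
  have hd : ∀ a : SIdx, F ![a, a] = 0 := fun a => hF.eq_zero (i := 0) (j := 1) (by decide) rfl
  have hb0' : F ![some 2, some 1] = -b 0 := by rw [hF.swap_two, hb0]
  have hb1' : F ![some 0, some 2] = -b 1 := by rw [hF.swap_two, hb1]
  have hb2' : F ![some 1, some 0] = -b 2 := by rw [hF.swap_two, hb2]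
  refine ⟨?_, ?_, ?_⟩ <;>
  · rw [sqOf_two, Fintype.sum_option, Fin.sum_univ_three, hη0, hη, hη, hη]
    simp only [hd, hE, hb0, hb1, hb2, hb0', hb1', hb2']
    ring

/-- Squares of a three-form in terms of its electric part `y` and its magnetic part `f`. -/
theorem sqOf_three_components {F : (Fin 3 → SIdx) → ℝ} (hF : IsAlternating F) {y : Fin 3 → ℝ}
    {f : ℝ} (hy0 : F ![none, some 1, some 2] = y 0) (hy1 : F ![none, some 2, some 0] = y 1)
    (hy2 : F ![none, some 0, some 1] = y 2) (hf : F ![some 0, some 1, some 2] = f) :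
    sqOf η F none none = 2 * ψ ^ 2 * ∑ i, y i ^ 2 ∧
    (∀ a, sqOf η F (some a) none = 2 * ψ ^ 2 * (f * y a)) ∧
    ∀ a c, sqOf η F (some a) (some c) = 2 * ψ * (y a * y c)
      + if a = c then 2 * ψ ^ 2 * f ^ 2 - 2 * ψ * ∑ i, y i ^ 2 else 0 := by
  have hd1 : ∀ a b : SIdx, F ![a, a, b] = 0 := fun a b =>
    hF.eq_zero (i := 0) (j := 1) (by decide) rfl
  have hd2 : ∀ a b : SIdx, F ![a, b, b] = 0 := fun a b =>
    hF.eq_zero (i := 1) (j := 2) (by decide) rfl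
  have hd3 : ∀ a b : SIdx, F ![a, b, a] = 0 := fun a b =>
    hF.eq_zero (i := 0) (j := 2) (by decide) rfl
  have key : ∀ {a b c : SIdx} {x : ℝ}, F ![a, b, c] = x → F ![b, a, c] = -x ∧ F ![a, c, b] = -x ∧
      F ![b, c, a] = x ∧ F ![c, a, b] = x ∧ F ![c, b, a] = -x := by
    intro a b c x h
    have h1 : F ![b, a, c] = -x := by rw [hF.swap_left, h]
    have h2 : F ![a, c, b] = -x := by rw [hF.swap_right, h]
    have h3 : F ![b, c, a] = x := by rw [hF.swap_right, h1, neg_neg]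
    have h4 : F ![c, a, b] = x := by rw [hF.swap_left, h2, neg_neg]
    exact ⟨h1, h2, h3, h4, by rw [hF.swap_right, h4]⟩
  obtain ⟨a1, a2, a3, a4, a5⟩ := key hy0
  obtain ⟨b1, b2, b3, b4, b5⟩ := key hy1
  obtain ⟨c1, c2, c3, c4, c5⟩ := key hy2
  obtain ⟨d1, d2, d3, d4, d5⟩ := key hf
  refine ⟨?_, fun a => ?_, fun a c => ?_⟩
  · simp only [sqOf_three, Fintype.sum_option, Fin.sum_univ_three, hη0, hη, hd1, hd2, hd3, hy0, hy1,
      hy2, hf, a1, a2, a3, a4, a5, b1, b2, b3, b4, b5, c1, c2, c3, c4, c5, d1, d2, d3, d4, d5]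
    ring
  · fin_cases a <;>
      simp [sqOf_three, Fintype.sum_option, Fin.sum_univ_three, hη0, hη, hd1, hd2, hd3, hy0, hy1,
      hy2, hf, a1, a2, a3, a4, a5, b1, b2, b3, b4, b5, c1, c2, c3, c4, c5, d1, d2, d3, d4, d5] <;>
      ring
  · fin_cases a <;> fin_cases c <;>
      simp [sqOf_three, Fintype.sum_option, Fin.sum_univ_three, hη0, hη, hd1, hd2, hd3, hy0, hy1,
      hy2, hf, a1, a2, a3, a4, a5, b1, b2, b3, b4, b5, c1, c2, c3, c4, c5, d1, d2, d3, d4, d5] <;>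
      ring

omit hη0 in
/-- Squares of a four-form are isotropic. -/
theorem sqOf_four {F : (Fin 4 → SIdx) → ℝ} (hF : IsAlternating F) :
    ∃ k, ∀ a c, sqOf η F (some a) (some c) = if a = c then k else 0 := by
  -- A nonzero component uses all four indices exactly once, so the last three determine the first.
  have h1 : ∀ {μ ν : SIdx}, μ ≠ ν → sqOf η F μ ν = 0 := by
    intro μ ν hμν
    refine Finset.sum_eq_zero fun γ _ => ?_
    by_cases h : F (Fin.cons μ γ) = 0
    · rw [h]; ring
    by_cases h' : F (Fin.cons ν γ) = 0
    · rw [h']; ring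
    exfalso
    have hinj : ∀ {σ : SIdx}, F (Fin.cons σ γ) ≠ 0 →
        Function.Injective (Fin.cons σ γ : Fin 4 → SIdx) := by
      intro σ hσ i j hij
      by_contra hne
      exact hσ (hF.eq_zero hne hij)
    have h2 := hinj h
    have h3 := hinj h'
    have h4 : Function.Surjective (Fin.cons μ γ : Fin 4 → SIdx) :=
      ((Fintype.bijective_iff_injective_and_card _).2 ⟨h2, by simp [SIdx]⟩).2
    obtain ⟨i, hi⟩ := h4 ν
    refine Fin.cases (fun hi => ?_) (fun j hi => ?_) i hi
    · exact hμν hi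
    · have : (Fin.cons ν γ : Fin 4 → SIdx) j.succ = (Fin.cons ν γ : Fin 4 → SIdx) 0 := hi
      exact Fin.succ_ne_zero _ (h3 this)
  -- Interchanging two spatial indices permutes the entries, so it changes F only by a sign and
  -- preserves η.
  have h2 : ∀ a c : Fin 3, sqOf η F (some a) (some a) = sqOf η F (some c) (some c) := by
    intro a c
    have hηs : ∀ σ, η (Equiv.swap (some a) (some c) σ) = η σ := by
      intro σ
      by_cases h : σ = some a
      · rw [h, Equiv.swap_apply_left, hη, hη]
      · by_cases h' : σ = some c
        · rw [h', Equiv.swap_apply_right, hη, hη]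
        · rw [Equiv.swap_apply_of_ne_of_ne h h']
    have hsq : ∀ μ : Fin 4 → SIdx, F (fun i => Equiv.swap (some a) (some c) (μ i)) *
        F (fun i => Equiv.swap (some a) (some c) (μ i)) = F μ * F μ := by
      intro μ
      by_cases hinj : Function.Injective μ
      · let e : Fin 4 ≃ SIdx := Equiv.ofBijective μ
          ((Fintype.bijective_iff_injective_and_card _).2 ⟨hinj, by simp [SIdx]⟩)
        have h1 : (fun i => Equiv.swap (some a) (some c) (μ i))
            = fun i => μ ((e.trans ((Equiv.swap (some a) (some c)).trans e.symm)) i) := by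
          funext i
          exact (e.apply_symm_apply _).symm
        rw [h1, hF]
        rcases Int.units_eq_one_or (Equiv.Perm.sign
          (e.trans ((Equiv.swap (some a) (some c)).trans e.symm))) with h | h <;> simp [h]
      · simp only [Function.Injective, not_forall] at hinj
        obtain ⟨i, j, hij, hne⟩ := hinj
        rw [hF.eq_zero hne hij, hF.eq_zero hne (by rw [hij])]
    rw [sqOf, sqOf]
    refine Fintype.sum_equiv (Equiv.arrowCongr (Equiv.refl _) (Equiv.swap (some a) (some c))) _ _
      fun γ => ?_
    have h3 : ∀ i, (Equiv.arrowCongr (Equiv.refl (Fin 3)) (Equiv.swap (some a) (some c))) γ i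
        = Equiv.swap (some a) (some c) (γ i) := fun i => rfl
    simp only [h3, hηs]
    congr 1
    rw [← hsq]
    have h4 : (fun i => Equiv.swap (some a) (some c) ((Fin.cons (some a) γ : Fin 4 → SIdx) i))
        = Fin.cons (some c) ((Equiv.arrowCongr (Equiv.refl (Fin 3))
          (Equiv.swap (some a) (some c))) γ) := by
      funext i
      refine Fin.cases ?_ (fun j => ?_) i
      · exact Equiv.swap_apply_left _ _
      · rfl
    rw [h4]
  refine ⟨sqOf η F (some 0) (some 0), fun a c => ?_⟩
  by_cases h : a = c
  · rw [if_pos h, h, h2 c 0]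
  · rw [if_neg h, h1 (by simpa using h)]

end components

end FrameGeometry

/-! ### Time-independence of the anisotropic stress; exclusion of degrees one and three -/

/-- Two positive tensors of rank one on a three-dimensional space that differ by a multiple of the
metric are equal. -/
theorem eq_zero_of_rank_one_sub {N N' : Fin 3 → Fin 3 → ℝ} {μ : ℝ}
    (h : ∀ a b, N a b = N' a b + if a = b then μ else 0) (hN : 0 ≤ ∑ a, N a a)
    (hN' : 0 ≤ ∑ a, N' a a) (hN2 : ∑ a, ∑ b, N a b ^ 2 = (∑ a, N a a) ^ 2)
    (hN2' : ∑ a, ∑ b, N' a b ^ 2 = (∑ a, N' a a) ^ 2) : μ = 0 := by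
  simp only [h, Fin.sum_univ_three] at *
  simp at *
  -- Squared norm equals squared trace on both sides. The second factor vanishes only if the two
  -- nonnegative traces are opposite, and then μ is zero as well.
  have h1 : μ * (4 * (N' 0 0 + N' 1 1 + N' 2 2) + 6 * μ) = 0 := by linarith
  rcases mul_eq_zero.1 h1 with h2 | h2
  · exact h2
  · linarith

namespace Cosmology

variable {𝔤 : Type} [LieRing 𝔤] [LieAlgebra ℝ 𝔤] {S : HomogeneousSpace 𝔤} (M : Cosmology S)

/-- Ricci tensor of the slices in a frame lifted to `𝔤`. -/
noncomputable def frameRicci (L : Fin 3 → 𝔤) (t : ℝ) (a b : Fin 3) : ℝ :=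
  ∑ c, ∑ d, S.W c (L a) * S.W d (L b) * M.spatial.ricci c d t

variable {M}

/-- A spatial tensor is determined by its components in an orthonormal frame. -/
theorem eq_of_frame {t₀ : ℝ} {L : Fin 3 → 𝔤}
    (hL : ∀ a b, M.bil t₀ (L a) (L b) = if a = b then 1 else 0) {X Y : Fin 3 → Fin 3 → ℝ}
    (h : ∀ a b, ∑ c, ∑ d, S.W c (L a) * S.W d (L b) * X c d
      = ∑ c, ∑ d, S.W c (L a) * S.W d (L b) * Y c d) : X = Y := by
  have hQ := M.frameMatrix_left_inverse hL
  set P := S.frameMatrix L with hP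
  set Q := M.h t₀ * Pᵀ
  have e : ∀ X : Fin 3 → Fin 3 → ℝ, ∀ a b, ∑ c, ∑ d, S.W c (L a) * S.W d (L b) * X c d
      = (P * Matrix.of X * Pᵀ) a b := by
    intro X a b
    rw [Matrix.mul_apply]
    simp only [Matrix.mul_apply, Matrix.transpose_apply, hP, S.frameMatrix_apply, Finset.sum_mul,
      Matrix.of_apply]
    rw [Finset.sum_comm]
    exact Finset.sum_congr rfl fun c _ => Finset.sum_congr rfl fun d _ => by ring
  have e' : ∀ X : Fin 3 → Fin 3 → ℝ, Matrix.of X = Q * (P * Matrix.of X * Pᵀ) * Qᵀ := by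
    intro X
    calc Matrix.of X = (Q * P) * Matrix.of X * (Q * P)ᵀ := by rw [hQ]; simp
      _ = _ := by rw [Matrix.transpose_mul]; simp only [Matrix.mul_assoc]
  have h1 : P * Matrix.of X * Pᵀ = P * Matrix.of Y * Pᵀ := by
    ext a b
    rw [← e, ← e, h]
  have h2 : Matrix.of X = Matrix.of Y := by rw [e' X, e' Y, h1]
  exact Matrix.of.injective h2

/-- The trace-free Ricci tensor does not depend on time, so anisotropy at one instant excludes a
Ricci tensor proportional to the metric at t₀. -/
theorem frameRicci_ne (hM : M.ShearFree) (hA : M.Anisotropic) {t₀ : ℝ} (ht₀ : t₀ ∈ M.I)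
    {L : Fin 3 → 𝔤} (hL : ∀ a b, M.bil t₀ (L a) (L b) = if a = b then 1 else 0) (r : ℝ) :
    ¬ ∀ a b, M.frameRicci L t₀ a b = if a = b then r else 0 := by
  intro h
  obtain ⟨t, ht, a, b, hab⟩ := hA
  rw [M.tracelessRicci_eq ht₀ hM ht] at hab
  have h1 : (fun c d => M.spatial.ricci c d t₀) = fun c d => r * M.h t₀ c d := by
    refine eq_of_frame hL fun a b => ?_
    refine (h a b).trans ?_
    have : ∑ c, ∑ d, S.W c (L a) * S.W d (L b) * (r * M.h t₀ c d) = r * M.bil t₀ (L a) (L b) := by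
      rw [bil, Finset.mul_sum]
      refine Finset.sum_congr rfl fun c _ => ?_
      rw [Finset.mul_sum]
      exact Finset.sum_congr rfl fun d _ => by ring
    rw [this, hL]
    simp
  have h2 : ∀ c d, M.spatial.ricci c d t₀ = r * M.h t₀ c d := fun c d =>
    congrFun (congrFun h1 c) d
  have h3 : M.spatial.scalar t₀ = 3 * r := by
    rw [FrameGeometry.scalar, ← M.sum_inv_h ht₀, Finset.sum_mul]
    refine Finset.sum_congr rfl fun c _ => ?_
    rw [Finset.sum_mul]
    refine Finset.sum_congr rfl fun d _ => ?_
    rw [h2]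
    have : M.spatial.g t₀ = M.h t₀ := rfl
    rw [this]
    ring
  apply hab
  rw [tracelessRicci, h2, h3]
  ring

end Cosmology

namespace ShearFreeSolution

variable {𝔤 : Type} [LieRing 𝔤] [LieAlgebra ℝ 𝔤] {S : HomogeneousSpace 𝔤} {M : Cosmology S}
  (s : ShearFreeSolution M)

theorem friedmann {t : ℝ} (ht : t ∈ M.I) : 3 * M.H t ^ 2 + M.spatial.scalar t / 2
    = s.fluids.totalRho t + s.gauge.energyDensity t := by
  rw [← M.einstein_nn s.shearFree ht, s.einstein t ht, PerfectFluids.T_eq_fluidTensor,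
    M.fluidTensor_nn]
  rfl

theorem flux {t : ℝ} (ht : t ∈ M.I) (a : Fin 3) : s.gauge.T (some a) none t = 0 :=
  s.comoving t ht a

/-- The trace of the spatial Einstein equations. -/
theorem raychaudhuri {t : ℝ} (ht : t ∈ M.I) :
    -M.spatial.scalar t / 2 - 6 * deriv M.H t - 9 * M.H t ^ 2 = 3 * s.fluids.totalP t
      + ∑ c, ∑ d, (M.h t)⁻¹ c d * s.gauge.T (some c) (some d) t := by
  have h1 : ∀ c d, s.gauge.T (some c) (some d) t = M.spatial.ricci c d t
      - (M.spatial.scalar t / 2 + 2 * deriv M.H t + 3 * M.H t ^ 2 + s.fluids.totalP t)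
        * M.h t c d := by
    intro c d
    have := s.einstein t ht (some c) (some d)
    rw [M.einstein_ss s.shearFree ht, PerfectFluids.T_eq_fluidTensor, M.fluidTensor_ss] at this
    linarith
  have h2 : ∑ c, ∑ d, (M.h t)⁻¹ c d * s.gauge.T (some c) (some d) t = M.spatial.scalar t
      - (M.spatial.scalar t / 2 + 2 * deriv M.H t + 3 * M.H t ^ 2 + s.fluids.totalP t)
        * ∑ c, ∑ d, (M.h t)⁻¹ c d * M.h t c d := by
    have hg : M.spatial.g t = M.h t := rfl
    conv_rhs => enter [1]; rw [FrameGeometry.scalar, hg]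
    rw [Finset.mul_sum, ← Finset.sum_sub_distrib]
    refine Finset.sum_congr rfl fun c _ => ?_
    rw [Finset.mul_sum, ← Finset.sum_sub_distrib]
    exact Finset.sum_congr rfl fun d _ => by rw [h1]; ring
  rw [h2, M.sum_inv_h ht]
  ring

/-- Conservation of energy of the gauge field. -/
theorem hasDerivAt_energyDensity {t : ℝ} (ht : t ∈ M.I) :
    HasDerivAt s.gauge.energyDensity (-3 * M.H t * s.gauge.energyDensity t
      - M.H t * ∑ c, ∑ d, (M.h t)⁻¹ c d * s.gauge.T (some c) (some d) t) t := by
  -- The Friedmann constraint is solved for the gauge energy density. All other terms have known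
  -- derivatives, so the field equations are not needed.
  have h1 : s.gauge.energyDensity =ᶠ[nhds t] fun t' => 3 * M.H t' ^ 2
      + M.spatial.scalar t / M.scaleSq t t' / 2 - s.fluids.totalRho t' := by
    filter_upwards [M.mem_nhds ht] with t' ht'
    rw [← M.spatial_scalar_eq ht s.shearFree ht']
    linarith [s.friedmann ht']
  have hp := (M.scaleSq_pos ht ht).ne'
  have h2 : HasDerivAt (fun t' => 3 * M.H t' ^ 2
      + M.spatial.scalar t / M.scaleSq t t' / 2 - s.fluids.totalRho t')
      (3 * (2 * M.H t * deriv M.H t)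
        + ((0 * M.scaleSq t t - M.spatial.scalar t * (2 * M.H t * M.scaleSq t t))
          / M.scaleSq t t ^ 2) / 2
        - (-3 * M.H t * (s.fluids.totalRho t + s.fluids.totalP t))) t := by
    refine HasDerivAt.sub (HasDerivAt.add ?_ (HasDerivAt.div_const ?_ 2))
      (s.fluids.hasDerivAt_totalRho s.shearFree ht)
    · refine HasDerivAt.const_mul 3 ?_
      simpa using (M.hasDerivAt_H s.shearFree ht).fun_pow 2
    · exact (hasDerivAt_const t _).div (M.hasDerivAt_scaleSq s.shearFree ht) hp
  refine (h2.congr_of_eventuallyEq h1).congr_deriv ?_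
  rw [M.scaleSq_self ht]
  have h3 := s.friedmann ht
  have h4 := s.raychaudhuri ht
  linear_combination (-3 * M.H t) * h3 - M.H t * h4

section frame

variable {t₀ t : ℝ} (ht₀ : t₀ ∈ M.I) (ht : t ∈ M.I) {L : Fin 3 → 𝔤}
  (hL : ∀ a b, M.bil t₀ (L a) (L b) = if a = b then 1 else 0)
include ht₀ ht hL

theorem frame_flux (a : Fin 3) : s.gauge.frameSq L t₀ t (some a) none = 0 := by
  have h1 := s.gauge.T_sn_frame s.shearFree ht₀ ht hL a
  have h2 : (s.gauge.p.factorial : ℝ) ≠ 0 := by positivity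
  have h3 : s.gauge.sgn ≠ 0 := by rcases s.gauge.sgn_eq with h | h <;> simp [h]
  have h4 : ∑ c, S.W c (L a) * s.gauge.T (some c) none t = 0 :=
    Finset.sum_eq_zero fun c _ => by rw [s.flux ht, mul_zero]
  rw [h4] at h1
  simpa [h2, h3] using h1.symm

/-- The time t enters only on the right side: the isotropic coefficient may vary with t, while the
Ricci components belong to t₀. This is how the stresses at different times are compared. -/
theorem frame_einstein : ∃ r, ∀ a b, M.frameRicci L t₀ a b = (if a = b then r else 0)
    + s.gauge.sgn * (s.gauge.frameSq L t₀ t (some a) (some b) / (s.gauge.p.factorial : ℝ)) := by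
  have h1 : ∀ c d, M.spatial.ricci c d t₀ = (M.spatial.scalar t / 2 + 2 * deriv M.H t
      + 3 * M.H t ^ 2 + s.fluids.totalP t) * M.h t c d + s.gauge.T (some c) (some d) t := by
    intro c d
    have := s.einstein t ht (some c) (some d)
    rw [M.einstein_ss s.shearFree ht, PerfectFluids.T_eq_fluidTensor, M.fluidTensor_ss] at this
    rw [← M.spatial_ricci_eq ht₀ s.shearFree ht]
    linarith
  refine ⟨(M.spatial.scalar t / 2 + 2 * deriv M.H t
      + 3 * M.H t ^ 2 + s.fluids.totalP t) * M.scaleSq t₀ t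
      - s.gauge.sgn * (M.scaleSq t₀ t * ((-s.gauge.frameSq L t₀ t none none
        + (M.scaleSq t₀ t)⁻¹ * ∑ a, s.gauge.frameSq L t₀ t (some a) (some a))
      / (2 * ((s.gauge.p + 1).factorial : ℝ)))), fun a b => ?_⟩
  have h2 := Cosmology.h_frame s.shearFree ht₀ ht hL a b
  have h3 := s.gauge.T_ss_frame s.shearFree ht₀ ht hL a b
  have h4 : M.frameRicci L t₀ a b = (M.spatial.scalar t / 2 + 2 * deriv M.H t
      + 3 * M.H t ^ 2 + s.fluids.totalP t)
        * (∑ c, ∑ d, S.W c (L a) * S.W d (L b) * M.h t c d)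
      + ∑ c, ∑ d, S.W c (L a) * S.W d (L b) * s.gauge.T (some c) (some d) t := by
    rw [Cosmology.frameRicci, Finset.mul_sum, ← Finset.sum_add_distrib]
    refine Finset.sum_congr rfl fun c _ => ?_
    rw [Finset.mul_sum, ← Finset.sum_add_distrib]
    exact Finset.sum_congr rfl fun d _ => by rw [h1]; ring
  rw [h4, h2, h3]
  split_ifs <;> ring

end frame

theorem frameSq_eq (A : GaugeField M) (L : Fin 3 → 𝔤) (t₀ t : ℝ) (μ ν : SIdx) :
    A.frameSq L t₀ t μ ν
      = FrameGeometry.sqOf (M.frameMetricInv t₀ t) (A.frameF L t) μ ν := rfl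

theorem frameF_alternating (A : GaugeField M) (L : Fin 3 → 𝔤) {t : ℝ} (ht : t ∈ M.I) :
    FrameGeometry.IsAlternating (A.frameF L t) := fun τ μ =>
  FrameGeometry.reframe_perm _ (A.alternating t ht) τ μ

/-- A gauge field whose stress is that of a spatial covector. -/
theorem covector_norm {t₀ : ℝ} (ht₀ : t₀ ∈ M.I) {L : Fin 3 → 𝔤}
    (hL : ∀ a b, M.bil t₀ (L a) (L b) = if a = b then 1 else 0) {z : ℝ → Fin 3 → ℝ}
    (hz : ∀ t ∈ M.I, ∃ r, ∀ a b, M.frameRicci L t₀ a b = (if a = b then r else 0)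
      + s.gauge.sgn * (z t a * z t b)) {t : ℝ} (ht : t ∈ M.I) :
    z t ≠ 0 ∧ ∑ a, z t a ^ 2 = ∑ a, z t₀ a ^ 2 := by
  constructor
  · intro h
    obtain ⟨r, hr⟩ := hz t ht
    refine Cosmology.frameRicci_ne s.shearFree s.anisotropic ht₀ hL r fun a b => ?_
    rw [hr, h]
    simp
  · obtain ⟨r, hr⟩ := hz t ht
    obtain ⟨r', hr'⟩ := hz t₀ ht₀
    have h1 : ∀ a b, z t a * z t b = z t₀ a * z t₀ b
        + if a = b then s.gauge.sgn * (r' - r) else 0 := by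
      intro a b
      have h2 := hr a b
      rw [hr'] at h2
      have h3 : s.gauge.sgn * s.gauge.sgn = 1 := by
        rcases s.gauge.sgn_eq with h | h <;> simp [h]
      split_ifs at h2 ⊢ with h
      · linear_combination (-s.gauge.sgn) * h2 + (z t₀ a * z t₀ b - z t a * z t b) * h3
      · linear_combination (-s.gauge.sgn) * h2 + (z t₀ a * z t₀ b - z t a * z t b) * h3
    -- At two times the rank-one stresses differ by a multiple of the metric, and this multiple must
    -- vanish.
    have h2 := eq_zero_of_rank_one_sub h1
      (Finset.sum_nonneg fun a _ => mul_self_nonneg _)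
      (Finset.sum_nonneg fun a _ => mul_self_nonneg _)
      (by simp only [Fin.sum_univ_three]; ring) (by simp only [Fin.sum_univ_three]; ring)
    refine Finset.sum_congr rfl fun a _ => ?_
    have := h1 a a
    rw [h2] at this
    simp at this
    rw [pow_two, pow_two, this]

/-- There are no solutions with a three-form. -/
theorem p_ne_three : s.gauge.p ≠ 3 := by
  intro hp
  obtain ⟨t₀, ht₀⟩ := M.nonempty
  obtain ⟨L, -, -, -, hL, -⟩ := Cosmology.exists_orthonormal_frame (M := M) ht₀
    (v := Pi.single 0 1) (by simp)
  obtain ⟨r, hr⟩ := s.frame_einstein ht₀ ht₀ hL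
  obtain ⟨k, hk⟩ : ∃ k, ∀ a c, s.gauge.frameSq L t₀ t₀ (some a) (some c) = if a = c then k else 0 := by
    have hF := frameF_alternating s.gauge L ht₀
    simp only [frameSq_eq]
    generalize s.gauge.frameF L t₀ = F at *
    generalize s.gauge.p = p at *
    subst hp
    exact FrameGeometry.sqOf_four (fun a => rfl) hF
  refine Cosmology.frameRicci_ne s.shearFree s.anisotropic ht₀ hL
    (r + s.gauge.sgn * (k / (s.gauge.p.factorial : ℝ))) fun a b => ?_
  rw [hr, hk]
  split_ifs <;> simp

/-- There are no solutions with a one-form. -/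
theorem p_ne_one : s.gauge.p ≠ 1 := by
  intro hp
  obtain ⟨t₀, ht₀⟩ := M.nonempty
  obtain ⟨L, -, -, -, hL, -⟩ := Cosmology.exists_orthonormal_frame (M := M) ht₀
    (v := Pi.single 0 1) (by simp)
  have hsgn : s.gauge.sgn * s.gauge.sgn = 1 := by
    rcases s.gauge.sgn_eq with h | h <;> simp [h]
  have key : ∀ t ∈ M.I, ∃ (N : Fin 3 → Fin 3 → ℝ) (k : ℝ),
      (∀ a c, s.gauge.frameSq L t₀ t (some a) (some c) = (if a = c then k else 0) - N a c) ∧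
      0 ≤ ∑ a, N a a ∧ ∑ a, ∑ b, N a b ^ 2 = (∑ a, N a a) ^ 2 ∧
      s.gauge.energyDensity t = s.gauge.sgn * ((M.scaleSq t₀ t)⁻¹ * (∑ a, N a a) / 2) ∧
      ∑ c, ∑ d, (M.h t)⁻¹ c d * s.gauge.T (some c) (some d) t = s.gauge.energyDensity t := by
    intro t ht
    have hF := frameF_alternating s.gauge L ht
    have hfl := s.frame_flux ht₀ ht hL
    have hT : s.gauge.energyDensity t = _ := s.gauge.T_nn_frame s.shearFree ht₀ ht hL
    have htr := s.gauge.T_trace_frame s.shearFree ht₀ ht hL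
    have hψ : 0 < (M.scaleSq t₀ t)⁻¹ := inv_pos.2 (M.scaleSq_pos ht₀ ht)
    rw [hT, htr]
    simp only [frameSq_eq] at *
    generalize s.gauge.frameF L t = F at *
    clear hT htr
    generalize s.gauge.p = p at *
    subst hp
    have e1 := fun a c => FrameGeometry.sqOf_two_some (M.frameMetricInv_none t₀ t)
      (M.frameMetricInv_some t₀ t) hF (E := fun a => F ![none, some a])
      (b := ![F ![some 1, some 2], F ![some 2, some 0], F ![some 0, some 1]]) (fun _ => rfl)
      rfl rfl rfl a c
    have e2 := FrameGeometry.sqOf_two_none (M.frameMetricInv_some t₀ t) F hF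
    have e3 := FrameGeometry.sqOf_two_mixed (M.frameMetricInv_none t₀ t)
      (M.frameMetricInv_some t₀ t) hF (E := fun a => F ![none, some a])
      (b := ![F ![some 1, some 2], F ![some 2, some 0], F ![some 0, some 1]]) (fun _ => rfl)
      rfl rfl rfl
    rw [hfl, hfl, hfl] at e3
    simp only [Nat.factorial, e2, e1]
    generalize (M.scaleSq t₀ t)⁻¹ = ψ at *
    obtain ⟨E, hE⟩ : ∃ E : Fin 3 → ℝ, E = fun a => F ![none, some a] := ⟨_, rfl⟩
    obtain ⟨b, hb⟩ : ∃ b : Fin 3 → ℝ,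
      b = ![F ![some 1, some 2], F ![some 2, some 0], F ![some 0, some 1]] := ⟨_, rfl⟩
    have hE' : ∀ a, F ![none, some a] = E a := fun a => by rw [hE]
    rw [← hb] at e3 ⊢
    simp only [hE'] at e3 ⊢
    have c1 : b 2 * E 1 - b 1 * E 2 = 0 := by
      simpa [hψ.ne'] using e3.1.symm
    have c2 : b 0 * E 2 - b 2 * E 0 = 0 := by
      simpa [hψ.ne'] using e3.2.1.symm
    have c3 : b 1 * E 0 - b 0 * E 1 = 0 := by
      simpa [hψ.ne'] using e3.2.2.symm
    refine ⟨fun a c => E a * E c + ψ * (b a * b c), ψ * ∑ i, b i ^ 2, fun a c => rfl, ?_, ?_, ?_,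
      ?_⟩
    · exact Finset.sum_nonneg fun a _ => by
        have := mul_self_nonneg (E a)
        have := mul_self_nonneg (b a)
        positivity
    · simp only [Fin.sum_univ_three]
      linear_combination (-2 * ψ) * ((b 2 * E 1 - b 1 * E 2) * c1
        + (b 0 * E 2 - b 2 * E 0) * c2 + (b 1 * E 0 - b 0 * E 1) * c3)
    · simp [Fin.sum_univ_three]
      exact Or.inl (by ring)
    · simp [Fin.sum_univ_three]
      exact Or.inl (by ring)
  choose! N k hN hN0 hN2 hρ htr using key
  -- The anisotropic stress is fixed by the constant Ricci tensor, hence so is its trace.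
  have hw : ∀ t ∈ M.I, ∑ a, N t a a = ∑ a, N t₀ a a := by
    intro t ht
    obtain ⟨r, hr⟩ := s.frame_einstein ht₀ ht hL
    obtain ⟨r', hr'⟩ := s.frame_einstein ht₀ ht₀ hL
    have hp1 : (s.gauge.p.factorial : ℝ) = 1 := by rw [hp]; simp
    have h1 : ∀ a b, N t a b = N t₀ a b
        + if a = b then s.gauge.sgn * (r - r') + k t - k t₀ else 0 := by
      intro a b
      have h2 := hr a b
      rw [hr', hN t ht, hN t₀ ht₀, hp1] at h2
      split_ifs at h2 ⊢ with h
      · linear_combination (s.gauge.sgn) * h2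
          + (N t₀ a b - N t a b - k t₀ + k t) * hsgn
      · linear_combination (s.gauge.sgn) * h2 + (N t₀ a b - N t a b) * hsgn
    have h2 := eq_zero_of_rank_one_sub h1 (hN0 t ht) (hN0 t₀ ht₀) (hN2 t ht) (hN2 t₀ ht₀)
    refine Finset.sum_congr rfl fun a _ => ?_
    have := h1 a a
    rw [h2] at this
    simpa using this
  have hw0 : ∑ a, N t₀ a a ≠ 0 := by
    intro h0
    obtain ⟨r, hr⟩ := s.frame_einstein ht₀ ht₀ hL
    have h1 := hN2 t₀ ht₀
    rw [h0] at h1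
    have h2 : ∀ a b, N t₀ a b = 0 := by
      intro a b
      have h3 : ∑ a, ∑ b, N t₀ a b ^ 2 = 0 := by rw [h1]; ring
      rw [Finset.sum_eq_zero_iff_of_nonneg fun a _ => Finset.sum_nonneg fun b _ => sq_nonneg _]
        at h3
      have h4 := h3 a (Finset.mem_univ a)
      rw [Finset.sum_eq_zero_iff_of_nonneg fun b _ => sq_nonneg _] at h4
      exact pow_eq_zero_iff (two_ne_zero) |>.1 (h4 b (Finset.mem_univ b))
    refine Cosmology.frameRicci_ne s.shearFree s.anisotropic ht₀ hL
      (r + s.gauge.sgn * (k t₀ / (s.gauge.p.factorial : ℝ))) fun a b => ?_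
    rw [hr, hN t₀ ht₀, h2]
    split_ifs <;> simp
  obtain ⟨t, ht, hH⟩ := s.expanding
  set w := ∑ a, N t₀ a a
  have hpos := M.scaleSq_pos ht₀ ht
  have h1 := s.hasDerivAt_energyDensity ht
  rw [htr t ht] at h1
  have h2 : HasDerivAt (fun t' => s.gauge.sgn * ((M.scaleSq t₀ t')⁻¹ * w / 2))
      (s.gauge.sgn * (-(2 * M.H t * M.scaleSq t₀ t) / M.scaleSq t₀ t ^ 2 * w / 2)) t :=
    ((((M.hasDerivAt_scaleSq s.shearFree ht).inv hpos.ne').mul_const w).div_const 2).const_mul _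
  have h3 : s.gauge.energyDensity =ᶠ[nhds t]
      fun t' => s.gauge.sgn * ((M.scaleSq t₀ t')⁻¹ * w / 2) := by
    filter_upwards [M.mem_nhds ht] with t' ht'
    rw [hρ t' ht', hw t' ht']
  -- Conservation gives ρ' = −4Hρ, whereas ρ proportional to 1/φ gives ρ' = −2Hρ. Both hold only if
  -- Hρ = 0.
  have h4 := h1.unique (h2.congr_of_eventuallyEq h3)
  have h5 := h3.self_of_nhds
  rw [h5] at h4
  have h6 : s.gauge.sgn ≠ 0 := by rcases s.gauge.sgn_eq with h | h <;> simp [h]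
  field_simp at h4
  have h7 : s.gauge.sgn * w * M.H t = 0 := by nlinarith
  simp [h6, hw0, hH] at h7

end ShearFreeSolution

/-! ### Hodge duality on the slices for two-form potentials -/

namespace FrameGeometry

variable {ι : Type} [Fintype ι] [DecidableEq ι] (G : FrameGeometry ι)

theorem cov_three (T : ℝ → (Fin 3 → ι) → ℝ) (μ a b c : ι) (t : ℝ) :
    G.cov T μ ![a, b, c] t = G.act μ (fun s => T s ![a, b, c]) t
      - ∑ σ, (G.conn μ a σ t * T t ![σ, b, c] + G.conn μ b σ t * T t ![a, σ, c]
        + G.conn μ c σ t * T t ![a, b, σ]) := by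
  have e0 : ∀ σ, Function.update ![a, b, c] 0 σ = ![σ, b, c] := fun σ => by
    funext i; fin_cases i <;> rfl
  have e1 : ∀ σ, Function.update ![a, b, c] 1 σ = ![a, σ, c] := fun σ => by
    funext i; fin_cases i <;> rfl
  have e2 : ∀ σ, Function.update ![a, b, c] 2 σ = ![a, b, σ] := fun σ => by
    funext i; fin_cases i <;> rfl
  simp only [cov, Fin.sum_univ_three, e0, e1, e2, Finset.sum_add_distrib]
  rfl

end FrameGeometry

/-- In an orthonormal frame of a three-space with connection `K`, a coclosed two-form is dual to a
closed covector. -/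
theorem curl_of_twoForm {K : Fin 3 → Matrix (Fin 3) (Fin 3) ℝ} {B : Matrix (Fin 3) (Fin 3) ℝ}
    (hK : ∀ i a b, K i a b = -K i b a) (hB : ∀ a b, B a b = -B b a)
    (h : ∀ b, ∑ i, (K i * B + B * (K i)ᵀ) i b = 0) (a b : Fin 3) :
    ∑ c, (K a b c - K b a c) * (![B 1 2, B 2 0, B 0 1] : Fin 3 → ℝ) c = 0 := by
  have hB' : ∀ a, B a a = 0 := fun a => by linarith [hB a a]
  have hK' : ∀ i a, K i a a = 0 := fun i a => by linarith [hK i a a]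
  have h0 := h 0
  have h1 := h 1
  have h2 := h 2
  simp only [Matrix.add_apply, Matrix.mul_apply, Matrix.transpose_apply, Fin.sum_univ_three, hB',
    hK', hB 1 0, hB 0 2, hB 2 1, fun i => hK i 1 0, fun i => hK i 0 2, fun i => hK i 2 1]
    at h0 h1 h2
  fin_cases a <;> fin_cases b <;>
    simp [Fin.sum_univ_three, hK', fun i => hK i 1 0, fun i => hK i 0 2,
      fun i => hK i 2 1] <;> linarith

/-- In an orthonormal frame of a three-space with connection `K`, a closed two-form is dual to a
coclosed covector. -/
theorem div_of_twoForm {K : Fin 3 → Matrix (Fin 3) (Fin 3) ℝ} {B : Matrix (Fin 3) (Fin 3) ℝ}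
    (hK : ∀ i a b, K i a b = -K i b a) (hB : ∀ a b, B a b = -B b a)
    (h : (K 0 * B + B * (K 0)ᵀ) 1 2 + (K 1 * B + B * (K 1)ᵀ) 2 0
      + (K 2 * B + B * (K 2)ᵀ) 0 1 = 0) :
    ∑ i, (K i *ᵥ ![B 1 2, B 2 0, B 0 1]) i = 0 := by
  have hB' : ∀ a, B a a = 0 := fun a => by linarith [hB a a]
  have hK' : ∀ i a, K i a a = 0 := fun i a => by linarith [hK i a a]
  simp only [Matrix.add_apply, Matrix.mul_apply, Matrix.transpose_apply, Fin.sum_univ_three, hB',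
    hK', hB 1 0, hB 0 2, hB 2 1, fun i => hK i 1 0, fun i => hK i 0 2, fun i => hK i 2 1] at h
  simp only [Matrix.mulVec, dotProduct, Fin.sum_univ_three, hK', fun i => hK i 1 0,
    fun i => hK i 0 2, fun i => hK i 2 1]
  simp
  linarith

namespace Cosmology

variable {𝔤 : Type} [LieRing 𝔤] [LieAlgebra ℝ 𝔤] {S : HomogeneousSpace 𝔤} {M : Cosmology S}

/-- The connection of the slices in a frame lifted to `𝔤`. -/
noncomputable def frameConn (M : Cosmology S) (t : ℝ) (L : Fin 3 → 𝔤) (a : Fin 3) :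
    Matrix (Fin 3) (Fin 3) ℝ :=
  S.frameMatrix L * M.nomizu t (L a) * (M.h t * (S.frameMatrix L)ᵀ)

section frame

variable {t : ℝ} (ht : t ∈ M.I) {L : Fin 3 → 𝔤}
include ht

theorem frameConn_skew (a b c : Fin 3) : M.frameConn t L a b c = -M.frameConn t L a c b := by
  have h1 := M.nomizu_skew ht (L a)
  have h2 : M.frameConn t L a
      = S.frameMatrix L * (M.nomizu t (L a) * M.h t) * (S.frameMatrix L)ᵀ := by
    simp only [frameConn, Matrix.mul_assoc]
  have h3 : M.frameConn t L a + (M.frameConn t L a)ᵀ = 0 := by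
    have : (S.frameMatrix L * (M.nomizu t (L a) * M.h t) * (S.frameMatrix L)ᵀ)ᵀ
        = S.frameMatrix L * (M.nomizu t (L a) * M.h t)ᵀ * (S.frameMatrix L)ᵀ := by
      simp [Matrix.transpose_mul, Matrix.mul_assoc]
    rw [h2, this, ← Matrix.add_mul, ← Matrix.mul_add, h1]
    simp
  have h4 := congrFun (congrFun h3 b) c
  simp only [Matrix.add_apply, Matrix.transpose_apply, Matrix.zero_apply] at h4
  linarith

theorem frameConn_torsion (hL : ∀ a b, M.bil t (L a) (L b) = if a = b then 1 else 0) (a b : Fin 3) :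
    ⁅L a, L b⁆ - ∑ c, (M.frameConn t L a b c - M.frameConn t L b a c) • L c ∈ S.iso := by
  have hQ := M.frameMatrix_left_inverse hL
  rw [S.mem_iso_iff, map_sub, map_sum, sub_eq_zero, ← M.nomizu_torsion ht]
  have h1 : ∀ a b, S.coords (L b) ᵥ* M.nomizu t (L a)
      = (M.frameConn t L a * S.frameMatrix L) b := by
    intro a b
    rw [frameConn, Matrix.mul_assoc, hQ, Matrix.mul_one]
    rfl
  rw [h1, h1]
  ext d
  simp only [Pi.sub_apply, Matrix.mul_apply, S.frameMatrix_apply, Finset.sum_apply, map_smul,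
    Pi.smul_apply, smul_eq_mul, S.coords_apply, sub_mul, Finset.sum_sub_distrib]

end frame

end Cosmology

namespace GaugeField

open Cosmology

variable {𝔤 : Type} [LieRing 𝔤] [LieAlgebra ℝ 𝔤] {S : HomogeneousSpace 𝔤} {M : Cosmology S}

section threeForm

variable {F : ℝ → (Fin 3 → SIdx) → ℝ} {t : ℝ} (ht : t ∈ M.I)
  (halt : ∀ᶠ s in nhds t, FrameGeometry.IsAlternating (F s))
  (hmag : ∀ᶠ s in nhds t, ∀ a b c, F s ![some a, some b, some c] = 0)
include ht halt hmag

/-- Without a purely spatial part the field is dt wedged with a spatial two-form B, and the terms in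
which the connection mixes space and time vanish; what remains is the covariant derivative of B on
the slice, up to sign. -/
theorem cov_some_threeForm (a b c : Fin 3) :
    M.spacetime.cov F (some a) ![none, some b, some c] t
      = -(M.connMatrix t a * Matrix.of (fun b c => F t ![none, some b, some c])
        + Matrix.of (fun b c => F t ![none, some b, some c]) * (M.connMatrix t a)ᵀ) b c := by
  have hm := hmag.self_of_nhds
  have h0 : ∀ c, F t ![none, none, c] = 0 := fun c =>
    halt.self_of_nhds.eq_zero (i := 0) (j := 1) (by decide) rfl
  have h1 : ∀ c, F t ![none, c, none] = 0 := fun c =>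
    halt.self_of_nhds.eq_zero (i := 0) (j := 2) (by decide) rfl
  rw [FrameGeometry.cov_three, Fintype.sum_option, h0, h1, M.conn_snn ht]
  have hdir : M.spacetime.dir (some a) = 0 := rfl
  simp only [FrameGeometry.act, hdir, hm, M.conn_sss ht, Matrix.add_apply, Matrix.mul_apply,
    Matrix.transpose_apply, connMatrix, Matrix.of_apply, ← Finset.sum_add_distrib]
  simp only [zero_mul, mul_zero, zero_add, add_zero, zero_sub]
  congr 1
  exact Finset.sum_congr rfl fun d _ => by ring

/-- The component of dF with one time index. The time derivative acts only on the vanishing spatial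
part, so B is closed on the slice. -/
theorem closed_threeForm (hcl : ∀ ν, M.spacetime.extDeriv F ν t = 0) (a b c : Fin 3) :
    let B := Matrix.of (fun b c => F t ![none, some b, some c])
    (M.connMatrix t a * B + B * (M.connMatrix t a)ᵀ) b c
      - (M.connMatrix t b * B + B * (M.connMatrix t b)ᵀ) a c
      + (M.connMatrix t c * B + B * (M.connMatrix t c)ᵀ) a b = 0 := by
  intro B
  have h1 := hcl ![none, some a, some b, some c]
  rw [FrameGeometry.extDeriv, Fin.sum_univ_four] at h1
  have e0 : (fun j => (![none, some a, some b, some c] : Fin 4 → SIdx) ((0 : Fin 4).succAbove j))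
      = ![some a, some b, some c] := by funext i; fin_cases i <;> rfl
  have e1 : (fun j => (![none, some a, some b, some c] : Fin 4 → SIdx) ((1 : Fin 4).succAbove j))
      = ![none, some b, some c] := by funext i; fin_cases i <;> rfl
  have e2 : (fun j => (![none, some a, some b, some c] : Fin 4 → SIdx) ((2 : Fin 4).succAbove j))
      = ![none, some a, some c] := by funext i; fin_cases i <;> rfl
  have e3 : (fun j => (![none, some a, some b, some c] : Fin 4 → SIdx) ((3 : Fin 4).succAbove j))
      = ![none, some a, some b] := by funext i; fin_cases i <;> rfl
  rw [e0, e1, e2, e3] at h1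
  have hm := hmag.self_of_nhds
  have h2 : M.spacetime.cov F none ![some a, some b, some c] t = 0 := by
    rw [FrameGeometry.cov_three, Fintype.sum_option]
    have hd : deriv (fun s => F s ![some a, some b, some c]) t = 0 := by
      have : (fun s => F s ![some a, some b, some c]) =ᶠ[nhds t] fun _ => 0 := by
        filter_upwards [hmag] with s hs using hs a b c
      rw [this.deriv_eq]
      simp
    simp [FrameGeometry.act, hd, hm, M.conn_nsn ht]
  have h3 := cov_some_threeForm ht halt hmag
  have f0 : (![none, some a, some b, some c] : Fin 4 → SIdx) 0 = none := rfl
  have f1 : (![none, some a, some b, some c] : Fin 4 → SIdx) 1 = some a := rfl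
  have f2 : (![none, some a, some b, some c] : Fin 4 → SIdx) 2 = some b := rfl
  have f3 : (![none, some a, some b, some c] : Fin 4 → SIdx) 3 = some c := rfl
  rw [f0, f1, f2, f3, h2, h3, h3, h3] at h1
  norm_num at h1
  simp only [Matrix.add_apply, B]
  linarith

/-- The component of the equation of motion with one free time index is the spatial divergence of B.
-/
theorem eom_threeForm (hem : ∀ ν, M.spacetime.divergence F ν t = 0) (b : Fin 3) :
    let B := Matrix.of (fun b c => F t ![none, some b, some c])
    ∑ a, ∑ e, (M.h t)⁻¹ a e * (M.connMatrix t a * B + B * (M.connMatrix t a)ᵀ) e b = 0 := by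
  intro B
  have hm := hmag.self_of_nhds
  have hg : M.spacetime.g t = M.metric t := rfl
  have h0 : ∀ c, F t ![none, none, c] = 0 := fun c =>
    halt.self_of_nhds.eq_zero (i := 0) (j := 1) (by decide) rfl
  have h := hem ![none, some b]
  have e : ∀ κ, (Fin.cons κ ![none, some b] : Fin 3 → SIdx) = ![κ, none, some b] := fun _ => rfl
  simp only [FrameGeometry.divergence, e, Fintype.sum_option, hg, M.metric_inv_nn ht,
    M.metric_inv_ns ht, M.metric_inv_sn ht, M.metric_inv_ss ht] at h
  have h4 : M.spacetime.cov F none ![none, none, some b] t = 0 := by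
    rw [FrameGeometry.cov_three, Fintype.sum_option]
    have hd : deriv (fun s => F s ![none, none, some b]) t = 0 := by
      have : (fun s => F s ![none, none, some b]) =ᶠ[nhds t] fun _ => 0 := by
        filter_upwards [halt] with s hs using hs.eq_zero (i := 0) (j := 1) (by decide) rfl
      rw [this.deriv_eq]
      simp
    simp [FrameGeometry.act, hd, h0, M.conn_nnn, conn_nns]
  have h3 : ∀ a e, M.spacetime.cov F (some a) ![some e, none, some b] t
      = (M.connMatrix t a * B + B * (M.connMatrix t a)ᵀ) e b := by
    intro a e
    have hs : ∀ b c, F t ![some b, none, c] = -F t ![none, some b, c] := fun b c =>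
      halt.self_of_nhds.swap_left _ _ _
    have h1 : F t ![some e, none, none] = 0 :=
      halt.self_of_nhds.eq_zero (i := 1) (j := 2) (by decide) rfl
    have hdir : M.spacetime.dir (some a) = 0 := rfl
    rw [FrameGeometry.cov_three, Fintype.sum_option, h0, h1, M.conn_snn ht]
    simp only [FrameGeometry.act, hdir, hm, hs, M.conn_sss ht, Matrix.add_apply, Matrix.mul_apply,
      Matrix.transpose_apply, connMatrix, Matrix.of_apply, ← Finset.sum_add_distrib, B]
    simp only [zero_mul, mul_zero, zero_add, add_zero, zero_sub, ← Finset.sum_neg_distrib]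
    exact Finset.sum_congr rfl fun d _ => by ring
  simpa [h4, h3] using h

end threeForm

end GaugeField

namespace FrameGeometry

variable {ι : Type} [Fintype ι]

theorem reframe_one (P : Matrix ι ι ℝ) (T : (Fin 1 → ι) → ℝ) (a : ι) :
    reframe P T ![a] = ∑ i, P a i * T ![i] := by
  refine (reframe_cons P T a ![]).trans ?_
  simp only [reframe_zero]
  rfl

theorem reframe_three (P : Matrix ι ι ℝ) (T : (Fin 3 → ι) → ℝ) (a b c : ι) :
    reframe P T ![a, b, c] = ∑ i, P a i * ∑ j, P b j * ∑ k, P c k * T ![i, j, k] := by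
  refine (reframe_cons P T a ![b, c]).trans ?_
  refine Finset.sum_congr rfl fun i _ => ?_
  congr 1
  refine (reframe_cons P _ b ![c]).trans ?_
  refine Finset.sum_congr rfl fun j _ => ?_
  congr 1
  refine (reframe_cons P _ c ![]).trans ?_
  simp only [reframe_zero]
  rfl

end FrameGeometry

namespace Cosmology

variable {𝔤 : Type} [LieRing 𝔤] [LieAlgebra ℝ 𝔤] {S : HomogeneousSpace 𝔤} {M : Cosmology S}

section frame

variable {t₀ : ℝ} (ht₀ : t₀ ∈ M.I) {L : Fin 3 → 𝔤}
  (hL : ∀ a b, M.bil t₀ (L a) (L b) = if a = b then 1 else 0)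
include ht₀ hL

omit ht₀ in
theorem normSq_frame (v : Fin 3 → ℝ) :
    M.normSq v t₀ = ∑ a, (S.frameMatrix L *ᵥ v) a ^ 2 := by
  have e : ∀ a, (S.frameMatrix L *ᵥ v) a ^ 2
      = ∑ c, ∑ d, S.frameMatrix L a c * v c * (S.frameMatrix L a d * v d) := fun a => by
    rw [pow_two, Matrix.mulVec, dotProduct, Finset.sum_mul_sum]
  simp only [e, normSq, M.h_inv_orthonormal hL, Matrix.mul_apply, Matrix.transpose_apply,
    Finset.sum_mul]
  conv_rhs => rw [Finset.sum_comm]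
  refine Finset.sum_congr rfl fun a _ => ?_
  conv_rhs => rw [Finset.sum_comm]
  exact Finset.sum_congr rfl fun b _ => Finset.sum_congr rfl fun c _ => by ring

/-- A source from the components of the Ricci tensor in an orthonormal frame. -/
theorem isSource_of_frame {v : Fin 3 → ℝ} {ε r : ℝ} (hv : v ≠ 0) (hε : ε = 1 ∨ ε = -1)
    (hric : ∀ a b, M.frameRicci L t₀ a b = (if a = b then r else 0)
      + ε * ((S.frameMatrix L *ᵥ v) a * (S.frameMatrix L *ᵥ v) b))
    (h : (∀ Z ∈ S.iso, ∀ b, ∑ c, v c * S.W c ⁅Z, S.E b⁆ = 0) →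
      (∀ X Y : 𝔤, ∑ c, v c * S.W c ⁅X, Y⁆ = 0) ∧
      ∑ a, ∑ b, ∑ c, (M.h t₀)⁻¹ a b * (M.spatial.conn a b c t₀ * v c) = 0) :
    M.IsSource t₀ v ε r := by
  have h1 : (fun c d => M.spatial.ricci c d t₀) = fun c d => r * M.h t₀ c d + ε * (v c * v d) := by
    refine eq_of_frame hL fun a b => (hric a b).trans ?_
    have e1 : ∑ c, ∑ d, S.W c (L a) * S.W d (L b) * (r * M.h t₀ c d + ε * (v c * v d))
        = r * M.bil t₀ (L a) (L b)
          + ε * ((S.frameMatrix L *ᵥ v) a * (S.frameMatrix L *ᵥ v) b) := by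
      have e2 : (S.frameMatrix L *ᵥ v) a * (S.frameMatrix L *ᵥ v) b
          = ∑ c, ∑ d, S.W c (L a) * v c * (S.W d (L b) * v d) := by
        rw [Matrix.mulVec, dotProduct, Matrix.mulVec, dotProduct, Finset.sum_mul_sum]
        rfl
      rw [bil, e2]
      simp only [Finset.mul_sum, ← Finset.sum_add_distrib]
      exact Finset.sum_congr rfl fun c _ => Finset.sum_congr rfl fun d _ => by ring
    rw [e1, hL]
    simp
  have h2 : ∀ c d, M.spatial.ricci c d t₀ = r * M.h t₀ c d + ε * (v c * v d) := fun c d =>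
    congrFun (congrFun h1 c) d
  have hε0 : ε ≠ 0 := by rcases hε with h | h <;> simp [h]
  -- The Ricci equation determines v up to sign, so v is isotropy invariant; this is made available
  -- to the proof that v is closed and coclosed.
  obtain ⟨h3, h4⟩ := h (M.invariant_of_ricci ht₀ h2 hε0 hv)
  exact ⟨hv, hε, h3, h4, h2⟩

/-- A two-form that satisfies the free field equations in three dimensions is dual to a closed and
coclosed covector. -/
theorem harmonic_of_twoForm (hiso : ∀ a, S.isoPart (L a) = 0) {B : Matrix (Fin 3) (Fin 3) ℝ}
    (hB : ∀ a b, B a b = -B b a)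
    (hcl : ∀ a b c, (M.connMatrix t₀ a * B + B * (M.connMatrix t₀ a)ᵀ) b c
      - (M.connMatrix t₀ b * B + B * (M.connMatrix t₀ b)ᵀ) a c
      + (M.connMatrix t₀ c * B + B * (M.connMatrix t₀ c)ᵀ) a b = 0)
    (hem : ∀ b, ∑ a, ∑ e, (M.h t₀)⁻¹ a e
      * (M.connMatrix t₀ a * B + B * (M.connMatrix t₀ a)ᵀ) e b = 0)
    {B' : Matrix (Fin 3) (Fin 3) ℝ} (hB' : B' = S.frameMatrix L * B * (S.frameMatrix L)ᵀ)
    {v : Fin 3 → ℝ} (hv : S.frameMatrix L *ᵥ v = ![B' 1 2, B' 2 0, B' 0 1])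
    (hinv : ∀ Z ∈ S.iso, ∀ b, ∑ c, v c * S.W c ⁅Z, S.E b⁆ = 0) :
    (∀ X Y : 𝔤, ∑ c, v c * S.W c ⁅X, Y⁆ = 0) ∧
      ∑ a, ∑ b, ∑ c, (M.h t₀)⁻¹ a b * (M.spatial.conn a b c t₀ * v c) = 0 := by
  have hQ := M.frameMatrix_left_inverse hL
  have hhinv := M.h_inv_orthonormal hL
  have hPhP := M.frameMatrix_orthonormal hL
  have hbr := frameConn_torsion ht₀ hL
  have hK := frameConn_skew (M := M) ht₀ (L := L)
  set P := S.frameMatrix L with hP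
  set K := M.frameConn t₀ L with hKdef
  have hBskew : ∀ a b, B' a b = -B' b a := by
    have h1 : Bᵀ = -B := by ext a b; exact hB b a
    have h2 : B'ᵀ = -B' := by
      rw [hB', Matrix.transpose_mul, Matrix.transpose_mul, h1, Matrix.transpose_transpose]
      simp [Matrix.mul_assoc]
    intro a b
    exact congrFun (congrFun h2 b) a
  set g : Fin 3 → Matrix (Fin 3) (Fin 3) ℝ :=
    fun a => M.connMatrix t₀ a * B + B * (M.connMatrix t₀ a)ᵀ with hg
  have hgs : ∀ a b c, g a b c = -g a c b := by
    have h1 : Bᵀ = -B := by ext a b; exact hB b a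
    intro a b c
    have h2 : (g a)ᵀ = -g a := by
      rw [hg]
      simp only [Matrix.transpose_add, Matrix.transpose_mul, h1, Matrix.transpose_transpose]
      simp [add_comm]
    exact congrFun (congrFun h2 c) b
  -- The derivative of B transforms as a tensor. The frame is horizontal, so the Nomizu map on it
  -- involves the connection matrices only.
  have hG : ∀ α, K α * B' + B' * (K α)ᵀ = P * (∑ a, P α a • g a) * Pᵀ := by
    intro α
    have h1 : K α * P = P * M.nomizu t₀ (L α) := by
      rw [hKdef, frameConn, Matrix.mul_assoc, hQ, Matrix.mul_one]
    have h2 : M.nomizu t₀ (L α) = ∑ a, P α a • M.connMatrix t₀ a := by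
      have h3 : S.isoRep (L α) = 0 := by
        ext b c
        rw [S.isoRep_apply, hiso]
        simp
      rw [nomizu_apply, h3, add_zero]
      rfl
    have h4 : ∑ a, P α a • g a = M.nomizu t₀ (L α) * B + B * (M.nomizu t₀ (L α))ᵀ := by
      rw [h2, Matrix.transpose_sum]
      simp only [hg, smul_add, Finset.sum_add_distrib, Matrix.sum_mul, Matrix.mul_sum,
        Matrix.transpose_smul, Matrix.smul_mul, Matrix.mul_smul]
    have h5 : K α * B' = P * (M.nomizu t₀ (L α) * B) * Pᵀ := by
      rw [hB', ← Matrix.mul_assoc, ← Matrix.mul_assoc, h1]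
      simp only [Matrix.mul_assoc]
    have h6 : B' * (K α)ᵀ = P * (B * (M.nomizu t₀ (L α))ᵀ) * Pᵀ := by
      have : Pᵀ * (K α)ᵀ = (M.nomizu t₀ (L α))ᵀ * Pᵀ := by
        rw [← Matrix.transpose_mul, h1, Matrix.transpose_mul]
      rw [hB', Matrix.mul_assoc, this]
      simp only [Matrix.mul_assoc]
    rw [h5, h6, h4, Matrix.mul_add, Matrix.add_mul]
  have hG' : ∀ α β γ, (K α * B' + B' * (K α)ᵀ) β γ
      = ∑ a, ∑ b, ∑ c, P α a * P β b * P γ c * g a b c := by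
    intro α β γ
    rw [hG, Matrix.mul_apply]
    simp only [Matrix.mul_apply, Matrix.transpose_apply, Matrix.sum_apply, Matrix.smul_apply,
      smul_eq_mul, Finset.mul_sum, Finset.sum_mul]
    rw [Finset.sum_comm]
    conv_rhs => rw [Finset.sum_comm]
    refine Finset.sum_congr rfl fun b _ => ?_
    rw [Finset.sum_comm]
    exact Finset.sum_congr rfl fun a _ => Finset.sum_congr rfl fun c _ => by ring
  -- The equation of motion of B becomes closedness of the dual covector.
  have hcurl := curl_of_twoForm hK hBskew (by
    intro β
    have h1 : ∀ c, ∑ a, ∑ b, (∑ α, P α a * P α b) * g a b c = 0 := by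
      intro c
      rw [← hem c]
      refine Finset.sum_congr rfl fun a _ => Finset.sum_congr rfl fun b _ => ?_
      rw [hhinv]
      rfl
    simp only [hG']
    calc _ = ∑ c, P β c * ∑ a, ∑ b, (∑ α, P α a * P α b) * g a b c := by
          simp only [Fin.sum_univ_three]
          ring
      _ = 0 := by simp only [h1, mul_zero, Finset.sum_const_zero])
  -- The Bianchi identity of B becomes coclosedness of the dual covector.
  have hdiv := div_of_twoForm hK hBskew (by
    have h1 : ∑ a, ∑ b, ∑ c, P 1 a * P 2 b * P 0 c * g a b c
        = ∑ a, ∑ b, ∑ c, P 0 a * P 1 b * P 2 c * g b c a := by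
      simp only [Fin.sum_univ_three]
      ring
    have h2 : ∑ a, ∑ b, ∑ c, P 2 a * P 0 b * P 1 c * g a b c
        = ∑ a, ∑ b, ∑ c, P 0 a * P 1 b * P 2 c * g c a b := by
      simp only [Fin.sum_univ_three]
      ring
    rw [hG', hG', hG', h1, h2]
    simp only [← Finset.sum_add_distrib]
    refine Finset.sum_eq_zero fun a _ => Finset.sum_eq_zero fun b _ => Finset.sum_eq_zero fun c _ => ?_
    have := hcl a b c
    have := hgs b a c
    linear_combination (P 0 a * P 1 b * P 2 c) * (hcl a b c) + (P 0 a * P 1 b * P 2 c) * hgs b a c)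
  rw [← hv] at hcurl hdiv
  have hvL : ∀ a, ∑ c, v c * S.W c (L a) = (P *ᵥ v) a := fun a => by
    rw [Matrix.mulVec, dotProduct]
    exact Finset.sum_congr rfl fun c _ => mul_comm _ _
  refine ⟨char_of_frame hQ hinv fun a b => ?_, ?_⟩
  · have h1 : ∀ c, S.W c (⁅L a, L b⁆ - ∑ c, (K a b c - K b a c) • L c) = 0 :=
      (S.mem_iso _).1 (hbr a b)
    have h2 : ∀ c, S.W c ⁅L a, L b⁆ = ∑ d, (K a b d - K b a d) * S.W c (L d) := fun c => by
      have := h1 c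
      rw [map_sub, map_sum, sub_eq_zero] at this
      simpa only [map_smul, smul_eq_mul] using this
    rw [← hcurl a b]
    simp only [h2, Finset.mul_sum, ← hvL]
    rw [Finset.sum_comm]
    exact Finset.sum_congr rfl fun d _ => Finset.sum_congr rfl fun c _ => by ring
  · rw [M.divergence_lift ht₀ hQ hbr (K := K) ?_ (fun _ _ _ => rfl) hhinv hinv, ← hP, hdiv]
    intro a
    rw [← hP, hPhP, Matrix.mul_one]
    ext b c
    simp [hK a b c]

end frame

end Cosmology

/-! ### Every solution is supported by a source -/

theorem epsilon_odd : epsilon 1 0 2 = -1 ∧ epsilon 2 0 1 = 1 ∧ epsilon 2 1 0 = -1 := by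
  refine ⟨?_, ?_, ?_⟩ <;> simp [epsilon, Matrix.det_fin_three]

theorem FrameGeometry.IsAlternating.eq_epsilon {ι : Type} [DecidableEq ι] {F : (Fin 3 → ι) → ℝ}
    (hF : FrameGeometry.IsAlternating F) (x : Fin 3 → ι) (a b c : Fin 3) :
    F ![x a, x b, x c] = epsilon a b c * F ![x 0, x 1, x 2] := by
  obtain ⟨e1, e2, e3, e4, e5, e6⟩ := Cosmology.epsilon_table
  obtain ⟨e7, e8, e9⟩ := epsilon_odd
  have h1 : ∀ i j, F ![i, i, j] = 0 := fun i j => hF.eq_zero (i := 0) (j := 1) (by decide) rfl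
  have h2 : ∀ i j, F ![i, j, i] = 0 := fun i j => hF.eq_zero (i := 0) (j := 2) (by decide) rfl
  have h3 : ∀ i j, F ![i, j, j] = 0 := fun i j => hF.eq_zero (i := 1) (j := 2) (by decide) rfl
  by_cases hab : a = b
  · rw [hab, h1, e6, zero_mul]
  by_cases hac : a = c
  · rw [hac, h2, e4, zero_mul]
  by_cases hbc : b = c
  · rw [hbc, h3, e5, zero_mul]
  fin_cases a <;> fin_cases b <;> first | exact absurd rfl hab | skip
  all_goals fin_cases c <;> first | exact absurd rfl hac | exact absurd rfl hbc | skip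
  all_goals simp only [Fin.zero_eta, Fin.mk_one, Fin.reduceFinMk]
  · rw [e1, one_mul]
  · rw [e2, hF.swap_right, neg_one_mul]
  · rw [e7, hF.swap_left, neg_one_mul]
  · rw [e3, hF.swap_right, hF.swap_left, neg_neg, one_mul]
  · rw [e8, hF.swap_left, hF.swap_right, neg_neg, one_mul]
  · rw [e9, hF.swap_left, hF.swap_right, hF.swap_left, neg_neg, neg_one_mul]

namespace ShearFreeSolution

open Cosmology

variable {𝔤 : Type} [LieRing 𝔤] [LieAlgebra ℝ 𝔤] {S : HomogeneousSpace 𝔤} {M : Cosmology S}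
  (s : ShearFreeSolution M)

section frame

variable {t₀ : ℝ} (ht₀ : t₀ ∈ M.I) {L : Fin 3 → 𝔤}
  (hL : ∀ a b, M.bil t₀ (L a) (L b) = if a = b then 1 else 0)
include ht₀ hL

/-- The field equations of a solution whose gauge potential has a given degree. -/
theorem exists_fieldStrength {p : ℕ} (hp : s.gauge.p = p) :
    ∃ F : ℝ → (Fin (p + 1) → SIdx) → ℝ,
      (∀ t ∈ M.I, FrameGeometry.IsAlternating (F t)) ∧
      (∀ t ∈ M.I, ∀ ν, M.spacetime.extDeriv F ν t = 0) ∧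
      (∀ t ∈ M.I, ∀ ν, M.spacetime.divergence F ν t = 0) ∧
      ∃ G : ℝ → (Fin (p + 1) → SIdx) → ℝ,
        (∀ t, G t = FrameGeometry.reframe (timeExtend (S.frameMatrix L)) (F t)) ∧
        (∀ t ∈ M.I, FrameGeometry.IsAlternating (G t)) ∧
        (∀ t ∈ M.I, ∀ a, FrameGeometry.sqOf (M.frameMetricInv t₀ t) (G t) (some a) none = 0) ∧
        (∀ t ∈ M.I, ∃ r, ∀ a b, M.frameRicci L t₀ a b = (if a = b then r else 0) + s.gauge.sgn
          * (FrameGeometry.sqOf (M.frameMetricInv t₀ t) (G t) (some a) (some b) / p.factorial)) ∧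
        (∀ t ∈ M.I, s.gauge.energyDensity t = s.gauge.sgn *
          (FrameGeometry.sqOf (M.frameMetricInv t₀ t) (G t) none none / p.factorial
          + (-FrameGeometry.sqOf (M.frameMetricInv t₀ t) (G t) none none + (M.scaleSq t₀ t)⁻¹
            * ∑ a, FrameGeometry.sqOf (M.frameMetricInv t₀ t) (G t) (some a) (some a))
          / (2 * (p + 1).factorial))) ∧
        (∀ t ∈ M.I, ∑ c, ∑ d, (M.h t)⁻¹ c d * s.gauge.T (some c) (some d) t = s.gauge.sgn *
          ((M.scaleSq t₀ t)⁻¹ * (∑ a, FrameGeometry.sqOf (M.frameMetricInv t₀ t) (G t)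
            (some a) (some a)) / p.factorial
          - 3 * ((-FrameGeometry.sqOf (M.frameMetricInv t₀ t) (G t) none none + (M.scaleSq t₀ t)⁻¹
            * ∑ a, FrameGeometry.sqOf (M.frameMetricInv t₀ t) (G t) (some a) (some a))
          / (2 * (p + 1).factorial)))) := by
  -- Replacing the degree by a variable gives the tensors over `Fin (p + 1)` a literal type once p
  -- is a numeral.
  subst hp
  exact ⟨s.gauge.F, s.gauge.alternating, s.gauge.closed, s.gauge.eom, s.gauge.frameF L,
    fun _ => rfl, fun t ht => frameF_alternating s.gauge L ht,
    fun t ht => s.frame_flux ht₀ ht hL, fun t ht => s.frame_einstein ht₀ ht hL,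
    fun t ht => s.gauge.T_nn_frame s.shearFree ht₀ ht hL,
    fun t ht => s.gauge.T_trace_frame s.shearFree ht₀ ht hL⟩

end frame

/-- A solution is supported by a source whose stress is that of the gauge field. -/
def SupportedBy (t₀ : ℝ) (v : Fin 3 → ℝ) (ε r : ℝ) : Prop :=
  M.IsSource t₀ v ε r ∧ ∀ t ∈ M.I, s.gauge.energyDensity t = ε * M.normSq v t / 2 ∧
    ∑ c, ∑ d, (M.h t)⁻¹ c d * s.gauge.T (some c) (some d) t = -s.gauge.energyDensity t

/-- The flux is the product of the time and space components of F. Anisotropy makes the spatial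
gradient nonzero, so the time component vanishes at all times, and the field equations restrict to
the slice. There they say that the gradient is closed and coclosed. -/
theorem supportedBy_of_p_eq_zero (hp : s.gauge.p = 0) {t₀ : ℝ} (ht₀ : t₀ ∈ M.I) :
    ∃ v ε r, s.SupportedBy t₀ v ε r := by
  obtain ⟨L, -, -, -, hL, -⟩ := exists_orthonormal_frame (M := M) ht₀
    (v := Pi.single 0 1) (by simp)
  obtain ⟨F, halt, hcl, hem, G, hG, hGalt, hfl, hE, hρ, htr⟩ := s.exists_fieldStrength ht₀ hL hp
  set P := S.frameMatrix L with hP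
  simp only [FrameGeometry.sqOf_one, Nat.factorial, Nat.cast_one, div_one] at hfl hE hρ htr
  set z : ℝ → Fin 3 → ℝ := fun t a => G t ![some a] with hz
  have hnorm := fun t ht => s.covector_norm ht₀ hL (z := z) hE (t := t) ht
  have hπG : ∀ t ∈ M.I, G t ![none] = 0 := by
    intro t ht
    obtain ⟨a, ha⟩ := Function.ne_iff.1 (hnorm t ht).1
    exact (mul_eq_zero.1 (hfl t ht a)).resolve_left ha
  have hπ : ∀ t ∈ M.I, F t ![none] = 0 := by
    intro t ht
    have := hπG t ht
    rw [hG, FrameGeometry.reframe_one, Fintype.sum_option] at this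
    simpa using this
  set v : Fin 3 → ℝ := fun c => F t₀ ![some c] with hv
  have hPv : P *ᵥ v = z t₀ := by
    ext a
    rw [hz]
    simp only [hG, FrameGeometry.reframe_one, Fintype.sum_option]
    simp [Matrix.mulVec, dotProduct, hv]
  have hn : ∀ t ∈ M.I, M.normSq v t = (M.scaleSq t₀ t)⁻¹ * ∑ a, z t a ^ 2 := by
    intro t ht
    rw [M.normSq_eq s.shearFree ht₀ ht, normSq_frame hL, (hnorm t ht).2, ← hPv, div_eq_inv_mul]
  obtain ⟨r, hr⟩ := hE t₀ ht₀
  refine ⟨v, s.gauge.sgn, r, isSource_of_frame ht₀ hL ?_ s.gauge.sgn_eq ?_ ?_, fun t ht => ?_⟩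
  · intro h
    rw [h, Matrix.mulVec_zero] at hPv
    exact (hnorm t₀ ht₀).1 hPv.symm
  · rw [← hP, hPv]
    exact hr
  · intro hinv
    have hFv : ∀ t (κ : Fin 1 → SIdx), F t κ = F t ![κ 0] := fun t κ => by
      congr 1; funext i; rw [Subsingleton.elim i 0]; rfl
    have hF : F = fun t κ => (fun s μ => F s ![μ]) t (κ 0) := by
      funext t κ; exact hFv t κ
    have hdir : ∀ a, M.spacetime.dir (some a) = 0 := fun _ => rfl
    have hcov_one := fun μ κ => (congrArg (fun F => M.spacetime.cov F μ κ t₀) hF).trans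
      (FrameGeometry.cov_one _ (fun s μ => F s ![μ]) μ κ t₀)
    have hcov : ∀ a κ, M.spacetime.cov F (some a) κ t₀
        = -∑ σ, M.spacetime.conn (some a) (κ 0) σ t₀ * F t₀ ![σ] := by
      intro a κ
      rw [hcov_one]
      simp [FrameGeometry.act, hdir]
    have hcov' : ∀ a b, M.spacetime.cov F (some a) ![some b] t₀
        = -∑ c, M.spatial.conn a b c t₀ * v c := by
      intro a b
      rw [hcov, Fintype.sum_option, hπ t₀ ht₀]
      simp only [Matrix.cons_val_zero, M.conn_sss ht₀, mul_zero, zero_add]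
      rfl
    constructor
    · have hE1 : S.frameMatrix S.E = 1 := by
        ext a b
        rw [S.frameMatrix_apply, S.W_E, Matrix.one_apply]
        simp [eq_comm]
      refine char_of_frame (L := S.E) (Q := 1) (by rw [hE1, Matrix.mul_one]) hinv fun a b => ?_
      have h1 := hcl t₀ ht₀ ![some a, some b]
      rw [FrameGeometry.extDeriv, Fin.sum_univ_two] at h1
      have e0 : (fun j => (![some a, some b] : Fin 2 → SIdx) ((0 : Fin 2).succAbove j))
          = ![some b] := by funext i; fin_cases i; rfl
      have e1 : (fun j => (![some a, some b] : Fin 2 → SIdx) ((1 : Fin 2).succAbove j))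
          = ![some a] := by funext i; fin_cases i; rfl
      have f0 : (![some a, some b] : Fin 2 → SIdx) 0 = some a := rfl
      have f1 : (![some a, some b] : Fin 2 → SIdx) 1 = some b := rfl
      rw [e0, e1, f0, f1, hcov', hcov'] at h1
      have h2 : ∑ c, v c * S.W c ⁅S.E a, S.E b⁆ = ∑ c, M.spatial.conn a b c t₀ * v c
          - ∑ c, M.spatial.conn b a c t₀ * v c := by
        rw [← Finset.sum_sub_distrib]
        refine Finset.sum_congr rfl fun c _ => ?_
        rw [← sub_mul, M.spatial_conn_torsion ht₀, HomogeneousSpace.D, mul_comm]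
      rw [h2]
      norm_num at h1
      linarith
    · have h1 := hem t₀ ht₀ ![]
      have hg : M.spacetime.g t₀ = M.metric t₀ := rfl
      have e : ∀ κ, (Fin.cons κ ![] : Fin 1 → SIdx) = ![κ] := fun _ => rfl
      simp only [FrameGeometry.divergence, e, Fintype.sum_option, hg, M.metric_inv_nn ht₀,
        M.metric_inv_ns ht₀, M.metric_inv_sn ht₀, M.metric_inv_ss ht₀, hcov'] at h1
      have h2 : M.spacetime.cov F none ![none] t₀ = 0 := by
        have hd : deriv (fun s => F s ![none]) t₀ = 0 := by
          have : (fun s => F s ![none]) =ᶠ[nhds t₀] fun _ => 0 := by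
            filter_upwards [M.mem_nhds ht₀] with t ht using hπ t ht
          rw [this.deriv_eq]
          simp
        rw [hcov_one, Fintype.sum_option]
        simp [FrameGeometry.act, hd, hπ t₀ ht₀, conn_nns]
      rw [h2] at h1
      simpa [Finset.mul_sum] using h1
  · rw [htr t ht, hρ t ht, hn t ht, hπG t ht]
    have e : ∀ a, G t ![some a] = z t a := fun _ => rfl
    simp only [e, pow_two]
    norm_num
    constructor <;> ring

/-- The flux is the product of the purely spatial component f and the dual y of the electric part.
Anisotropy gives y ≠ 0, hence f = 0, and `harmonic_of_twoForm` shows that the dual covector is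
closed and coclosed. -/
theorem supportedBy_of_p_eq_two (hp : s.gauge.p = 2) {t₀ : ℝ} (ht₀ : t₀ ∈ M.I) :
    ∃ v ε r, s.SupportedBy t₀ v ε r := by
  obtain ⟨L, -, -, hiso, hL, -⟩ := exists_orthonormal_frame (M := M) ht₀
    (v := Pi.single 0 1) (by simp)
  obtain ⟨F, halt, hcl, hem, G, hG, hGalt, hfl, hE, hρ, htr⟩ := s.exists_fieldStrength ht₀ hL hp
  have hQ := M.frameMatrix_left_inverse hL
  set P := S.frameMatrix L with hP
  obtain ⟨y, hy⟩ : ∃ y : ℝ → Fin 3 → ℝ, ∀ t, y t = ![G t ![none, some 1, some 2],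
    G t ![none, some 2, some 0], G t ![none, some 0, some 1]] := ⟨_, fun _ => rfl⟩
  obtain ⟨f, hf⟩ : ∃ f : ℝ → ℝ, ∀ t, f t = G t ![some 0, some 1, some 2] := ⟨_, fun _ => rfl⟩
  have hsq := fun t ht => FrameGeometry.sqOf_three_components (M.frameMetricInv_none t₀ t)
    (M.frameMetricInv_some t₀ t) (hGalt t ht) (y := y t) (f := f t) (by simp [hy]) (by simp [hy])
    (by simp [hy]) (hf t).symm
  have hψ : ∀ t ∈ M.I, 0 < (M.scaleSq t₀ t)⁻¹ := fun t ht => inv_pos.2 (M.scaleSq_pos ht₀ ht)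
  -- The stress is the inverse squared scale factor times y⊗y. Its square root is absorbed in z,
  -- whose norm is constant and which agrees with y at t₀.
  obtain ⟨z, hz⟩ : ∃ z : ℝ → Fin 3 → ℝ, ∀ t a, z t a = √(M.scaleSq t₀ t)⁻¹ * y t a :=
    ⟨_, fun _ _ => rfl⟩
  have hzz : ∀ t ∈ M.I, ∀ a b, z t a * z t b = (M.scaleSq t₀ t)⁻¹ * (y t a * y t b) := by
    intro t ht a b
    rw [hz, hz]
    linear_combination (y t a * y t b) * Real.mul_self_sqrt (hψ t ht).le
  have hE' : ∀ t ∈ M.I, ∃ r, ∀ a b, M.frameRicci L t₀ a b = (if a = b then r else 0)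
      + s.gauge.sgn * (z t a * z t b) := by
    intro t ht
    obtain ⟨r, hr⟩ := hE t ht
    refine ⟨r + s.gauge.sgn * ((M.scaleSq t₀ t)⁻¹ ^ 2 * f t ^ 2
      - (M.scaleSq t₀ t)⁻¹ * ∑ i, y t i ^ 2), fun a b => ?_⟩
    rw [hr, (hsq t ht).2.2, hzz t ht]
    simp only [Nat.factorial]
    split_ifs <;> push_cast <;> ring
  have hnorm := fun t ht => s.covector_norm ht₀ hL (z := z) hE' (t := t) ht
  have hf0 : ∀ t ∈ M.I, f t = 0 := by
    intro t ht
    obtain ⟨a, ha⟩ := Function.ne_iff.1 (hnorm t ht).1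
    have h1 : y t a ≠ 0 := fun h => ha (by rw [hz, h, mul_zero]; rfl)
    have h2 := hfl t ht a
    rw [(hsq t ht).2.1] at h2
    have h3 := (hψ t ht).ne'
    have h4 : f t * y t a = 0 := by
      have h5 : 2 * (M.scaleSq t₀ t)⁻¹ ^ 2 ≠ 0 := by positivity
      exact (mul_eq_zero.1 h2).resolve_left h5
    exact (mul_eq_zero.1 h4).resolve_right h1
  have hmag : ∀ t ∈ M.I, ∀ a b c, F t ![some a, some b, some c] = 0 := by
    intro t ht
    have h1 := hf0 t ht
    rw [hf, hG, FrameGeometry.reframe_three] at h1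
    have h2 := (halt t ht).eq_epsilon some
    have h3 : P.det ≠ 0 := by
      intro h
      have := congrArg Matrix.det hQ
      rw [Matrix.det_mul, h, mul_zero, Matrix.det_one] at this
      exact zero_ne_one this
    obtain ⟨φ, hφ⟩ : ∃ φ, φ = F t ![some 0, some 1, some 2] := ⟨_, rfl⟩
    rw [← hφ] at h2
    -- The spatial part has a single independent component, which a change of frame multiplies by
    -- the determinant.
    have h4 : P.det * φ = 0 := by
      rw [← h1, Matrix.det_fin_three]
      simp only [Fintype.sum_option, timeExtend_sn, timeExtend_ss, zero_mul, zero_add, h2]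
      obtain ⟨e1, e2, e3, e4, e5, e6⟩ := epsilon_table
      obtain ⟨e7, e8, e9⟩ := epsilon_odd
      simp only [Fin.sum_univ_three, e1, e2, e3, e4, e5, e6, e7, e8, e9]
      ring
    intro a b c
    rw [h2, (mul_eq_zero.1 h4).resolve_left h3, mul_zero]
  set B : Matrix (Fin 3) (Fin 3) ℝ := Matrix.of fun b c => F t₀ ![none, some b, some c] with hB
  have hB' : ∀ a b, (P * B * Pᵀ) a b = G t₀ ![none, some a, some b] := by
    intro a b
    rw [hG, FrameGeometry.reframe_three]
    simp only [Fintype.sum_option, timeExtend_nn, timeExtend_ns, timeExtend_sn, timeExtend_ss,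
      zero_mul, mul_zero, Finset.sum_const_zero, add_zero, zero_add, one_mul, Matrix.mul_apply,
      Matrix.transpose_apply, Finset.sum_mul, Finset.mul_sum, hB, Matrix.of_apply]
    rw [Finset.sum_comm]
    exact Finset.sum_congr rfl fun i _ => Finset.sum_congr rfl fun j _ => by ring
  have hz₀ : z t₀ = y t₀ := by
    funext a
    rw [hz, M.scaleSq_self ht₀]
    simp
  set v : Fin 3 → ℝ := (M.h t₀ * Pᵀ) *ᵥ y t₀ with hv
  have hPv : P *ᵥ v = y t₀ := by
    rw [hv, Matrix.mulVec_mulVec, mul_eq_one_comm.1 hQ, Matrix.one_mulVec]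
  have hn : ∀ t ∈ M.I, M.normSq v t = (M.scaleSq t₀ t)⁻¹ * ((M.scaleSq t₀ t)⁻¹ * ∑ a, y t a ^ 2) := by
    intro t ht
    have h1 : ∑ a, z t a ^ 2 = (M.scaleSq t₀ t)⁻¹ * ∑ a, y t a ^ 2 := by
      rw [Finset.mul_sum]
      exact Finset.sum_congr rfl fun a _ => by rw [pow_two, hzz t ht, pow_two]
    rw [M.normSq_eq s.shearFree ht₀ ht, normSq_frame hL, ← h1, (hnorm t ht).2, ← hP, hPv, hz₀,
      div_eq_inv_mul]
  obtain ⟨r, hr⟩ := hE' t₀ ht₀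
  have hmag' : ∀ᶠ t in nhds t₀, ∀ a b c, F t ![some a, some b, some c] = 0 := by
    filter_upwards [M.mem_nhds ht₀] with t ht using hmag t ht
  have halt' : ∀ᶠ t in nhds t₀, FrameGeometry.IsAlternating (F t) := by
    filter_upwards [M.mem_nhds ht₀] with t ht using halt t ht
  refine ⟨v, s.gauge.sgn, r, isSource_of_frame ht₀ hL ?_ s.gauge.sgn_eq ?_ fun hinv => ?_,
    fun t ht => ?_⟩
  · intro h
    rw [h, Matrix.mulVec_zero] at hPv
    exact (hnorm t₀ ht₀).1 (hz₀.trans hPv.symm)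
  · rw [← hP, hPv, ← hz₀]
    exact hr
  · refine harmonic_of_twoForm ht₀ hL hiso (B := B) (fun a b => (halt t₀ ht₀).swap_right _ _ _)
      (GaugeField.closed_threeForm ht₀ halt' hmag' (hcl t₀ ht₀))
      (GaugeField.eom_threeForm ht₀ halt' hmag' (hem t₀ ht₀)) rfl ?_ hinv
    rw [← hP, hPv, hB', hB', hB', hy]
  · rw [htr t ht, hρ t ht, hn t ht, (hsq t ht).1]
    simp only [(hsq t ht).2.2, hf0 t ht, Nat.factorial, Fin.sum_univ_three]
    norm_num
    constructor <;> ring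

theorem exists_supportedBy {t₀ : ℝ} (ht₀ : t₀ ∈ M.I) : ∃ v ε r, s.SupportedBy t₀ v ε r := by
  have h1 := s.gauge.p_le
  have h2 := s.p_ne_one
  have h3 := s.p_ne_three
  have h4 : s.gauge.p = 0 ∨ s.gauge.p = 2 := by omega
  rcases h4 with h | h
  · exact s.supportedBy_of_p_eq_zero h ht₀
  · exact s.supportedBy_of_p_eq_two h ht₀

end ShearFreeSolution

/-! ### Uniqueness of the curvature constant and the expansion history -/

namespace Cosmology

variable {𝔤 : Type} [LieRing 𝔤] [LieAlgebra ℝ 𝔤] {S : HomogeneousSpace 𝔤} {M : Cosmology S}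

/-- The isotropic part of the Ricci tensor of a source is unique. -/
theorem IsSource.eq_curvature {t₀ : ℝ} (ht₀ : t₀ ∈ M.I) {v v' : Fin 3 → ℝ} {ε ε' r r' : ℝ}
    (hs : M.IsSource t₀ v ε r) (hs' : M.IsSource t₀ v' ε' r') : r = r' := by
  -- Two covectors in dimension three have a common kernel vector x, and the Ricci curvature of x is
  -- r h(x, x) for both sources. The zero row only pads the matrix.
  obtain ⟨x, hx0, hx⟩ := (Matrix.exists_mulVec_eq_zero_iff (M := Matrix.of ![v, v', 0])).2 (by
    rw [Matrix.det_eq_zero_of_row_eq_zero (2 : Fin 3)]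
    intro j
    simp)
  have hv : ∑ a, v a * x a = 0 := by simpa [Matrix.mulVec, dotProduct] using congrFun hx 0
  have hv' : ∑ a, v' a * x a = 0 := by simpa [Matrix.mulVec, dotProduct] using congrFun hx 1
  have key : ∀ {v : Fin 3 → ℝ} {ε r : ℝ}, M.IsSource t₀ v ε r → ∑ a, v a * x a = 0 →
      ∑ a, ∑ b, x a * x b * M.spatial.ricci a b t₀
        = r * ∑ a, ∑ b, x a * x b * M.h t₀ a b := by
    intro v ε r hs hv
    have h1 : ∑ a, ∑ b, ε * (v a * x a * (v b * x b)) = 0 := by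
      simp only [← Finset.mul_sum, hv, mul_zero, Finset.sum_const_zero]
    rw [← add_zero (r * _), ← h1, Finset.mul_sum, ← Finset.sum_add_distrib]
    refine Finset.sum_congr rfl fun a _ => ?_
    rw [Finset.mul_sum, ← Finset.sum_add_distrib]
    exact Finset.sum_congr rfl fun b _ => by rw [hs.ricci]; ring
  have hpos : 0 < ∑ a, ∑ b, x a * x b * M.h t₀ a b := by
    have := (M.posDef t₀ ht₀).dotProduct_mulVec_pos hx0
    simp only [dotProduct, Matrix.mulVec, Pi.star_apply, star_trivial, Finset.mul_sum] at this
    refine this.trans_eq ?_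
    exact Finset.sum_congr rfl fun a _ => Finset.sum_congr rfl fun b _ => by ring
  exact mul_right_cancel₀ hpos.ne' ((key hs hv).symm.trans (key hs' hv'))

end Cosmology

namespace ShearFreeSolution

open Cosmology

variable {𝔤 : Type} [LieRing 𝔤] [LieAlgebra ℝ 𝔤] {S : HomogeneousSpace 𝔤} {M : Cosmology S}
  (s : ShearFreeSolution M)

/-- The expansion history of a solution is determined by the curvature `r` of its source. -/
theorem SupportedBy.expandsAsFLRW {s : ShearFreeSolution M} {t₀ : ℝ} (ht₀ : t₀ ∈ M.I)
    {v : Fin 3 → ℝ} {ε r : ℝ}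
    (hs : s.SupportedBy t₀ v ε r) {Q : ℝ → Prop} (hQ : ∀ c, 0 < c → Q (c * r)) :
    s.ExpandsAsFLRW Q := by
  have hM := s.shearFree
  have hφ := fun t ht => M.scaleSq_pos ht₀ (t := t) ht
  have hdφ := fun t ht => M.hasDerivAt_scaleSq (t₀ := t₀) hM (t := t) ht
  constructor
  · refine ⟨fun t => √(M.scaleSq t₀ t), fun t ht => ⟨Real.sqrt_pos.2 (hφ t ht), ?_⟩⟩
    have h0 := (Real.sqrt_pos.2 (hφ t ht)).ne'
    refine ((hdφ t ht).sqrt (hφ t ht).ne').congr_deriv ?_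
    rw [div_eq_iff (by positivity)]
    linear_combination (-2 * M.H t) * Real.mul_self_sqrt (hφ t ht).le
  · intro a ha
    -- The norm of v enters ³R and 2ρ_A equally and cancels; only 3r/φ is left.
    have hsc : ∀ t ∈ M.I, M.spatial.scalar t - 2 * s.gauge.energyDensity t
        = 3 * r / M.scaleSq t₀ t := by
      intro t ht
      rw [M.spatial_scalar_eq ht₀ hM ht, hs.1.scalar ht₀, (hs.2 t ht).1, M.normSq_eq hM ht₀ ht]
      ring
    have hconst : ∀ t ∈ M.I, a t ^ 2 / M.scaleSq t₀ t = a t₀ ^ 2 := by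
      intro t ht
      have h1 : ∀ t ∈ M.I, HasDerivAt (fun t => a t ^ 2 / M.scaleSq t₀ t) 0 t := by
        intro t ht
        refine (((ha t ht).2.fun_pow 2).div (hdφ t ht) (hφ t ht).ne').congr_deriv ?_
        have := (hφ t ht).ne'
        rw [div_eq_zero_iff]
        left
        norm_num
        ring
      have := M.eq_of_deriv_eq_zero ht₀ h1 ht
      simpa [M.scaleSq_self ht₀] using this
    have ha0 := (ha t₀ ht₀).1
    refine ⟨a t₀ ^ 2 / 2 * r, hQ _ (by positivity), fun t ht => ?_⟩
    have hK : s.Keff a t = a t₀ ^ 2 / 2 * r := by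
      rw [Keff, hsc t ht, ← hconst t ht]
      ring
    have hKa : a t₀ ^ 2 / 2 * r / a t ^ 2 = r / (2 * M.scaleSq t₀ t) := by
      have h1 := (ha t ht).1
      have h2 := hφ t ht
      rw [← hconst t ht]
      field_simp
    have h3 := s.friedmann ht
    have h4 := s.raychaudhuri ht
    -- The stress trace is minus the energy density, so ρ_A + 3P_A vanishes and the field drops out
    -- of the acceleration equation.
    rw [(hs.2 t ht).2] at h4
    have h5 := hsc t ht
    have h6 : 3 * r / M.scaleSq t₀ t = 6 * (r / (2 * M.scaleSq t₀ t)) := by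
      have := (hφ t ht).ne'
      field_simp
      ring
    rw [h6] at h5
    refine ⟨hK, ?_, ?_, s.fluids.hasDerivAt_totalRho hM ht⟩
    · rw [hKa]
      linarith
    · refine (M.hasDerivAt_H hM ht).congr_deriv ?_
      linarith

/-- The source supporting a given solution need not be the one found from the class of the
spacetime, but both have the same r, so the sign can be taken from the class. -/
theorem expandsAsFLRW_of_isSource {t₀ : ℝ} (ht₀ : t₀ ∈ M.I) {v : Fin 3 → ℝ} {ε r : ℝ}
    (hs : M.IsSource t₀ v ε r) {Q : ℝ → Prop} (hQ : ∀ c, 0 < c → Q (c * r)) :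
    s.ExpandsAsFLRW Q := by
  obtain ⟨v', ε', r', h⟩ := s.exists_supportedBy ht₀
  obtain rfl := hs.eq_curvature ht₀ h.1
  exact h.expandsAsFLRW ht₀ hQ

/-- The spacetimes that admit a shear-free solution. -/
theorem nonempty_iff (hM : M.ShearFree) (hexp : M.Expanding) : Nonempty (ShearFreeSolution M) ↔
    M.IsLRSBianchiIII ∨ M.IsBianchiVI0 ∨ M.IsKantowskiSachs := by
  obtain ⟨t₀, ht₀⟩ := M.nonempty
  constructor
  · rintro ⟨s⟩
    obtain ⟨v, ε, r, h⟩ := s.exists_supportedBy ht₀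
    exact h.1.classification ht₀ hM
  · rintro (h | h | h)
    · obtain ⟨v, ε, r, hs, -⟩ := h.exists_isSource ht₀
      exact ⟨hs.solution ht₀ hM hexp⟩
    · obtain ⟨v, ε, r, hs, -⟩ := h.exists_isSource ht₀
      exact ⟨hs.solution ht₀ hM hexp⟩
    · obtain ⟨v, ε, r, hs, -⟩ := h.exists_isSource ht₀
      exact ⟨hs.solution ht₀ hM hexp⟩

theorem expandsAsFLRW_of_isLRSBianchiIII (h : M.IsLRSBianchiIII) :
    s.ExpandsAsFLRW (fun K => K < 0) := by
  obtain ⟨t₀, ht₀⟩ := M.nonempty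
  obtain ⟨v, ε, r, hs, hr⟩ := h.exists_isSource ht₀
  exact s.expandsAsFLRW_of_isSource ht₀ hs fun c hc => mul_neg_of_pos_of_neg hc hr

theorem expandsAsFLRW_of_isBianchiVI0 (h : M.IsBianchiVI0) :
    s.ExpandsAsFLRW (fun K => K = 0) := by
  obtain ⟨t₀, ht₀⟩ := M.nonempty
  obtain ⟨v, ε, r, hs, hr⟩ := h.exists_isSource ht₀
  exact s.expandsAsFLRW_of_isSource ht₀ hs fun c _ => by rw [hr, mul_zero]

theorem expandsAsFLRW_of_isKantowskiSachs (h : M.IsKantowskiSachs) :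
    s.ExpandsAsFLRW (fun K => 0 < K) := by
  obtain ⟨t₀, ht₀⟩ := M.nonempty
  obtain ⟨v, ε, r, hs, hr⟩ := h.exists_isSource ht₀
  exact s.expandsAsFLRW_of_isSource ht₀ hs fun c hc => mul_pos hc hr

end ShearFreeSolution

/-! ### Examples with exponential expansion -/

namespace Cosmology

variable {𝔤 : Type} [LieRing 𝔤] [LieAlgebra ℝ 𝔤] {S : HomogeneousSpace 𝔤} {M : Cosmology S}

/-- A spatial metric that expands at a uniform rate is shear-free. -/
theorem shearFree_of_deriv {k : ℝ}
    (hd : ∀ t ∈ M.I, ∀ a b, deriv (fun s => M.h s a b) t = 2 * k * M.h t a b) :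
    M.ShearFree ∧ ∀ t ∈ M.I, M.H t = k := by
  have h0 : ∀ t μ ν, M.gradU μ ν t = M.spacetime.conn μ ν none t := by
    intro t μ ν
    rw [gradU, FrameGeometry.cov_one _ fun _ => u, Fintype.sum_option]
    simp [FrameGeometry.act, u]
  have hH : ∀ t ∈ M.I, M.H t = k := by
    intro t ht
    have h1 := M.sum_inv_h ht
    rw [H, div_eq_iff (by norm_num), mul_comm, ← h1, Finset.sum_mul]
    simp only [h0, Fintype.sum_option, M.conn_nnn, M.conn_nsn ht, M.conn_snn ht,
      M.conn_ssn_eq_deriv ht, hd t ht, M.metric_inv_ss ht, mul_zero, zero_add,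
      Finset.sum_const_zero]
    refine Finset.sum_congr rfl fun a _ => ?_
    rw [Finset.sum_mul]
    exact Finset.sum_congr rfl fun b _ => by ring
  refine ⟨fun t ht μ ν => ?_, hH⟩
  rcases μ with _ | a <;> rcases ν with _ | b
  · simp [shear, h0, M.conn_nnn, u]
  · simp [shear, h0, M.conn_nsn ht, M.conn_snn ht, u]
  · simp [shear, h0, M.conn_nsn ht, M.conn_snn ht, u]
  · simp only [shear, h0, M.conn_ssn_eq_deriv ht, hd t ht, hH t ht, metric_ss, u, M.h_symm ht b a]
    ring

end Cosmology

/-- The exponentially expanding flat frame metric. -/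
noncomputable def expMetric (t : ℝ) : Matrix (Fin 3) (Fin 3) ℝ := Real.exp (2 * t) • 1

theorem expMetric_contDiffOn (a b : Fin 3) :
    ContDiffOn ℝ (⊤ : ℕ∞) (fun t => expMetric t a b) Set.univ := by
  simp only [expMetric, Matrix.smul_apply, smul_eq_mul]
  exact ((contDiff_const.mul contDiff_id).exp.mul contDiff_const).contDiffOn

theorem expMetric_posDef (t : ℝ) : (expMetric t).PosDef :=
  Matrix.PosDef.one.smul (Real.exp_pos _)

theorem deriv_expMetric (t : ℝ) (a b : Fin 3) :
    deriv (fun s => expMetric s a b) t = 2 * 1 * expMetric t a b := by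
  have h1 : HasDerivAt (fun s : ℝ => Real.exp (2 * s)) (Real.exp (2 * t) * (2 * 1)) t :=
    ((hasDerivAt_id t).const_mul 2).exp
  simp only [expMetric, Matrix.smul_apply, smul_eq_mul]
  rw [(h1.mul_const _).deriv]
  ring

theorem Cosmology.of_expMetric {𝔤 : Type} [LieRing 𝔤] [LieAlgebra ℝ 𝔤] {S : HomogeneousSpace 𝔤}
    {M : Cosmology S} (hM : M.h = expMetric) : M.ShearFree ∧ M.Expanding := by
  obtain ⟨h1, h2⟩ := Cosmology.shearFree_of_deriv (M := M) (k := 1) fun t _ a b => by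
    rw [hM]; exact deriv_expMetric t a b
  obtain ⟨t, ht⟩ := M.nonempty
  exact ⟨h1, t, ht, by rw [h2 t ht]; norm_num⟩

/-! ### A Kantowski-Sachs spacetime -/

namespace LRSAlgebra

/-- An exponentially expanding Kantowski-Sachs spacetime. -/
noncomputable def expanding (c : ℝ) :
    Cosmology (space c (P := 1) (Q := 1) (Matrix.mul_one 1)) :=
  cosmology c (Matrix.mul_one 1) isOpen_univ Set.univ_nonempty Set.ordConnected_univ
    expMetric_contDiffOn (fun t _ => expMetric_posDef t)
    fun t _ => ⟨Real.exp (2 * t), by rw [Matrix.transpose_one, Matrix.mul_one]; rfl⟩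

/-- Index of the basis vector that generates the translations or a rotation. -/
def basisIndex : Fin 4 ≃ Option (Fin 3) where
  toFun i := match i with
    | 0 => none
    | 1 => some 0
    | 2 => some 1
    | 3 => some 2
  invFun i := match i with
    | none => 0
    | some 0 => 1
    | some 1 => 2
    | some 2 => 3
  left_inv i := by fin_cases i <;> rfl
  right_inv i := by
    rcases i with _ | i
    · rfl
    · fin_cases i <;> rfl

/-- Basis of translations and rotations. -/
noncomputable def basis (c : ℝ) : Module.Basis (Option (Fin 3)) ℝ (LRSAlgebra c) :=
  ((Pi.basisFun ℝ (Fin 4)).map (LinearEquiv.ofBijective mk Function.bijective_id)).reindex basisIndex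

theorem basis_apply (c : ℝ) (i : Option (Fin 3)) :
    basis c i = mk (Pi.single (basisIndex.symm i) 1) := by
  simp [basis]
  rfl

theorem expanding_isKantowskiSachs : (expanding 1).IsKantowskiSachs := by
  obtain ⟨e1, e2, e3, e4, e5, e6⟩ := Cosmology.epsilon_table
  obtain ⟨e7, e8, e9⟩ := epsilon_odd
  have h0 : basisIndex.symm none = 0 := rfl
  have h1 : basisIndex.symm (some 0) = 1 := rfl
  have h2 : basisIndex.symm (some 1) = 2 := rfl
  have h3 : basisIndex.symm (some 2) = 3 := rfl
  refine ⟨basis 1, fun a => ?_, fun a b => ?_, ?_⟩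
  · simp only [basis_apply]
    apply ext' <;> simp only [coord_lie_zero, coord_lie_one, coord_lie_two, coord_lie_three,
      coord_mk, map_zero, h0] <;> simp
  · simp only [basis_apply, Fin.sum_univ_three]
    fin_cases a <;> fin_cases b <;> apply ext' <;>
      simp only [coord_lie_zero, coord_lie_one, coord_lie_two, coord_lie_three, Fin.zero_eta,
        Fin.mk_one, Fin.reduceFinMk, coord_mk, map_add, map_smul, h1, h2, h3, e1, e2, e3, e4, e5,
        e6, e7, e8, e9] <;> simp
  · ext Z
    rw [Submodule.mem_span_singleton, LieSubalgebra.mem_toSubmodule]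
    refine Iff.trans (mem_rot (X := Z)) ⟨fun h => ⟨coord 3 Z, ?_⟩, ?_⟩
    · rw [basis_apply, h3]
      apply ext' <;> rw [map_smul, coord_mk]
      · have : coord 0 Z = 0 := h 0
        simp [this]
      · have : coord 1 Z = 0 := h 1
        simp [this]
      · have : coord 2 Z = 0 := h 2
        simp [this]
      · simp
    · rintro ⟨x, rfl⟩ a
      rw [basis_apply, h3, map_smul, coord_mk]
      fin_cases a <;> simp

end LRSAlgebra

/-! ### Bianchi spacetimes -/

/-- The three-dimensional Lie algebra with `[e_0, e_1] = α e_1`, `[e_0, e_2] = β e_2`. -/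
def SolvableAlgebra (_α _β : ℝ) : Type := Fin 3 → ℝ

namespace SolvableAlgebra

variable {α β : ℝ}

instance : AddCommGroup (SolvableAlgebra α β) := inferInstanceAs (AddCommGroup (Fin 3 → ℝ))
instance : Module ℝ (SolvableAlgebra α β) := inferInstanceAs (Module ℝ (Fin 3 → ℝ))

/-- Coordinates with respect to the basis `e_i`. -/
def coord (i : Fin 3) : SolvableAlgebra α β →ₗ[ℝ] ℝ :=
  LinearMap.proj (R := ℝ) (φ := fun _ : Fin 3 => ℝ) i

/-- The element with given coordinates. -/
def mk : (Fin 3 → ℝ) →ₗ[ℝ] SolvableAlgebra α β := LinearMap.id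

@[simp] theorem coord_mk (x : Fin 3 → ℝ) (i : Fin 3) :
    coord i (mk x : SolvableAlgebra α β) = x i := rfl

instance : Bracket (SolvableAlgebra α β) (SolvableAlgebra α β) where
  bracket X Y := mk ![0, α * (coord 0 X * coord 1 Y - coord 1 X * coord 0 Y),
    β * (coord 0 X * coord 2 Y - coord 2 X * coord 0 Y)]

theorem coord_lie_zero (X Y : SolvableAlgebra α β) : coord 0 ⁅X, Y⁆ = 0 := rfl

theorem coord_lie_one (X Y : SolvableAlgebra α β) :
    coord 1 ⁅X, Y⁆ = α * (coord 0 X * coord 1 Y - coord 1 X * coord 0 Y) := rfl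

theorem coord_lie_two (X Y : SolvableAlgebra α β) :
    coord 2 ⁅X, Y⁆ = β * (coord 0 X * coord 2 Y - coord 2 X * coord 0 Y) := rfl

theorem ext' {X Y : SolvableAlgebra α β} (h0 : coord 0 X = coord 0 Y) (h1 : coord 1 X = coord 1 Y)
    (h2 : coord 2 X = coord 2 Y) : X = Y := by
  refine funext fun i => ?_
  fin_cases i
  exacts [h0, h1, h2]

instance : LieRing (SolvableAlgebra α β) where
  add_lie X Y Z := by
    apply ext' <;> simp only [coord_lie_zero, coord_lie_one, coord_lie_two, map_add] <;> ring
  lie_add X Y Z := by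
    apply ext' <;> simp only [coord_lie_zero, coord_lie_one, coord_lie_two, map_add] <;> ring
  lie_self X := by
    apply ext' <;> simp only [coord_lie_zero, coord_lie_one, coord_lie_two, map_zero] <;> ring
  leibniz_lie X Y Z := by
    apply ext' <;> simp only [coord_lie_zero, coord_lie_one, coord_lie_two, map_add] <;> ring

instance : LieAlgebra ℝ (SolvableAlgebra α β) where
  lie_smul r X Y := by
    apply ext' <;> simp only [coord_lie_zero, coord_lie_one, coord_lie_two, map_smul,
      smul_eq_mul] <;> ring

/-- Basis vector. -/
def e (i : Fin 3) : SolvableAlgebra α β := mk (Pi.single i 1)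

theorem lie_e_zero_one : ⁅(e 0 : SolvableAlgebra α β), (e 1 : SolvableAlgebra α β)⁆ = α • e 1 := by
  apply ext' <;> simp only [coord_lie_zero, coord_lie_one, coord_lie_two, map_smul, e, coord_mk] <;>
    simp

theorem lie_e_zero_two : ⁅(e 0 : SolvableAlgebra α β), (e 2 : SolvableAlgebra α β)⁆ = β • e 2 := by
  apply ext' <;> simp only [coord_lie_zero, coord_lie_one, coord_lie_two, map_smul, e, coord_mk] <;>
    simp

theorem lie_e_one_two : ⁅(e 1 : SolvableAlgebra α β), (e 2 : SolvableAlgebra α β)⁆ = 0 := by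
  apply ext' <;> simp only [coord_lie_zero, coord_lie_one, coord_lie_two, map_zero, e, coord_mk] <;>
    simp

/-- The simply transitive homogeneous space of the algebra. -/
def space (α β : ℝ) : HomogeneousSpace (SolvableAlgebra α β) where
  iso := ⊥
  E := e
  W := coord
  W_E a b := by simp [e, Pi.single_apply]
  mem_iso Z := by
    rw [LieSubalgebra.mem_bot]
    refine ⟨fun h a => by rw [h, map_zero], fun h => ?_⟩
    apply ext' <;> rw [h, map_zero]
  reductive Z hZ a := by
    rw [LieSubalgebra.mem_bot] at hZ
    simp [hZ]
  effective Z hZ _ := by rwa [LieSubalgebra.mem_bot] at hZ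

/-- An exponentially expanding Bianchi spacetime. -/
noncomputable def expanding (α β : ℝ) : Cosmology (space α β) where
  I := Set.univ
  isOpen := isOpen_univ
  nonempty := Set.univ_nonempty
  ordConnected := Set.ordConnected_univ
  h := expMetric
  smooth := expMetric_contDiffOn
  posDef t _ := expMetric_posDef t
  invariant Z hZ t _ a b := by
    have : Z = 0 := hZ
    simp [this]

theorem bil_e (a b : Fin 3) : (expanding α β).bil 0 (e a) (e b) = if a = b then 1 else 0 := by
  have h1 : ∀ a b, (space α β).W a (e b) = if a = b then 1 else 0 := (space α β).W_E
  have h2 : (expanding α β).h = expMetric := rfl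
  simp [Cosmology.bil, h1, h2, expMetric, Matrix.one_apply, eq_comm]

theorem expanding_isLRSBianchiIII : (expanding 0 1).IsLRSBianchiIII := by
  have hM := (Cosmology.of_expMetric (M := expanding 0 1) rfl).1
  -- With α = 0 the central vector is e 1, and the frame lemmas expect it in position zero.
  let L : Fin 3 → SolvableAlgebra 0 1 := ![e 1, e 0, e 2]
  have hL : ∀ a b : Fin 3, (expanding 0 1).bil 0 (L a) (L b) = if a = b then 1 else 0 := by
    intro a b
    fin_cases a <;> fin_cases b <;> simp [L, bil_e]
  have b01 : ⁅L 0, L 1⁆ = 0 := by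
    rw [← lie_skew]
    exact (congrArg Neg.neg lie_e_zero_one).trans (by rw [zero_smul, neg_zero])
  have b02 : ⁅L 0, L 2⁆ = 0 := lie_e_one_two
  have b12 : ⁅L 1, L 2⁆ = (0 : ℝ) • L 1 + (1 : ℝ) • L 2 := by
    rw [zero_smul, zero_add]
    exact lie_e_zero_two
  exact ⟨Cosmology.isLRS_of_frame (Set.mem_univ _) hM rfl hL b01 b02 b12,
    Cosmology.isTracefreeBianchiIII_of_frame (Set.mem_univ _) hM rfl hL b01 b02 b12 (by norm_num)⟩

theorem expanding_isBianchiVI0 : (expanding (-1) 1).IsBianchiVI0 := by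
  have hM := (Cosmology.of_expMetric (M := expanding (-1) 1) rfl).1
  refine Cosmology.isBianchiVI0_of_frame (Set.mem_univ 0) hM rfl (L := e) bil_e (s := -1) (p := 0)
    (μ := 1) ?_ ?_ lie_e_one_two (by norm_num) (by norm_num) (by norm_num)
  · rw [lie_e_zero_one, zero_smul, add_zero]
  · rw [lie_e_zero_two, zero_smul, zero_add, neg_neg]

end SolvableAlgebra

theorem theorem1 :
    (∀ (𝔤 : Type) [LieRing 𝔤] [LieAlgebra ℝ 𝔤] (S : HomogeneousSpace 𝔤) (M : Cosmology S),
      M.ShearFree → M.Expanding →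
        (Nonempty (ShearFreeSolution M) ↔
          M.IsLRSBianchiIII ∨ M.IsBianchiVI0 ∨ M.IsKantowskiSachs) ∧
        ∀ s : ShearFreeSolution M,
          (M.IsLRSBianchiIII → s.ExpandsAsFLRW (fun K => K < 0)) ∧
          (M.IsBianchiVI0 → s.ExpandsAsFLRW (fun K => K = 0)) ∧
          (M.IsKantowskiSachs → s.ExpandsAsFLRW (fun K => 0 < K))) ∧
    (∃ (𝔤 : Type) (_ : LieRing 𝔤) (_ : LieAlgebra ℝ 𝔤) (S : HomogeneousSpace 𝔤)
      (M : Cosmology S), M.IsLRSBianchiIII ∧ Nonempty (ShearFreeSolution M)) ∧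
    (∃ (𝔤 : Type) (_ : LieRing 𝔤) (_ : LieAlgebra ℝ 𝔤) (S : HomogeneousSpace 𝔤)
      (M : Cosmology S), M.IsBianchiVI0 ∧ Nonempty (ShearFreeSolution M)) ∧
    (∃ (𝔤 : Type) (_ : LieRing 𝔤) (_ : LieAlgebra ℝ 𝔤) (S : HomogeneousSpace 𝔤)
      (M : Cosmology S), M.IsKantowskiSachs ∧ Nonempty (ShearFreeSolution M)) := by
  refine ⟨fun 𝔤 _ _ S M hM hexp => ⟨ShearFreeSolution.nonempty_iff hM hexp, fun s =>
    ⟨s.expandsAsFLRW_of_isLRSBianchiIII, s.expandsAsFLRW_of_isBianchiVI0,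
      s.expandsAsFLRW_of_isKantowskiSachs⟩⟩, ?_, ?_, ?_⟩
  · obtain ⟨hM, hexp⟩ := Cosmology.of_expMetric (M := SolvableAlgebra.expanding 0 1) rfl
    have h := SolvableAlgebra.expanding_isLRSBianchiIII
    exact ⟨_, _, _, _, _, h, (ShearFreeSolution.nonempty_iff hM hexp).2 (Or.inl h)⟩
  · obtain ⟨hM, hexp⟩ := Cosmology.of_expMetric (M := SolvableAlgebra.expanding (-1) 1) rfl
    have h := SolvableAlgebra.expanding_isBianchiVI0
    exact ⟨_, _, _, _, _, h, (ShearFreeSolution.nonempty_iff hM hexp).2 (Or.inr (Or.inl h))⟩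
  · obtain ⟨hM, hexp⟩ := Cosmology.of_expMetric (M := LRSAlgebra.expanding 1) rfl
    have h := LRSAlgebra.expanding_isKantowskiSachs
    exact ⟨_, _, _, _, _, h, (ShearFreeSolution.nonempty_iff hM hexp).2 (Or.inr (Or.inr h))⟩
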